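/- Let $n\ge 3$, $0<x_0<1$, and let $\mathring h$ be the round metric of the unit sphere $\mathbb S^{n-1}\subset\mathbb R^n$. On the collar $(0,x_0)\times\mathbb S^{n-1}$, with coordinates $(x,\theta)$ and local coordinates $(x^i)=(x,x^A)$, let $$\mathring g=x^{-2}\Big(\mathrm dx^2+\big(1-\tfrac{x^2}{4}\big)^2\mathring h\Big)$$ be the hyperbolic reference metric. We say that a metric $g$ has *the asymptotic form* $(\ast)$ in the coordinates $(x,\theta)$ if, as $x\to0$, $$g=x^{-2}\Big(\mathrm dx^2+\big(1-\tfrac{x^2}{4}\big)^2\mathring h+x^n\mu\Big)+o(x^{n-2})\,\mathrm dx^i\mathrm dx^j,\qquad \mu=\mu_{AB}(\theta)\,\mathrm dx^A\mathrm dx^B,\tag{$\ast$}$$ with $\mu$ a symmetric 2-tensor of class $C^2$ on $\mathbb S^{n-1}$. Its energy-momentum covector in these coordinates is $$m_0=c_n\int_{\mathbb S^{n-1}}\mathrm{tr}_{\mathring h}\mu\;d\mu_{\mathring h},\qquad m_i=c_n\int_{\mathbb S^{n-1}}\theta^i\,\mathrm{tr}_{\mathring h}\mu\;d\mu_{\mathring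 h}\quad(1\le i\le n),$$ where $c_n>0$ is any fixed normalising constant. Let $M$ be an $n$-dimensional smooth manifold with a Riemannian metric $g$ of class $C^k$, $2\le k\le\infty$, and let an open subset of $M$ be diffeomorphic to, and identified with, the collar $(0,x_0)\times\mathbb S^{n-1}$, where for each $\delta<x_0$ the set $\{0<x\le\delta\}$ is closed in $M$ (so $x\to0$ is an end of $M$). Suppose that $g$ has the form $(\ast)$ on the collar, with energy-momentum covector $(m_0,\dots,m_n)$, that $$x^{-1}(R[g]-R[\mathring g])\in L^1\big(\{0<x<x_0\},d\mu_g\big),$$ and that $\lambda=g-\mathring g$ satisfies, for some constant $C_1$, $$\sum_{0\le l\le2}\Big(|\mathring\nabla^l\lambda|_{\mathring g}+x^{-1}|\mathring\nabla^l\mathring{\mathcal D}\lambda|_{\mathring g}\Big)\le C_1x^n\qquad\text{on }\{0<x<x_0\}.$$ Here $R$ is the scalar curvature, $\mathring\nabla$ is the Levi-Civita connection of $\mathring g$, $\mathring{\mathcal D}$ is the covariant derivative of $\mathring h$ in the directions tangent to the spheres, and $\mathring{\mathcal D}\lambda$ is assumed twice differentiable. Let $(\tilde m_0,\dots,\tilde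 m_n)\in\mathbb R^{n+1}$ lie to the chronological future of $(m_0,\dots,m_n)$, that is, $\tilde m_0>m_0$ and $(\tilde m_0-m_0)^2-\sum_{i\ge1}(\tilde m_i-m_i)^2>0$. Then there exists $0<\epsilon_0<x_0/4$ such that for all $0<\epsilon<\epsilon_0$ there is a $C^k$ metric $g_\epsilon$ on $M$ such that 1. $0\le R[g_\epsilon]-R[g]$, and $R[g_\epsilon]-R[g]=O(x^{n+2})$ on the collar for each $\epsilon$ (the constant may depend on $\epsilon$); 2. $g_\epsilon$ coincides with $g$ outside of $\{0<x\le4\epsilon\}$; 3. after a change of coordinates near infinity of the form $(x,\theta)\mapsto(x+x^{n+1}\psi_\epsilon(\theta),\theta)$, with $\psi_\epsilon$ a smooth function on $\mathbb S^{n-1}$, $g_\epsilon$ has the form $(\ast)$, and its energy-momentum covector $(m^\epsilon_0,\dots,m^\epsilon_n)$ in these coordinates satisfies $m^\epsilon_\nu\to\tilde m_\nu$ as $\epsilon\to0$, for $0\le\nu\le n$. In particular, if $(m_\nu)$ is timelike and past pointing, that is, $m_0<0$ and $m_0^2>\sum_{i\ge1}m_i^2$, there are such metrics $g_\epsilon$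 with $m^\epsilon_\nu\to0$ as $\epsilon\to0$. -/

import Mathlib

open scoped Manifold ContDiff Topology
open MeasureTheory

noncomputable section

namespace AHMass

/-- Euclidean `n`-space, with coordinates `y = (y₁, …, yₙ)`. -/
abbrev E (n : ℕ) : Type := EuclideanSpace ℝ (Fin n)

/-! ### Tensor calculus in coordinates

A metric on (an open subset of) `ℝⁿ` is given by its matrix of components, a covariant tensor field
of rank `k` by its array of components `T y I`, with `I : Fin k → Fin n` the list of its indices. -/

/-- The partial derivative `∂f/∂yᵢ`. -/
def pd {n : ℕ} (i : Fin n) (f : E n → ℝ) (y : E n) : ℝ :=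
  fderiv ℝ f y (EuclideanSpace.single i 1)

/-- The Christoffel symbol `Γˡᵢⱼ = ½ gˡᵐ (∂ᵢ gₘⱼ + ∂ⱼ gₘᵢ - ∂ₘ gᵢⱼ)`. -/
def christoffel {n : ℕ} (G : E n → Matrix (Fin n) (Fin n) ℝ) (l i j : Fin n) (y : E n) : ℝ :=
  (1 / 2) * ∑ m, (G y)⁻¹ l m *
    (pd i (fun z => G z m j) y + pd j (fun z => G z m i) y - pd m (fun z => G z i j) y)

/-- The Ricci tensor `Rᵢⱼ = ∂ₗ Γˡᵢⱼ - ∂ⱼ Γˡᵢₗ + Γˡₗₘ Γᵐᵢⱼ - Γˡⱼₘ Γᵐᵢₗ`. -/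
def ricci {n : ℕ} (G : E n → Matrix (Fin n) (Fin n) ℝ) (i j : Fin n) (y : E n) : ℝ :=
  ∑ l, pd l (christoffel G l i j) y - ∑ l, pd j (christoffel G l i l) y
    + ∑ l, ∑ m, christoffel G l l m y * christoffel G m i j y
    - ∑ l, ∑ m, christoffel G l j m y * christoffel G m i l y

/-- The scalar curvature `R[g] = gⁱʲ Rᵢⱼ`. -/
def scalarCurvature {n : ℕ} (G : E n → Matrix (Fin n) (Fin n) ℝ) (y : E n) : ℝ :=
  ∑ i, ∑ j, (G y)⁻¹ i j * ricci G i j y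

/-- The covariant derivative, for the Levi-Civita connection of `G`, of a covariant tensor field:
`(∇T)_{i j₁ … jₖ} = ∂ᵢ T_{j₁ … jₖ} - ∑ₐ Γˡ_{i jₐ} T_{j₁ … l … jₖ}` (with `l` at place `a`).
The index of differentiation comes first. -/
def covDeriv {n k : ℕ} (G : E n → Matrix (Fin n) (Fin n) ℝ) (T : E n → (Fin k → Fin n) → ℝ)
    (y : E n) (I : Fin (k + 1) → Fin n) : ℝ :=
  pd (I 0) (fun z => T z (Fin.tail I)) y
    - ∑ a : Fin k, ∑ l : Fin n,
        christoffel G l (I 0) (Fin.tail I a) y * T y (Function.update (Fin.tail I) a l)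

/-- The pointwise norm `|t|_g`, `|t|² = g^{i₁j₁} ⋯ g^{iₖjₖ} t_{i₁…iₖ} t_{j₁…jₖ}`, of a covariant
tensor, the metric at the point having the matrix `A`. -/
def tensorNorm {n k : ℕ} (A : Matrix (Fin n) (Fin n) ℝ) (t : (Fin k → Fin n) → ℝ) : ℝ :=
  √(∑ I : Fin k → Fin n, ∑ J : Fin k → Fin n, (∏ a, A⁻¹ (I a) (J a)) * t I * t J)

/-- `∑_{0 ≤ l ≤ 2} |∇ˡ T|_g` at the point `y`. -/
def normC2 {n k : ℕ} (G : E n → Matrix (Fin n) (Fin n) ℝ) (T : E n → (Fin k → Fin n) → ℝ)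
    (y : E n) : ℝ :=
  tensorNorm (G y) (T y) + tensorNorm (G y) (covDeriv G T y)
    + tensorNorm (G y) (covDeriv G (covDeriv G T) y)

/-- A matrix as an array of components of a tensor of rank two. -/
def toTensor {n : ℕ} (A : Matrix (Fin n) (Fin n) ℝ) : (Fin 2 → Fin n) → ℝ :=
  fun I => A (I 0) (I 1)

/-! ### The collar `(0, x₀) × 𝕊ⁿ⁻¹`

It is identified with the punctured ball `0 < ‖y‖ < x₀` of `ℝⁿ` through `(x, θ) ↦ y = x θ`. Thus
`x = ‖y‖` and `θ = y / ‖y‖`, the conformal boundary `x = 0` corresponds to `y → 0`, and the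
vector field `∂_x` is `θ`. -/

/-- The collar `{0 < x < x₀}`. -/
def collar (n : ℕ) (x₀ : ℝ) : Set (E n) := {y | 0 < ‖y‖ ∧ ‖y‖ < x₀}

/-- The point `θ = y / ‖y‖` of the unit sphere. -/
def angle {n : ℕ} (y : E n) : E n := ‖y‖⁻¹ • y

/-- The tensor `dx²` on the collar. -/
def dxSq {n : ℕ} (y : E n) : Matrix (Fin n) (Fin n) ℝ :=
  Matrix.of fun i j => angle y i * angle y j

/-- The round metric `h̊ = h̊_AB(θ) dxᴬ dxᴮ` of the unit sphere, pulled back to the collar: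
the Euclidean metric is `dx² + x² h̊`. -/
def roundMetric {n : ℕ} (y : E n) : Matrix (Fin n) (Fin n) ℝ :=
  (‖y‖ ^ 2)⁻¹ • (1 - dxSq y)

/-- The product metric `dx² + h̊`, smooth up to the conformal boundary of the compactified collar. -/
def productMetric {n : ℕ} (y : E n) : Matrix (Fin n) (Fin n) ℝ := dxSq y + roundMetric y

/-- The hyperbolic reference metric `g̊ = x⁻² (dx² + (1 - x²/4)² h̊)`. -/
def hyperbolicMetric {n : ℕ} (y : E n) : Matrix (Fin n) (Fin n) ℝ :=
  (‖y‖ ^ 2)⁻¹ • (dxSq y + (1 - ‖y‖ ^ 2 / 4) ^ 2 • roundMetric y)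

/-- The covariant derivative `D̊` of `h̊`, in the directions tangent to the spheres `{x} × 𝕊ⁿ⁻¹`, of
all the components `T_{x…x A…B}` of a tensor field on the collar. This is the Levi-Civita derivative
of the product `dx² + h̊`, with its derivative slot projected along `∂_x`. -/
def sphereDeriv {n k : ℕ} (T : E n → (Fin k → Fin n) → ℝ) (y : E n)
    (I : Fin (k + 1) → Fin n) : ℝ :=
  ∑ l, (1 - dxSq y) (I 0) l * covDeriv productMetric T y (Fin.cons l (Fin.tail I))

/-- A twice continuously differentiable field `μ = μ_AB(θ) dxᴬ dxᴮ` of symmetric two-tensors on the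
unit sphere. The form on `T_θ 𝕊ⁿ⁻¹ = θ^⊥` is extended by zero to `θ` and given by its matrix in
`ℝⁿ`; only the values at unit vectors matter. -/
structure IsSphereTensor {n : ℕ} (μ : E n → Matrix (Fin n) (Fin n) ℝ) : Prop where
  symm : ∀ θ : E n, ‖θ‖ = 1 → (μ θ).IsSymm
  tangential : ∀ θ : E n, ‖θ‖ = 1 → ∀ i, ∑ j, μ θ i j * θ j = 0
  contDiffOn : ∀ i j, ContDiffOn ℝ 2 (fun y : E n => μ (angle y) i j) {0}ᶜ

/-- The pullback of `μ` to the collar under the projection `(x, θ) ↦ θ`. -/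
def pullbackSphereTensor {n : ℕ} (μ : E n → Matrix (Fin n) (Fin n) ℝ) (y : E n) :
    Matrix (Fin n) (Fin n) ℝ :=
  (‖y‖ ^ 2)⁻¹ • μ (angle y)

/-- `g = x⁻² (dx² + (1 - x²/4)² h̊ + xⁿ μ) + o(xⁿ⁻²) dxⁱ dxʲ` as `x → 0`. The components of the last
term in the coordinates `(x, xᴬ)` are controlled by its norm for `dx² + h̊`. -/
structure HasExpansion {n : ℕ} (G μ : E n → Matrix (Fin n) (Fin n) ℝ) : Prop where
  tensor : IsSphereTensor μ
  remainder :
    (fun y : E n => tensorNorm (productMetric y)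
      (toTensor (G y - hyperbolicMetric y - ‖y‖ ^ (n - 2) • pullbackSphereTensor μ y)))
      =o[𝓝[≠] (0 : E n)] fun y => ‖y‖ ^ (n - 2)

/-- The deviation `λ = g - g̊` from the reference metric. -/
def deviation {n : ℕ} (G : E n → Matrix (Fin n) (Fin n) ℝ) (y : E n) : (Fin 2 → Fin n) → ℝ :=
  toTensor (G y - hyperbolicMetric y)

/-- On `{0 < x < x₀}` the tensor `D̊λ` is twice differentiable and, for some constant `C₁`,
`∑_{0 ≤ l ≤ 2} (|∇̊ˡ λ| + x⁻¹ |∇̊ˡ D̊ λ|) ≤ C₁ xⁿ`, with `∇̊` and the norms those of `g̊`. -/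
structure HasDecay {n : ℕ} (x₀ : ℝ) (G : E n → Matrix (Fin n) (Fin n) ℝ) : Prop where
  differentiableOn : ∀ I,
    DifferentiableOn ℝ (fun y => sphereDeriv (deviation G) y I) (collar n x₀)
  differentiableOn_covDeriv : ∀ I,
    DifferentiableOn ℝ (fun y => covDeriv hyperbolicMetric (sphereDeriv (deviation G)) y I)
      (collar n x₀)
  bound : ∃ C₁ : ℝ, ∀ y ∈ collar n x₀,
    normC2 hyperbolicMetric (deviation G) y
      + ‖y‖⁻¹ * normC2 hyperbolicMetric (sphereDeriv (deviation G)) y ≤ C₁ * ‖y‖ ^ n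

/-- `x⁻¹ (R[g] - R[g̊])` is integrable on the collar for the Riemannian measure
`dμ_g = √(det g) dy`. -/
def ScalarIntegrable {n : ℕ} (x₀ : ℝ) (G : E n → Matrix (Fin n) (Fin n) ℝ) : Prop :=
  IntegrableOn (fun y : E n =>
    ‖y‖⁻¹ * (scalarCurvature G y - scalarCurvature hyperbolicMetric y) * √(G y).det)
    (collar n x₀) volume

/-! ### Mass aspect and energy-momentum -/

/-- The mass aspect function `Θ = tr_h̊ μ = h̊ᴬᴮ μ_AB` on the unit sphere. -/
def massAspect {n : ℕ} (μ : E n → Matrix (Fin n) (Fin n) ℝ) (θ : E n) : ℝ := (μ θ).trace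

/-- The energy-momentum covector `(m₀, m₁, …, mₙ)`, with normalising constant `c`:
`m₀ = c ∫ Θ dμ_h̊` and `mᵢ = c ∫ Θ θⁱ dμ_h̊` over the unit sphere. -/
def energyMomentum {n : ℕ} (c : ℝ) (μ : E n → Matrix (Fin n) (Fin n) ℝ) : Fin (n + 1) → ℝ :=
  Fin.cons
    (c * ∫ θ : Metric.sphere (0 : E n) 1, massAspect μ θ.1 ∂(volume : Measure (E n)).toSphere)
    fun i => c * ∫ θ : Metric.sphere (0 : E n) 1, massAspect μ θ.1 * θ.1 i
      ∂(volume : Measure (E n)).toSphere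

/-- `m'` lies to the chronological future of `m`. -/
def InChronologicalFuture {n : ℕ} (m m' : Fin (n + 1) → ℝ) : Prop :=
  m 0 < m' 0 ∧ 0 < (m' 0 - m 0) ^ 2 - ∑ i : Fin n, (m' i.succ - m i.succ) ^ 2

/-- `m` is timelike and past pointing. -/
def IsTimelikePast {n : ℕ} (m : Fin (n + 1) → ℝ) : Prop :=
  m 0 < 0 ∧ 0 < m 0 ^ 2 - ∑ i : Fin n, m i.succ ^ 2

/-! ### Manifolds with an asymptotic end -/

section Manifold

variable {n : ℕ} {M : Type*} [TopologicalSpace M] [ChartedSpace (E n) M]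

/-- Riemannian metrics of class `Cᵏ` on the manifold `M`. -/
abbrev RMetric (n : ℕ) (k : ℕ∞) (M : Type*) [TopologicalSpace M] [ChartedSpace (E n) M]
    [IsManifold 𝓘(ℝ, E n) ∞ M] : Type _ :=
  Bundle.ContMDiffRiemannianMetric 𝓘(ℝ, E n) (k : WithTop ℕ∞) (E n)
    (fun p : M => TangentSpace 𝓘(ℝ, E n) p)

/-- The components of a Riemannian metric in a chart, as functions on the target of the chart. -/
def coordMetric [IsManifold 𝓘(ℝ, E n) ∞ M] {k : ℕ∞} (φ : OpenPartialHomeomorph M (E n))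
    (g : RMetric n k M) (y : E n) : Matrix (Fin n) (Fin n) ℝ :=
  Matrix.of fun i j => g.inner (φ.symm y)
    (mfderiv 𝓘(ℝ, E n) 𝓘(ℝ, E n) φ.symm y (EuclideanSpace.single i (1 : ℝ) : E n))
    (mfderiv 𝓘(ℝ, E n) 𝓘(ℝ, E n) φ.symm y (EuclideanSpace.single j (1 : ℝ) : E n))

/-- `φ` is a diffeomorphism from an open region of `M` onto the collar `{0 < x < x₀}`, and this
region is an end of `M`, going to infinity as `x → 0`: each set `{x ≤ δ}` with `δ < x₀` is closed in
`M`, so that the region meets the rest of `M` only as `x → x₀`. -/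
structure IsEndChart (x₀ : ℝ) (φ : OpenPartialHomeomorph M (E n)) : Prop where
  mem_maximalAtlas : φ ∈ IsManifold.maximalAtlas 𝓘(ℝ, E n) ∞ M
  target_eq : φ.target = collar n x₀
  isClosed : ∀ δ < x₀, IsClosed {p : M | p ∈ φ.source ∧ ‖φ p‖ ≤ δ}

/-- The coordinates `φ'` arise from `φ` by a transformation `(x, θ) ↦ (x + xⁿ⁺¹ ψ(θ), θ)` near
infinity, for a smooth function `ψ` on the sphere. Such a transformation fixes conformal infinity
pointwise. -/
structure IsRadialChange (φ φ' : OpenPartialHomeomorph M (E n)) : Prop where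
  source_subset : φ'.source ⊆ φ.source
  nhds_infinity : ∃ δ > 0, ∀ p ∈ φ.source, ‖φ p‖ < δ → p ∈ φ'.source
  formula : ∃ ψ : E n → ℝ, ContDiffOn ℝ ∞ (fun y => ψ (angle y)) {0}ᶜ ∧
    ∀ p ∈ φ'.source, φ' p = (1 + ‖φ p‖ ^ n * ψ (angle (φ p))) • φ p

/-- There are `0 < ε₀ < x₀/4` and metrics `g_ε`, `0 < ε < ε₀`, such that
* `g_ε` coincides with `g` outside of `{x ≤ 4ε}`;
* `0 ≤ R[g_ε] - R[g]` and `R[g_ε] - R[g] = O(xⁿ⁺²)` (outside of the collar, the two metrics and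
  therefore their curvatures are the same);
* after a change of coordinates which fixes infinity pointwise, `g_ε` has again an expansion
  `x⁻² (dx² + (1 - x²/4)² h̊ + xⁿ μ_ε) + o(xⁿ⁻²) dxⁱ dxʲ`;
* the energy-momentum covector of `g_ε` tends to `m'` as `ε → 0`. -/
def HasDeformation [IsManifold 𝓘(ℝ, E n) ∞ M] {k : ℕ∞} (c x₀ : ℝ)
    (φ : OpenPartialHomeomorph M (E n)) (g : RMetric n k M) (m' : Fin (n + 1) → ℝ) : Prop :=
  ∃ ε₀ : ℝ, 0 < ε₀ ∧ ε₀ < x₀ / 4 ∧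
    ∃ (gε : ℝ → RMetric n k M) (με : ℝ → E n → Matrix (Fin n) (Fin n) ℝ),
      (∀ ε, 0 < ε → ε < ε₀ →
        (∀ p : M, ¬ (p ∈ φ.source ∧ ‖φ p‖ ≤ 4 * ε) → (gε ε).inner p = g.inner p) ∧
        (∃ C : ℝ, ∀ y ∈ collar n x₀,
          0 ≤ scalarCurvature (coordMetric φ (gε ε)) y - scalarCurvature (coordMetric φ g) y ∧
          scalarCurvature (coordMetric φ (gε ε)) y - scalarCurvature (coordMetric φ g) y
            ≤ C * ‖y‖ ^ (n + 2)) ∧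
        ∃ (x₁ : ℝ) (φ' : OpenPartialHomeomorph M (E n)), 0 < x₁ ∧ x₁ < 1 ∧ IsEndChart x₁ φ' ∧
          IsRadialChange φ φ' ∧ HasExpansion (coordMetric φ' (gε ε)) (με ε)) ∧
      Filter.Tendsto (fun ε => energyMomentum c (με ε)) (𝓝[>] 0) (𝓝 m')

end Manifold

end AHMass

end

noncomputable section

set_option synthInstance.maxHeartbeats 200000
set_option maxSynthPendingDepth 3

namespace AHMass

/-! Write `n = m + 1`, `x = ‖y‖`, `t = x²`. The deformed metric is `g_ε = g + xⁿ⁻² a(θ) X(t) dx²`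
with `a = 2nψ`, `ψ > 0` a smooth function on the sphere, and `X(t) = exp(-K t)` times a cutoff which
is `1` for `t ≤ ε²` and `0` for `t ≥ 2ε²`. Two facts make this work.

Mass. Near infinity `X → 1`, and the change of coordinates `x ↦ x + xⁿ⁺¹ψ` removes the added term to
leading order: the stretching of `dx` absorbs `2nψ xⁿ⁻² dx²`, while the passage from `x⁻²` to the
new radius leaves the angular term `2ψ xⁿ⁻² h̊`. Thus `μ` becomes `μ + 2ψ h̊` (`shiftTensor`), the
remainder being controlled by `exists_expansionError_bound`. The mass aspect grows by `2(n-1)ψ`, and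
the integrals of positive smooth functions against `1, θ¹, …, θⁿ` include every future timelike
vector (`mem_momentCone_of_timelike`, by separation of convex sets). So `ψ` can be chosen
independently of `ε` with energy-momentum exactly equal to the target, and the limit is that of a
constant.

Curvature. To first order the scalar curvature changes by `-2(n-1) xⁿ a t X'(t)`, with error `O(xⁿ⁺²
(X + |t X'|))`. The undifferentiated terms cancel because of the power of `x`, and `X''` does not
occur at all, since the second radial derivative of the radial component is absent from the scalar
curvature (`jetCurv_add_radial`). As `X` decreases, the main term is nonnegative. The factor `exp(-K
t)` gives `-t X' ≥ K t X`, so for `K` large the main term dominates the error near infinity,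
uniformly in `ε` (`exists_radialCutoff_scalarCurvature`).

For the error estimate, scalar curvature is a smooth function `jetCurv` of the two-jet of the metric
in a frame. In frames adapted to the collar the jet of the hyperbolic metric is a polynomial in `x²`
(`frameJet_hyperbolicMetric`), the jet of `λ` is `O(xⁿ)` by the decay hypothesis
(`frameJet_deviation_le`), and everything is expanded about the single limiting jet `hypJet m 0`;
this is `exists_scalarCurvature_add_radialBump_bound`. -/

/-! ### The scalar curvature as a polynomial in the two-jet of the metric -/

/-- The bilinear form with matrix `A`. -/
def bilOf {n : ℕ} (A : Matrix (Fin n) (Fin n) ℝ) : E n →L[ℝ] E n →L[ℝ] ℝ :=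
  ∑ i, ∑ j, A i j • (EuclideanSpace.proj i : E n →L[ℝ] ℝ).smulRight
    (EuclideanSpace.proj j : E n →L[ℝ] ℝ)

lemma bilOf_apply {n : ℕ} (A : Matrix (Fin n) (Fin n) ℝ) (u v : E n) :
    bilOf A u v = ∑ i, ∑ j, A i j * (u i * v j) := by
  simp [bilOf]

lemma bilOf_single {n : ℕ} (A : Matrix (Fin n) (Fin n) ℝ) (i j : Fin n) :
    bilOf A (EuclideanSpace.single i 1) (EuclideanSpace.single j 1) = A i j := by
  simp [bilOf_apply]

/-- Lower Christoffel symbols `½ (∂ᵢ g_qj + ∂ⱼ g_qi - ∂_q g_ij)`. -/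
def lowerChr {n : ℕ} (B : Fin n → Fin n → Fin n → ℝ) (q i j : Fin n) : ℝ :=
  (1 / 2) * (B i q j + B j q i - B q i j)

/-- Derivatives `∂_l` of the lower Christoffel symbols. -/
def dLowerChr {n : ℕ} (D : Fin n → Fin n → Fin n → Fin n → ℝ) (l q i j : Fin n) : ℝ :=
  (1 / 2) * (D l i q j + D l j q i - D l q i j)

/-- The Ricci tensor in terms of the inverse metric and the derivatives of the metric. -/
def ricciPoly {n : ℕ} (A : Fin n → Fin n → ℝ) (B : Fin n → Fin n → Fin n → ℝ)
    (D : Fin n → Fin n → Fin n → Fin n → ℝ) (i j : Fin n) : ℝ :=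
  ∑ l, ∑ p, A l p * (dLowerChr D l p i j - dLowerChr D j p i l)
    + ∑ l, ∑ p, A l p * ∑ q, ∑ r, A q r *
      (lowerChr B q j p * lowerChr B r i l - lowerChr B q l p * lowerChr B r i j)

/-- The scalar curvature in terms of the inverse metric and the derivatives of the metric. -/
def curvPoly {n : ℕ} (A : Fin n → Fin n → ℝ) (B : Fin n → Fin n → Fin n → ℝ)
    (D : Fin n → Fin n → Fin n → Fin n → ℝ) : ℝ :=
  ∑ i, ∑ j, A i j * ricciPoly A B D i j

lemma contDiffAt_det {m : WithTop ℕ∞} {W ι : Type*} [NormedAddCommGroup W]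
    [NormedSpace ℝ W] [Fintype ι] [DecidableEq ι] {y : W} {F : W → Matrix ι ι ℝ} (hF : ∀ i j, ContDiffAt ℝ m (fun z => F z i j) y) :
    ContDiffAt ℝ m (fun z => (F z).det) y := by
  simp only [Matrix.det_apply]
  refine ContDiffAt.sum fun σ _ => ContDiffAt.const_smul _ ?_
  exact contDiffAt_prod fun i _ => hF _ _

/-- Cramer's rule: an entry of the inverse is a quotient of two determinants, polynomial in the
entries of the matrix. -/
lemma contDiffAt_inv_entry {m : WithTop ℕ∞} {W ι : Type*} [NormedAddCommGroup W]
    [NormedSpace ℝ W] [Fintype ι] [DecidableEq ι] {y : W} {G : W → Matrix ι ι ℝ}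
    (hG : ∀ i j, ContDiffAt ℝ m (fun z => G z i j) y)
    (hdet : (G y).det ≠ 0) (i j : ι) : ContDiffAt ℝ m (fun z => (G z)⁻¹ i j) y := by
  have : (fun z => (G z)⁻¹ i j) = fun z => ((G z).det)⁻¹ * ((G z).updateRow j (Pi.single i 1)).det := by
    ext z
    simp [Matrix.inv_def, Matrix.adjugate_apply, Ring.inverse_eq_inv']
  rw [this]
  refine (ContDiffAt.inv (contDiffAt_det hG) hdet).mul (contDiffAt_det fun a b => ?_)
  simp only [Matrix.updateRow_apply]
  split_ifs
  · exact contDiffAt_const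
  · exact hG a b

section Coordinates

variable {n : ℕ} {G : E n → Matrix (Fin n) (Fin n) ℝ} {y : E n}

lemma contDiffAt_bilOf {m : WithTop ℕ∞} (hG : ∀ i j, ContDiffAt ℝ m (fun z => G z i j) y) :
    ContDiffAt ℝ m (fun z => bilOf (G z)) y := by
  unfold bilOf
  exact ContDiffAt.sum fun i _ => ContDiffAt.sum fun j _ => (hG i j).smul contDiffAt_const

lemma fderiv_eval₂ {F : E n → E n →L[ℝ] E n →L[ℝ] ℝ} (hF : DifferentiableAt ℝ F y)
    (k u v : E n) : fderiv ℝ (fun z => F z u v) y k = fderiv ℝ F y k u v := by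
  have h := ((hF.hasFDerivAt.clm_apply (hasFDerivAt_const u y)).clm_apply
    (hasFDerivAt_const v y)).fderiv
  rw [h]; simp

lemma fderiv_eval₃ {F : E n → E n →L[ℝ] E n →L[ℝ] E n →L[ℝ] ℝ} (hF : DifferentiableAt ℝ F y)
    (k u v w : E n) : fderiv ℝ (fun z => F z u v w) y k = fderiv ℝ F y k u v w := by
  have h := (((hF.hasFDerivAt.clm_apply (hasFDerivAt_const u y)).clm_apply
    (hasFDerivAt_const v y)).clm_apply (hasFDerivAt_const w y)).fderiv
  rw [h]; simp

/-- The first derivatives of the components of the metric `F` in the frame `e`. -/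
def jetOne (F : E n → E n →L[ℝ] E n →L[ℝ] ℝ) (y : E n) (e : Fin n → E n) (a b c : Fin n) : ℝ :=
  fderiv ℝ F y (e a) (e b) (e c)

/-- The second derivatives of the components of the metric `F` in the frame `e`. -/
def jetTwo (F : E n → E n →L[ℝ] E n →L[ℝ] ℝ) (y : E n) (e : Fin n → E n)
    (a b c d : Fin n) : ℝ :=
  fderiv ℝ (fderiv ℝ F) y (e a) (e b) (e c) (e d)

/-- The standard basis. -/
def stdFrame (n : ℕ) (i : Fin n) : E n := EuclideanSpace.single i 1

lemma pd_entry (hG : ∀ i j, ContDiffAt ℝ 2 (fun z => G z i j) y) (k i j : Fin n) :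
    pd k (fun z => G z i j) y = jetOne (fun z => bilOf (G z)) y (stdFrame n) k i j := by
  have h := (contDiffAt_bilOf hG).differentiableAt (by norm_num)
  rw [jetOne, ← fderiv_eval₂ h, pd]
  simp [stdFrame, bilOf_single]

lemma eventually_contDiffAt (hG : ∀ i j, ContDiffAt ℝ 2 (fun z => G z i j) y) :
    ∀ᶠ z in 𝓝 y, ∀ i j, ContDiffAt ℝ 2 (fun z => G z i j) z := by
  simp only [Filter.eventually_all]
  intro i j
  exact (hG i j).eventually (by simp)

lemma differentiableAt_fderiv_bilOf (hG : ∀ i j, ContDiffAt ℝ 2 (fun z => G z i j) y) :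
    DifferentiableAt ℝ (fderiv ℝ fun z => bilOf (G z)) y :=
  ((contDiffAt_bilOf hG).fderiv_right (m := 1) (by norm_num)).differentiableAt (by norm_num)

lemma hasFDerivAt_jetOne (hG : ∀ i j, ContDiffAt ℝ 2 (fun z => G z i j) y)
    (e : Fin n → E n) (a b c : Fin n) :
    DifferentiableAt ℝ (fun z => jetOne (fun z => bilOf (G z)) z e a b c) y := by
  have h := differentiableAt_fderiv_bilOf hG
  unfold jetOne
  fun_prop

lemma pd_jetOne (hG : ∀ i j, ContDiffAt ℝ 2 (fun z => G z i j) y) (l k i j : Fin n) :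
    pd l (fun z => jetOne (fun z => bilOf (G z)) z (stdFrame n) k i j) y
      = jetTwo (fun z => bilOf (G z)) y (stdFrame n) l k i j := by
  rw [jetTwo, ← fderiv_eval₃ (differentiableAt_fderiv_bilOf hG)]
  rfl

lemma jetOne_symm (hG : ∀ i j, ContDiffAt ℝ 2 (fun z => G z i j) y)
    (hs : ∀ᶠ z in 𝓝 y, (G z).IsSymm) (k i j : Fin n) :
    jetOne (fun z => bilOf (G z)) y (stdFrame n) k i j
      = jetOne (fun z => bilOf (G z)) y (stdFrame n) k j i := by
  rw [← pd_entry hG, ← pd_entry hG, pd, pd]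
  congr 1
  apply Filter.EventuallyEq.fderiv_eq
  filter_upwards [hs] with z hz
  exact hz.apply j i

lemma pd_add {f g : E n → ℝ} (hf : DifferentiableAt ℝ f y) (hg : DifferentiableAt ℝ g y)
    (k : Fin n) : pd k (fun z => f z + g z) y = pd k f y + pd k g y := by
  simp [pd, fderiv_fun_add hf hg]

lemma pd_sub {f g : E n → ℝ} (hf : DifferentiableAt ℝ f y) (hg : DifferentiableAt ℝ g y)
    (k : Fin n) : pd k (fun z => f z - g z) y = pd k f y - pd k g y := by
  simp [pd, fderiv_fun_sub hf hg]

lemma pd_mul {f g : E n → ℝ} (hf : DifferentiableAt ℝ f y) (hg : DifferentiableAt ℝ g y)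
    (k : Fin n) : pd k (fun z => f z * g z) y = f y * pd k g y + pd k f y * g y := by
  simp [pd, fderiv_fun_mul hf hg, mul_comm]

lemma pd_const_mul {f : E n → ℝ} (c : ℝ) (hf : DifferentiableAt ℝ f y)
    (k : Fin n) : pd k (fun z => c * f z) y = c * pd k f y := by
  simp [pd, fderiv_const_mul hf]

lemma pd_sum {ι : Type*} {s : Finset ι} {f : ι → E n → ℝ}
    (hf : ∀ i ∈ s, DifferentiableAt ℝ (f i) y) (k : Fin n) :
    pd k (fun z => ∑ i ∈ s, f i z) y = ∑ i ∈ s, pd k (f i) y := by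
  simp [pd, fderiv_fun_sum hf]

/-- Differentiation of `G⁻¹ G = 1`, which holds near `y` because the determinant stays nonzero
there, gives `∂G⁻¹ = -G⁻¹ (∂G) G⁻¹`. -/
lemma pd_inv_entry (hG : ∀ i j, ContDiffAt ℝ 2 (fun z => G z i j) y)
    (hdet : (G y).det ≠ 0) (k l m : Fin n) :
    pd k (fun z => (G z)⁻¹ l m) y
      = - ∑ p, ∑ q, (G y)⁻¹ l p * jetOne (fun z => bilOf (G z)) y (stdFrame n) k p q
          * (G y)⁻¹ q m := by
  have hGd : ∀ i j, DifferentiableAt ℝ (fun z => G z i j) y := fun i j =>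
    (hG i j).differentiableAt (by norm_num)
  have hId : ∀ i j, DifferentiableAt ℝ (fun z => (G z)⁻¹ i j) y := fun i j =>
    (contDiffAt_inv_entry hG hdet i j).differentiableAt (by norm_num)
  have hne : ∀ᶠ z in 𝓝 y, (G z).det ≠ 0 :=
    (contDiffAt_det hG).continuousAt.eventually_ne hdet
  have key : ∀ q, ∑ p, ((G y)⁻¹ l p * pd k (fun z => G z p q) y
      + pd k (fun z => (G z)⁻¹ l p) y * G y p q) = 0 := by
    intro q
    have h1 : (fun z => ∑ p, (G z)⁻¹ l p * G z p q) =ᶠ[𝓝 y]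
        fun _ => (1 : Matrix (Fin n) (Fin n) ℝ) l q := by
      filter_upwards [hne] with z hz
      rw [← Matrix.nonsing_inv_mul (G z) (isUnit_iff_ne_zero.2 hz), Matrix.mul_apply]
    have h2 : pd k (fun z => ∑ p, (G z)⁻¹ l p * G z p q) y = 0 := by
      rw [pd, h1.fderiv_eq]; simp
    rw [pd_sum (fun p _ => (hId l p).fun_mul (hGd p q))] at h2
    rw [← h2]
    exact Finset.sum_congr rfl fun p _ => (pd_mul (hId l p) (hGd p q) k).symm
  have h3 : ∀ q, ∑ p, pd k (fun z => (G z)⁻¹ l p) y * G y p q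
      = - ∑ p, (G y)⁻¹ l p * jetOne (fun z => bilOf (G z)) y (stdFrame n) k p q := by
    intro q
    have := key q
    rw [Finset.sum_add_distrib] at this
    simp only [← pd_entry hG]
    linarith
  have h4 : pd k (fun z => (G z)⁻¹ l m) y
      = ∑ q, (∑ p, pd k (fun z => (G z)⁻¹ l p) y * G y p q) * (G y)⁻¹ q m := by
    simp only [Finset.sum_mul]
    rw [Finset.sum_comm]
    simp only [mul_assoc, ← Finset.mul_sum, ← Matrix.mul_apply]
    rw [Matrix.mul_nonsing_inv _ (isUnit_iff_ne_zero.2 hdet)]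
    simp [Matrix.one_apply]
  rw [h4]
  simp only [h3, neg_mul, Finset.sum_neg_distrib, Finset.sum_mul]
  rw [Finset.sum_comm]

lemma christoffel_eventuallyEq (hG : ∀ i j, ContDiffAt ℝ 2 (fun z => G z i j) y)
    (l i j : Fin n) :
    christoffel G l i j =ᶠ[𝓝 y] fun z => ∑ m, (G z)⁻¹ l m *
      lowerChr (jetOne (fun z => bilOf (G z)) z (stdFrame n)) m i j := by
  filter_upwards [eventually_contDiffAt hG] with z hz
  simp only [christoffel, pd_entry hz, lowerChr, Finset.mul_sum]
  exact Finset.sum_congr rfl fun m _ => by ring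

lemma differentiableAt_lowerChr (hG : ∀ i j, ContDiffAt ℝ 2 (fun z => G z i j) y)
    (m i j : Fin n) :
    DifferentiableAt ℝ (fun z => lowerChr (jetOne (fun z => bilOf (G z)) z (stdFrame n)) m i j)
      y := by
  unfold lowerChr
  exact (((hasFDerivAt_jetOne hG _ _ _ _).add (hasFDerivAt_jetOne hG _ _ _ _)).sub
    (hasFDerivAt_jetOne hG _ _ _ _)).const_mul _

lemma pd_lowerChr (hG : ∀ i j, ContDiffAt ℝ 2 (fun z => G z i j) y) (k m i j : Fin n) :
    pd k (fun z => lowerChr (jetOne (fun z => bilOf (G z)) z (stdFrame n)) m i j) y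
      = dLowerChr (jetTwo (fun z => bilOf (G z)) y (stdFrame n)) k m i j := by
  unfold lowerChr dLowerChr
  have d := fun a b c => hasFDerivAt_jetOne hG (stdFrame n) a b c
  rw [pd_const_mul _ (((d _ _ _).fun_add (d _ _ _)).fun_sub (d _ _ _)),
    pd_sub ((d _ _ _).fun_add (d _ _ _)) (d _ _ _), pd_add (d _ _ _) (d _ _ _)]
  simp only [pd_jetOne hG]

lemma pd_christoffel (hG : ∀ i j, ContDiffAt ℝ 2 (fun z => G z i j) y)
    (hdet : (G y).det ≠ 0) (k l i j : Fin n) :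
    pd k (christoffel G l i j) y
      = ∑ p, (G y)⁻¹ l p * dLowerChr (jetTwo (fun z => bilOf (G z)) y (stdFrame n)) k p i j
        - ∑ p, ∑ q, ∑ r, (G y)⁻¹ l p * ((G y)⁻¹ q r *
          (jetOne (fun z => bilOf (G z)) y (stdFrame n) k p q *
            lowerChr (jetOne (fun z => bilOf (G z)) y (stdFrame n)) r i j)) := by
  have hId : ∀ i j, DifferentiableAt ℝ (fun z => (G z)⁻¹ i j) y := fun i j =>
    (contDiffAt_inv_entry hG hdet i j).differentiableAt (by norm_num)
  have h1 : pd k (christoffel G l i j) y = pd k (fun z => ∑ m, (G z)⁻¹ l m *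
      lowerChr (jetOne (fun z => bilOf (G z)) z (stdFrame n)) m i j) y := by
    rw [pd, (christoffel_eventuallyEq hG l i j).fderiv_eq, pd]
  rw [h1, pd_sum (fun m _ => (hId l m).fun_mul (differentiableAt_lowerChr hG m i j))]
  have h2 : ∀ m, pd k (fun z => (G z)⁻¹ l m *
      lowerChr (jetOne (fun z => bilOf (G z)) z (stdFrame n)) m i j) y = _ :=
    fun m => pd_mul (hId l m) (differentiableAt_lowerChr hG m i j) k
  simp only [h2, pd_lowerChr hG, pd_inv_entry hG hdet, neg_mul, Finset.sum_mul,
    ← sub_eq_add_neg, Finset.sum_sub_distrib]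
  congr 1
  rw [Finset.sum_comm]
  refine Finset.sum_congr rfl fun p _ => ?_
  rw [Finset.sum_comm]
  exact Finset.sum_congr rfl fun q _ => Finset.sum_congr rfl fun r _ => by ring

lemma ricci_eq_ricciPoly (hG : ∀ i j, ContDiffAt ℝ 2 (fun z => G z i j) y)
    (hs : ∀ᶠ z in 𝓝 y, (G z).IsSymm) (hdet : (G y).det ≠ 0) (i j : Fin n) :
    ricci G i j y = ricciPoly (fun a b => (G y)⁻¹ a b) (jetOne (fun z => bilOf (G z)) y (stdFrame n))
      (jetTwo (fun z => bilOf (G z)) y (stdFrame n)) i j := by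
  set A := (G y)⁻¹ with hA
  set B := jetOne (fun z => bilOf (G z)) y (stdFrame n) with hB
  set D := jetTwo (fun z => bilOf (G z)) y (stdFrame n) with hD
  have hBs : ∀ k p q, B k p q = B k q p := jetOne_symm hG hs
  -- Metric compatibility, `∂ₖ g_pq = Γ_pkq + Γ_qkp`. It rewrites the terms coming from `∂g⁻¹` as
  -- products of Christoffel symbols; half of these cancel the two `ΓΓ` terms of the Ricci tensor
  -- and the other half are the quadratic part of `ricciPoly`.
  have hBc : ∀ k p q, B k p q = lowerChr B p k q + lowerChr B q k p := by
    intro k p q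
    simp only [lowerChr]
    rw [hBs q p k, hBs p k q, hBs k q p]; ring
  have hc : ∀ l i j, christoffel G l i j y = ∑ m, A l m * lowerChr B m i j := fun l i j =>
    (christoffel_eventuallyEq hG l i j).eq_of_nhds
  have q1 : ∀ i j, ∑ l, ∑ m, christoffel G l l m y * christoffel G m i j y
      = ∑ l, ∑ p, ∑ q, ∑ r, A l p * (A q r * (lowerChr B p l q * lowerChr B r i j)) := by
    intro i j
    simp only [hc, Finset.sum_mul_sum]
    refine Finset.sum_congr rfl fun l _ => ?_
    rw [Finset.sum_comm]
    exact Finset.sum_congr rfl fun p _ => Finset.sum_congr rfl fun q _ =>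
      Finset.sum_congr rfl fun r _ => by ring
  have q2 : ∑ l, ∑ m, christoffel G l j m y * christoffel G m i l y
      = ∑ l, ∑ p, ∑ q, ∑ r, A l p * (A q r * (lowerChr B p j q * lowerChr B r i l)) := by
    simp only [hc, Finset.sum_mul_sum]
    refine Finset.sum_congr rfl fun l _ => ?_
    rw [Finset.sum_comm]
    exact Finset.sum_congr rfl fun p _ => Finset.sum_congr rfl fun q _ =>
      Finset.sum_congr rfl fun r _ => by ring
  rw [ricci, q1, q2]
  simp only [pd_christoffel hG hdet, ← hA, ← hB, ← hD]
  simp only [ricciPoly, Finset.mul_sum, ← Finset.sum_add_distrib, ← Finset.sum_sub_distrib]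
  refine Finset.sum_congr rfl fun l _ => Finset.sum_congr rfl fun p _ => ?_
  simp only [hBc, mul_add, add_mul, mul_sub, Finset.sum_add_distrib, Finset.sum_sub_distrib]
  ring

lemma scalarCurvature_eq_curvPoly (hG : ∀ i j, ContDiffAt ℝ 2 (fun z => G z i j) y)
    (hs : ∀ᶠ z in 𝓝 y, (G z).IsSymm) (hdet : (G y).det ≠ 0) :
    scalarCurvature G y = curvPoly (fun a b => (G y)⁻¹ a b) (jetOne (fun z => bilOf (G z)) y (stdFrame n))
      (jetTwo (fun z => bilOf (G z)) y (stdFrame n)) := by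
  simp only [scalarCurvature, curvPoly, ricci_eq_ricciPoly hG hs hdet]

end Coordinates

/-! ### Change of frame -/

section Frame

variable {n : ℕ}

/-- Contraction with the inverse metric does not depend on the frame: expanding `e'` and `A` through
`P` turns both sides into the same fourfold sum. Only linearity of `X` in each slot is needed, so
one pair of indices of a larger expression can be moved while the others stay fixed. -/
lemma sum_contract {V : Type*} [AddCommGroup V] [Module ℝ V] {ι κ : Type*} [Fintype ι] [Fintype κ]
    {e : ι → V} {e' : κ → V} {P : ι → κ → ℝ} (he : ∀ a, e' a = ∑ i, P i a • e i)
    {A : ι → ι → ℝ} {A' : κ → κ → ℝ} (hA : ∀ i j, A i j = ∑ a, ∑ b, P i a * A' a b * P j b)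
    (X : V → V → ℝ) (h1 : ∀ v, IsLinearMap ℝ fun u => X u v) (h2 : ∀ u, IsLinearMap ℝ (X u)) :
    ∑ i, ∑ j, A i j * X (e i) (e j) = ∑ a, ∑ b, A' a b * X (e' a) (e' b) := by
  have hX : ∀ a b, X (e' a) (e' b) = ∑ i, ∑ j, P i a * P j b * X (e i) (e j) := by
    intro a b
    have l1 : ∀ v, X (e' a) v = ∑ i, P i a * X (e i) v := by
      intro v
      rw [he a]
      refine (map_sum (h1 v).mk' (fun i => P i a • e i) Finset.univ).trans ?_
      exact Finset.sum_congr rfl fun i _ => (h1 v).map_smul _ _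
    have l2 : ∀ u, X u (e' b) = ∑ j, P j b * X u (e j) := by
      intro u
      rw [he b]
      refine (map_sum (h2 u).mk' (fun i => P i b • e i) Finset.univ).trans ?_
      exact Finset.sum_congr rfl fun i _ => (h2 u).map_smul _ _
    rw [l1]
    simp only [l2, Finset.mul_sum, mul_assoc]
  simp only [hA, hX, Finset.sum_mul, Finset.mul_sum]
  have swap : ∀ f : ι → ι → κ → κ → ℝ, ∑ i, ∑ j, ∑ a, ∑ b, f i j a b
      = ∑ a, ∑ b, ∑ i, ∑ j, f i j a b := by
    intro f
    calc _ = ∑ i, ∑ a, ∑ j, ∑ b, f i j a b := Finset.sum_congr rfl fun i _ => Finset.sum_comm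
      _ = ∑ a, ∑ i, ∑ j, ∑ b, f i j a b := Finset.sum_comm
      _ = ∑ a, ∑ i, ∑ b, ∑ j, f i j a b := Finset.sum_congr rfl fun a _ =>
          Finset.sum_congr rfl fun i _ => Finset.sum_comm
      _ = _ := Finset.sum_congr rfl fun a _ => Finset.sum_comm
  rw [swap]
  exact Finset.sum_congr rfl fun a _ => Finset.sum_congr rfl fun b _ =>
    Finset.sum_congr rfl fun i _ => Finset.sum_congr rfl fun j _ => by ring

lemma isLinearMap_sum {V : Type*} [AddCommGroup V] [Module ℝ V] {ι : Type*} (s : Finset ι)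
    {f : ι → V → ℝ} (hf : ∀ i, IsLinearMap ℝ (f i)) : IsLinearMap ℝ fun v => ∑ i ∈ s, f i v := by
  constructor
  · intro u v; simp [(hf _).map_add, Finset.sum_add_distrib]
  · intro c v; simp [(hf _).map_smul, Finset.mul_sum]

/-- The curvature integrand as a four-linear form. -/
def secondForm (D : E n →L[ℝ] E n →L[ℝ] E n →L[ℝ] E n →L[ℝ] ℝ) (l q i j : E n) : ℝ :=
  (1 / 2) * (D l i q j + D l j q i - D l q i j)

def firstForm (B : E n →L[ℝ] E n →L[ℝ] E n →L[ℝ] ℝ) (q i j : E n) : ℝ :=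
  (1 / 2) * (B i q j + B j q i - B q i j)

/-- Every index is contracted with `A`, so the pairs are carried from `e` to `e'` one after another
by `sum_contract`. Derivatives of a metric are not tensors, but the change of frame is a constant
linear one at a single point, and under such changes `B` and `D` behave as multilinear forms. -/
lemma curvPoly_frame (B : E n →L[ℝ] E n →L[ℝ] E n →L[ℝ] ℝ)
    (D : E n →L[ℝ] E n →L[ℝ] E n →L[ℝ] E n →L[ℝ] ℝ) {e e' : Fin n → E n} {P A A' : Fin n → Fin n → ℝ}
    (he : ∀ a, e' a = ∑ i, P i a • e i)
    (hA : ∀ i j, A i j = ∑ a, ∑ b, P i a * A' a b * P j b) :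
    curvPoly A (fun a b c => B (e a) (e b) (e c)) (fun a b c d => D (e a) (e b) (e c) (e d))
      = curvPoly A' (fun a b c => B (e' a) (e' b) (e' c))
        (fun a b c d => D (e' a) (e' b) (e' c) (e' d)) := by
  have key : ∀ (A : Fin n → Fin n → ℝ) (e : Fin n → E n),
    curvPoly A (fun a b c => B (e a) (e b) (e c)) (fun a b c d => D (e a) (e b) (e c) (e d))
      = ∑ i, ∑ j, A i j * ∑ l, ∑ p, A l p *
          (secondForm D (e l) (e p) (e i) (e j) - secondForm D (e j) (e p) (e i) (e l))
        + ∑ i, ∑ j, A i j * ∑ l, ∑ p, A l p * ∑ q, ∑ r, A q r *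
          (firstForm B (e q) (e j) (e p) * firstForm B (e r) (e i) (e l)
            - firstForm B (e q) (e l) (e p) * firstForm B (e r) (e i) (e j)) := by
    intro A e
    simp only [curvPoly, ricciPoly, mul_add, Finset.sum_add_distrib]
    rfl
  have Dl1 : ∀ q i j, IsLinearMap ℝ fun l => secondForm D l q i j := fun q i j =>
    ⟨fun u v => by simp [secondForm]; ring, fun c v => by simp [secondForm]; ring⟩
  have Dl2 : ∀ l i j, IsLinearMap ℝ fun q => secondForm D l q i j := fun l i j =>
    ⟨fun u v => by simp [secondForm]; ring, fun c v => by simp [secondForm]; ring⟩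
  have Dl3 : ∀ l q j, IsLinearMap ℝ fun i => secondForm D l q i j := fun l q j =>
    ⟨fun u v => by simp [secondForm]; ring, fun c v => by simp [secondForm]; ring⟩
  have Dl4 : ∀ l q i, IsLinearMap ℝ fun j => secondForm D l q i j := fun l q i =>
    ⟨fun u v => by simp [secondForm]; ring, fun c v => by simp [secondForm]; ring⟩
  have Bl1 : ∀ i j, IsLinearMap ℝ fun q => firstForm B q i j := fun i j =>
    ⟨fun u v => by simp [firstForm]; ring, fun c v => by simp [firstForm]; ring⟩
  have Bl2 : ∀ q j, IsLinearMap ℝ fun i => firstForm B q i j := fun q j =>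
    ⟨fun u v => by simp [firstForm]; ring, fun c v => by simp [firstForm]; ring⟩
  have Bl3 : ∀ q i, IsLinearMap ℝ fun j => firstForm B q i j := fun q i =>
    ⟨fun u v => by simp [firstForm]; ring, fun c v => by simp [firstForm]; ring⟩
  have lc : ∀ (c : ℝ) {f : E n → ℝ}, IsLinearMap ℝ f → IsLinearMap ℝ fun v => c * f v :=
    fun c f h => ⟨fun u v => by rw [h.map_add]; ring, fun a v => by
      rw [h.map_smul]; simp only [smul_eq_mul]; ring⟩
  have lc' : ∀ (c : ℝ) {f : E n → ℝ}, IsLinearMap ℝ f → IsLinearMap ℝ fun v => f v * c :=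
    fun c f h => ⟨fun u v => by rw [h.map_add]; ring, fun a v => by
      rw [h.map_smul]; simp only [smul_eq_mul]; ring⟩
  have ls : ∀ {f g : E n → ℝ}, IsLinearMap ℝ f → IsLinearMap ℝ g →
      IsLinearMap ℝ fun v => f v - g v :=
    fun {f g} h h' => ⟨fun u v => by rw [h.map_add, h'.map_add]; ring, fun a v => by
      rw [h.map_smul, h'.map_smul]; simp only [smul_eq_mul]; ring⟩
  have lss : ∀ {f : Fin n → Fin n → E n → ℝ}, (∀ i j, IsLinearMap ℝ (f i j)) →
      IsLinearMap ℝ fun v => ∑ i, ∑ j, f i j v := fun hf =>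
    isLinearMap_sum _ fun i => isLinearMap_sum _ fun j => hf i j
  rw [key, key]
  congr 1
  · calc _ = ∑ i, ∑ j, A i j * ∑ l, ∑ p, A' l p *
          (secondForm D (e' l) (e' p) (e i) (e j) - secondForm D (e j) (e' p) (e i) (e' l)) := by
          refine Finset.sum_congr rfl fun i _ => Finset.sum_congr rfl fun j _ => ?_
          rw [sum_contract he hA (fun u v =>
            secondForm D u v (e i) (e j) - secondForm D (e j) v (e i) u)
            (fun v => ls (Dl1 _ _ _) (Dl4 _ _ _)) (fun u => ls (Dl2 _ _ _) (Dl2 _ _ _))]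
      _ = _ := sum_contract he hA (fun u v => ∑ l, ∑ p, A' l p *
            (secondForm D (e' l) (e' p) u v - secondForm D v (e' p) u (e' l)))
            (fun v => lss fun i j => lc _ (ls (Dl3 _ _ _) (Dl3 _ _ _)))
            (fun u => lss fun i j => lc _ (ls (Dl4 _ _ _) (Dl1 _ _ _)))
  · calc _ = ∑ i, ∑ j, A i j * ∑ l, ∑ p, A l p * ∑ q, ∑ r, A' q r *
          (firstForm B (e' q) (e j) (e p) * firstForm B (e' r) (e i) (e l)
            - firstForm B (e' q) (e l) (e p) * firstForm B (e' r) (e i) (e j)) := by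
          refine Finset.sum_congr rfl fun i _ => Finset.sum_congr rfl fun j _ => ?_
          congr 1
          refine Finset.sum_congr rfl fun l _ => Finset.sum_congr rfl fun p _ => ?_
          rw [sum_contract he hA (fun u v =>
            firstForm B u (e j) (e p) * firstForm B v (e i) (e l)
            - firstForm B u (e l) (e p) * firstForm B v (e i) (e j))
            (fun v => ls (lc' _ (Bl1 _ _)) (lc' _ (Bl1 _ _)))
            (fun u => ls (lc _ (Bl1 _ _)) (lc _ (Bl1 _ _)))]
      _ = ∑ i, ∑ j, A i j * ∑ l, ∑ p, A' l p * ∑ q, ∑ r, A' q r *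
          (firstForm B (e' q) (e j) (e' p) * firstForm B (e' r) (e i) (e' l)
            - firstForm B (e' q) (e' l) (e' p) * firstForm B (e' r) (e i) (e j)) := by
          refine Finset.sum_congr rfl fun i _ => Finset.sum_congr rfl fun j _ => ?_
          rw [sum_contract he hA (fun u v => ∑ q, ∑ r, A' q r *
            (firstForm B (e' q) (e j) v * firstForm B (e' r) (e i) u
            - firstForm B (e' q) u v * firstForm B (e' r) (e i) (e j)))
            (fun v => lss fun q r => lc _ (ls (lc _ (Bl3 _ _)) (lc' _ (Bl2 _ _))))
            (fun u => lss fun q r => lc _ (ls (lc' _ (Bl3 _ _)) (lc' _ (Bl3 _ _))))]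
      _ = _ := sum_contract he hA (fun u v => ∑ l, ∑ p, A' l p * ∑ q, ∑ r, A' q r *
          (firstForm B (e' q) v (e' p) * firstForm B (e' r) u (e' l)
            - firstForm B (e' q) (e' l) (e' p) * firstForm B (e' r) u v))
            (fun v => lss fun i j => lc _ (lss fun q r => lc _
              (ls (lc _ (Bl2 _ _)) (lc _ (Bl2 _ _)))))
            (fun u => lss fun i j => lc _ (lss fun q r => lc _
              (ls (lc' _ (Bl2 _ _)) (lc _ (Bl3 _ _)))))

end Frame

/-! ### The scalar curvature as a function of the two-jet -/

/-- Two-jets of metrics: the components and their first and second derivatives. -/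
abbrev Jet (n : ℕ) : Type :=
  (Fin n → Fin n → ℝ) × (Fin n → Fin n → Fin n → ℝ) × (Fin n → Fin n → Fin n → Fin n → ℝ)

/-- The scalar curvature of a metric with two-jet `J`. -/
def jetCurv {n : ℕ} (J : Jet n) : ℝ :=
  curvPoly (fun i j => (Matrix.of J.1)⁻¹ i j) J.2.1 J.2.2

/-- Away from degenerate metrics this is a rational function of the jet. -/
lemma contDiffAt_jetCurv {n : ℕ} {J : Jet n} (hJ : (Matrix.of J.1).det ≠ 0) :
    ContDiffAt ℝ 2 jetCurv J := by
  have hA : ∀ i j, ContDiffAt ℝ 2 (fun J : Jet n => (Matrix.of J.1)⁻¹ i j) J := by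
    refine contDiffAt_inv_entry (fun i j => ?_) hJ
    simp only [Matrix.of_apply]
    fun_prop
  have hB : ∀ i j k, ContDiffAt ℝ 2 (fun J : Jet n => lowerChr J.2.1 i j k) J := by
    intro i j k
    unfold lowerChr
    fun_prop
  have hD : ∀ i j k l, ContDiffAt ℝ 2 (fun J : Jet n => dLowerChr J.2.2 i j k l) J := by
    intro i j k l
    unfold dLowerChr
    fun_prop
  have S : ∀ {f : Fin n → Fin n → Jet n → ℝ}, (∀ i j, ContDiffAt ℝ 2 (f i j) J) →
      ContDiffAt ℝ 2 (fun J => ∑ i, ∑ j, f i j J) J := fun hf =>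
    ContDiffAt.sum fun i _ => ContDiffAt.sum fun j _ => hf i j
  refine S fun i j => (hA i j).mul (ContDiffAt.add (S fun l p => (hA l p).mul ?_)
    (S fun l p => (hA l p).mul (S fun q r => (hA q r).mul ?_)))
  · exact (hD _ _ _ _).sub (hD _ _ _ _)
  · exact ((hB _ _ _).mul (hB _ _ _)).sub ((hB _ _ _).mul (hB _ _ _))

/-- A first-order expansion at a moving point `x`, but with the derivative frozen at `x₀`. The price
is the extra term `‖x - x₀‖ ‖d‖`. Later `x` is the jet of `g`, `x₀` the limiting hyperbolic jet and
`d` the jet of the perturbation. -/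
lemma exists_second_order_bound {V : Type*} [NormedAddCommGroup V] [NormedSpace ℝ V]
    {f : V → ℝ} {x₀ : V} (hf : ContDiffAt ℝ 2 f x₀) :
    ∃ K > 0, ∃ r > 0, ∀ x d : V, ‖x - x₀‖ ≤ r → ‖d‖ ≤ r →
      |f (x + d) - f x - fderiv ℝ f x₀ d| ≤ K * ‖d‖ * (‖x - x₀‖ + ‖d‖) := by
  obtain ⟨C, t, ht, hL⟩ :=
    (hf.fderiv_right (m := 1) (by norm_num)).exists_lipschitzOnWith
  have hd : ∀ᶠ x in 𝓝 x₀, DifferentiableAt ℝ f x := by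
    filter_upwards [hf.eventually (by simp)] with x hx using hx.differentiableAt (by norm_num)
  obtain ⟨ε, hε, hball⟩ := Metric.mem_nhds_iff.1 (Filter.inter_mem ht hd)
  refine ⟨C + 1, by positivity, ε / 3, by positivity, fun x d hx hd' => ?_⟩
  -- The ball of radius `ρ` about `x₀` contains `x` and `x + d`, and on it the derivative differs
  -- from that at `x₀` by at most `C ρ`.
  set ρ := ‖x - x₀‖ + ‖d‖ with hρ
  have hρε : ρ < ε := by linarith
  have hmem : ∀ z ∈ Metric.closedBall x₀ ρ, z ∈ t ∧ DifferentiableAt ℝ f z := fun z hz =>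
    hball (lt_of_le_of_lt (Metric.mem_closedBall.1 hz) hρε)
  have hxm : x ∈ Metric.closedBall x₀ ρ := by
    rw [Metric.mem_closedBall, dist_eq_norm]; linarith [norm_nonneg d]
  have hxdm : x + d ∈ Metric.closedBall x₀ ρ := by
    rw [Metric.mem_closedBall, dist_eq_norm, add_sub_right_comm]
    exact norm_add_le _ _
  have h0 : x₀ ∈ Metric.closedBall x₀ ρ := Metric.mem_closedBall_self (by positivity)
  have key := (convex_closedBall x₀ ρ).norm_image_sub_le_of_norm_hasFDerivWithin_le'
    (f := f) (f' := fderiv ℝ f) (φ := fderiv ℝ f x₀) (C := C * ρ)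
    (fun z hz => (hmem z hz).2.hasFDerivAt.hasFDerivWithinAt)
    (fun z hz => by
      refine (hL.norm_sub_le (hmem z hz).1 (hmem x₀ h0).1).trans ?_
      gcongr
      rw [← dist_eq_norm]; exact Metric.mem_closedBall.1 hz) hxm hxdm
  rw [add_sub_cancel_left, Real.norm_eq_abs] at key
  refine key.trans ?_
  have : 0 ≤ ρ * ‖d‖ := by positivity
  nlinarith

/-- The indicator of the radial index. -/
def rad {m : ℕ} (a : Fin (m + 1)) : ℝ := if a = 0 then 1 else 0

/-- The Kronecker symbol on the tangential indices. -/
def tang {m : ℕ} (a b : Fin (m + 1)) : ℝ := if a = b ∧ a ≠ 0 then 1 else 0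

@[simp] lemma rad_zero {m : ℕ} : rad (0 : Fin (m + 1)) = 1 := by simp [rad]
@[simp] lemma rad_succ {m : ℕ} (a : Fin m) : rad a.succ = 0 := by simp [rad]
@[simp] lemma tang_zero_left {m : ℕ} (a : Fin (m + 1)) : tang 0 a = 0 := by simp [tang]
@[simp] lemma tang_zero_right {m : ℕ} (a : Fin (m + 1)) : tang a 0 = 0 := by
  simp only [tang, ite_eq_right_iff]; rintro ⟨rfl, h⟩; exact absurd rfl h
@[simp] lemma tang_succ {m : ℕ} (a b : Fin m) : tang a.succ b.succ = if a = b then 1 else 0 := by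
  simp [tang]

/-- The first derivatives, in an adapted frame, of the hyperbolic metric at `‖y‖² = q`. -/
def hypB {m : ℕ} (q : ℝ) (k u v : Fin (m + 1)) : ℝ :=
  -2 * (rad k * rad u * rad v) + (-4 + q) * (rad k * tang u v)
    + (-1 + 3 / 2 * q - q ^ 2 / 16) * (tang k u * rad v + tang k v * rad u)

/-- The second derivatives, in an adapted frame, of the hyperbolic metric at `‖y‖² = q`. -/
def hypD {m : ℕ} (q : ℝ) (k l u v : Fin (m + 1)) : ℝ :=
  6 * (rad k * rad l * rad u * rad v) + (20 - 3 * q) * (rad k * rad l * tang u v)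
    + (2 - 5 * q + q ^ 2 / 8) * (tang k l * rad u * rad v)
    + (-4 * q + q ^ 2) * (tang k l * tang u v)
    + (5 - 9 / 2 * q + q ^ 2 / 16) * (tang l u * rad k * rad v + tang l v * rad k * rad u
      + tang k u * rad l * rad v + tang k v * rad l * rad u)
    + (-q + 3 / 2 * q ^ 2 - q ^ 3 / 16) * (tang k u * tang l v + tang l u * tang k v)

/-- The two-jet of the hyperbolic metric in an adapted frame at `‖y‖² = q`. -/
def hypJet (m : ℕ) (q : ℝ) : Jet (m + 1) :=
  (fun a b => rad a * rad b + (1 - q / 2 + q ^ 2 / 16) * tang a b, hypB q, hypD q)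

/-- The two-jet in which only the component `00` of the metric is present. -/
def radJet {m : ℕ} (φ : ℝ) (p : Fin (m + 1) → ℝ) (P : Fin (m + 1) → Fin (m + 1) → ℝ) :
    Jet (m + 1) :=
  (fun a b => φ * (rad a * rad b), fun k a b => p k * (rad a * rad b),
    fun k l a b => P k l * (rad a * rad b))

lemma sum_diag {m : ℕ} (w : ℝ) (X : Fin (m + 1) → Fin (m + 1) → ℝ) :
    ∑ i, ∑ j, (w * (rad i * rad j) + tang i j) * X i j
      = w * X 0 0 + ∑ a : Fin m, X a.succ a.succ := by
  simp [Fin.sum_univ_succ]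

lemma inv_diag {m : ℕ} {w : ℝ} (hw : w ≠ 0) :
    (Matrix.of fun a b : Fin (m + 1) => w * (rad a * rad b) + tang a b)⁻¹
      = Matrix.of fun a b : Fin (m + 1) => w⁻¹ * (rad a * rad b) + tang a b := by
  apply Matrix.inv_eq_right_inv
  ext i j
  rw [Matrix.mul_apply]
  refine Fin.cases ?_ (fun i => ?_) i <;> refine Fin.cases ?_ (fun j => ?_) j <;>
    simp [Fin.sum_univ_succ, hw, Matrix.one_apply, (Fin.succ_ne_zero _).symm]

/-- At `q = 0` the perturbed metric is diagonal in the frame, so the curvature can be computed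
exactly; the linearisation is then the derivative of an explicit function of one variable. Without
perturbation the value is `-m(m+1)`, the curvature of hyperbolic space of dimension `m + 1`. -/
lemma jetCurv_hypJet_add {m : ℕ} (φ : ℝ) (p : Fin (m + 1) → ℝ)
    (P : Fin (m + 1) → Fin (m + 1) → ℝ) (hφ : 1 + φ ≠ 0) :
    jetCurv (hypJet m 0 + radJet φ p P)
      = -(1 + φ)⁻¹ * ∑ a : Fin m, P a.succ a.succ
        + ((1 + φ)⁻¹) ^ 2 * (1 / 2 * ∑ a : Fin m, p a.succ ^ 2 + 2 * m * (1 - p 0 / 2))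
        - (1 + φ)⁻¹ * (m * (m + 3)) := by
  have h1 : (Matrix.of (hypJet m 0 + radJet φ p P).1)
      = Matrix.of fun a b : Fin (m + 1) => (1 + φ) * (rad a * rad b) + tang a b := by
    ext a b; simp [hypJet, radJet]; ring
  rw [jetCurv, h1, inv_diag hφ]
  set w := (1 + φ)⁻¹
  simp only [Matrix.of_apply, curvPoly, ricciPoly, sum_diag]
  simp [hypJet, radJet, hypB, hypD, lowerChr, dLowerChr]
  have e1 : ∀ x : Fin m, (∑ x_1 : Fin m,
      2⁻¹ * (((if x_1 = x then (-4 : ℝ) else 0) + if x = x_1 then -1 else 0)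
        - if x_1 = x then -1 else 0) *
      (2⁻¹ * (((if x_1 = x then -4 else 0) + if x = x_1 then -1 else 0)
        - if x_1 = x then -1 else 0))) = 4 := by
    intro x
    rw [Finset.sum_eq_single x (fun b _ hb => by simp [hb, hb.symm]) (by simp)]
    norm_num
  have e2 : ∀ x : Fin m, (∑ x_1 : Fin m,
      2⁻¹ * (((if x = x_1 then (-1 : ℝ) else 0) + if x_1 = x then -4 else 0)
        - if x_1 = x then -1 else 0) *
      (2⁻¹ * (((if x = x_1 then -1 else 0) + if x_1 = x then -4 else 0)
        - if x_1 = x then -1 else 0))) = 4 := by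
    intro x
    rw [Finset.sum_eq_single x (fun b _ hb => by simp [hb, hb.symm]) (by simp)]
    norm_num
  have e3 : ∀ x : Fin m, (∑ x_1 : Fin m,
      w * (2⁻¹ * (((if x = x_1 then (-1 : ℝ) else 0) + if x_1 = x then -1 else 0)
          - if x = x_1 then -4 else 0) *
        (2⁻¹ * (((if x = x_1 then -1 else 0) + if x_1 = x then -1 else 0)
          - if x = x_1 then -4 else 0)) -
        2⁻¹ * (-1 + -1 + 4) * (2⁻¹ * (-1 + -1 + 4)))) = w * (1 - m) := by
    intro x
    have : ∀ x_1 : Fin m, w * (2⁻¹ * (((if x = x_1 then (-1 : ℝ) else 0)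
        + if x_1 = x then -1 else 0) - if x = x_1 then -4 else 0) *
        (2⁻¹ * (((if x = x_1 then -1 else 0) + if x_1 = x then -1 else 0)
          - if x = x_1 then -4 else 0)) - 2⁻¹ * (-1 + -1 + 4) * (2⁻¹ * (-1 + -1 + 4)))
        = w * ((if x_1 = x then 1 else 0) - 1) := by
      intro x_1
      by_cases h : x = x_1
      · simp [h]
      · simp [h, Ne.symm h]; norm_num
    simp only [this, ← Finset.mul_sum, Finset.sum_sub_distrib]
    simp
  simp only [e1, e2, e3, Finset.sum_add_distrib, Finset.sum_sub_distrib, ← Finset.mul_sum]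
  simp only [Finset.sum_const, Finset.card_univ, Fintype.card_fin, nsmul_eq_mul]
  have e4 : ∑ i : Fin m, 2⁻¹ * p i.succ * (2⁻¹ * p i.succ) = 1 / 4 * ∑ a : Fin m, p a.succ ^ 2 := by
    rw [Finset.mul_sum]
    exact Finset.sum_congr rfl fun i _ => by ring
  rw [e4]
  ring

lemma det_hypJet {m : ℕ} : (Matrix.of (hypJet m 0).1).det ≠ 0 := by
  have h : Matrix.of (hypJet m 0).1
      = Matrix.of fun a b : Fin (m + 1) => (1 : ℝ) * (rad a * rad b) + tang a b := by
    ext a b; simp [hypJet]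
  have h' := Matrix.isUnit_det_of_right_inverse (A := Matrix.of (hypJet m 0).1)
    (B := Matrix.of (hypJet m 0).1) (by
      rw [h]
      ext i j
      rw [Matrix.mul_apply]
      refine Fin.cases ?_ (fun i => ?_) i <;> refine Fin.cases ?_ (fun j => ?_) j <;>
        simp [Fin.sum_univ_succ, Matrix.one_apply, (Fin.succ_ne_zero _).symm])
  exact h'.ne_zero

/-- The linearised scalar curvature at the limiting hyperbolic jet, in the radial direction. -/
lemma fderiv_jetCurv_radJet {m : ℕ} (φ : ℝ) (p : Fin (m + 1) → ℝ)
    (P : Fin (m + 1) → Fin (m + 1) → ℝ) :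
    fderiv ℝ jetCurv (hypJet m 0) (radJet φ p P)
      = m * (m - 1) * φ - m * p 0 - ∑ a : Fin m, P a.succ a.succ := by
  have hf : HasFDerivAt jetCurv (fderiv ℝ jetCurv (hypJet m 0)) (hypJet m 0) :=
    ((contDiffAt_jetCurv det_hypJet).differentiableAt (by norm_num)).hasFDerivAt
  have hl : HasDerivAt (fun t : ℝ => hypJet m 0 + t • radJet φ p P) (radJet φ p P) 0 := by
    simpa using ((hasDerivAt_id (0 : ℝ)).smul_const (radJet φ p P)).const_add (hypJet m 0)
  have h1 : HasDerivAt (fun t : ℝ => jetCurv (hypJet m 0 + t • radJet φ p P))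
      (fderiv ℝ jetCurv (hypJet m 0) (radJet φ p P)) 0 := by
    have := HasFDerivAt.comp_hasDerivAt (f := fun t : ℝ => hypJet m 0 + t • radJet φ p P)
      (x := (0 : ℝ)) (l := jetCurv) (l' := fderiv ℝ jetCurv (hypJet m 0)) (by simpa using hf) hl
    exact this
  have hs : ∀ t : ℝ, t • radJet φ p P = radJet (t * φ) (t • p) (t • P) := by
    intro t
    simp only [radJet, Prod.smul_mk]
    congr 1
    · ext a b; simp [mul_assoc]
    congr 1
    · ext a b c; simp [mul_assoc]
    · ext a b c d; simp [mul_assoc]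
  set S := ∑ a : Fin m, P a.succ a.succ with hS
  set Q := ∑ a : Fin m, p a.succ ^ 2 with hQ
  have hev : (fun t : ℝ => jetCurv (hypJet m 0 + t • radJet φ p P)) =ᶠ[𝓝 0] fun t =>
      -(1 + t * φ)⁻¹ * (t * S) + ((1 + t * φ)⁻¹) ^ 2 * (1 / 2 * (t ^ 2 * Q)
        + 2 * m * (1 - t * p 0 / 2)) - (1 + t * φ)⁻¹ * (m * (m + 3)) := by
    have : ∀ᶠ t : ℝ in 𝓝 0, 1 + t * φ ≠ 0 := by
      have hc : ContinuousAt (fun t : ℝ => 1 + t * φ) 0 := by fun_prop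
      exact hc.eventually_ne (by simp)
    filter_upwards [this] with t ht
    rw [hs, jetCurv_hypJet_add _ _ _ ht]
    simp [hS, hQ, Finset.mul_sum, mul_pow]
  have h0 : HasDerivAt (fun t : ℝ => 1 + t * φ) φ 0 := by
    simpa using ((hasDerivAt_id (0 : ℝ)).mul_const φ).const_add 1
  have hi : HasDerivAt (fun t : ℝ => (1 + t * φ)⁻¹) (-φ) 0 := by
    have := h0.fun_inv (by simp)
    simpa using this
  have hid := hasDerivAt_id' (0 : ℝ)
  have h2 := ((hi.fun_neg.fun_mul (hid.mul_const S)).fun_add ((hi.fun_pow 2).fun_mul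
    ((((hid.fun_pow 2).mul_const Q).const_mul (1 / 2)).fun_add
      ((((hid.mul_const (p 0)).div_const 2).const_sub 1).const_mul (2 * (m : ℝ)))))).fun_sub
    (hi.mul_const ((m : ℝ) * (m + 3)))
  have h3 := h1.unique (h2.congr_of_eventuallyEq hev)
  rw [h3]
  simp
  ring

/-- The component `∂₀∂₀g₀₀` does not enter the scalar curvature. -/
lemma jetCurv_add_radial {m : ℕ} (J : Jet (m + 1)) (s : ℝ) :
    jetCurv (J + (0, 0, fun k l a b => s * (rad k * rad l * rad a * rad b))) = jetCurv J := by
  simp only [jetCurv, Prod.fst_add, Prod.snd_add, add_zero, curvPoly]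
  refine Finset.sum_congr rfl fun i _ => Finset.sum_congr rfl fun j _ => ?_
  congr 1
  simp only [ricciPoly]
  congr 1
  refine Finset.sum_congr rfl fun l _ => Finset.sum_congr rfl fun p _ => ?_
  -- The addition to `dLowerChr` is totally symmetric in its four indices, so it cancels in the
  -- difference `dLowerChr D l p i j - dLowerChr D j p i l`.
  simp only [dLowerChr, Pi.add_apply]
  ring

/-! ### Adapted frames -/

/-- The two-jet of the family `F` of bilinear forms in the frame `e` at `y`. -/
def frameJet {n : ℕ} (F : E n → E n →L[ℝ] E n →L[ℝ] ℝ) (y : E n) (e : Fin n → E n) : Jet n :=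
  (fun a b => F y (e a) (e b), jetOne F y e, jetTwo F y e)

lemma eq_sum_single {n : ℕ} (u : E n) : u = ∑ i, u i • stdFrame n i := by
  ext j
  simp [stdFrame, Finset.sum_apply, Pi.single_apply]

/-- With the vectors `e a` as columns of `P`, the Gram matrix of the frame is `Pᵀ G P`. If its
determinant is nonzero then both `P` and `G` are invertible, so it need not be assumed separately
that `e` is a basis. -/
lemma inv_eq_frame {n : ℕ} {G : E n → Matrix (Fin n) (Fin n) ℝ} {y : E n}
    (e : Fin n → E n) (hdet : (Matrix.of (frameJet (fun z => bilOf (G z)) y e).1).det ≠ 0) :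
    (G y).det ≠ 0 ∧ ∀ i j, (G y)⁻¹ i j = ∑ a, ∑ b, e a i *
      (Matrix.of (frameJet (fun z => bilOf (G z)) y e).1)⁻¹ a b * e b j := by
  set P : Matrix (Fin n) (Fin n) ℝ := Matrix.of fun i a => e a i with hP
  have hGh : Matrix.of (frameJet (fun z => bilOf (G z)) y e).1 = P.transpose * G y * P := by
    ext a b
    simp only [frameJet, Matrix.of_apply, bilOf_apply, Matrix.mul_apply, Matrix.transpose_apply, hP,
      Finset.sum_mul]
    rw [Finset.sum_comm]
    exact Finset.sum_congr rfl fun i _ => Finset.sum_congr rfl fun j _ => by ring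
  have hdet' := hdet
  rw [hGh, Matrix.det_mul, Matrix.det_mul, Matrix.det_transpose] at hdet'
  have hPd : P.det ≠ 0 := right_ne_zero_of_mul hdet'
  have hPu : IsUnit P.det := isUnit_iff_ne_zero.2 hPd
  have hPtu : IsUnit P.transpose.det := by rwa [Matrix.det_transpose]
  refine ⟨right_ne_zero_of_mul (left_ne_zero_of_mul hdet'), fun i j => ?_⟩
  have h1 : (G y)⁻¹ = P * (Matrix.of (frameJet (fun z => bilOf (G z)) y e).1)⁻¹ * P.transpose := by
    rw [hGh, Matrix.mul_inv_rev, Matrix.mul_inv_rev, ← Matrix.mul_assoc,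
      Matrix.mul_nonsing_inv _ hPu, Matrix.one_mul, Matrix.mul_assoc,
      Matrix.nonsing_inv_mul _ hPtu, Matrix.mul_one]
  rw [h1]
  simp only [Matrix.mul_apply, Matrix.transpose_apply, Finset.sum_mul]
  rw [Finset.sum_comm]
  rfl

lemma scalarCurvature_eq_jetCurv {n : ℕ} {G : E n → Matrix (Fin n) (Fin n) ℝ} {y : E n}
    (hG : ∀ i j, ContDiffAt ℝ 2 (fun z => G z i j) y) (hs : ∀ᶠ z in 𝓝 y, (G z).IsSymm)
    (e : Fin n → E n) (hdet : (Matrix.of (frameJet (fun z => bilOf (G z)) y e).1).det ≠ 0) :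
    scalarCurvature G y = jetCurv (frameJet (fun z => bilOf (G z)) y e) := by
  obtain ⟨hGd, hinv⟩ := inv_eq_frame e hdet
  rw [scalarCurvature_eq_curvPoly hG hs hGd, jetCurv]
  exact curvPoly_frame (fderiv ℝ (fun z => bilOf (G z)) y)
    (fderiv ℝ (fderiv ℝ fun z => bilOf (G z)) y) (e := stdFrame n) (e' := e)
    (P := fun i a => e a i) (fun a => eq_sum_single (e a)) hinv

/-- A frame at `y` adapted to the collar: `e₀ = y` is the vector `x ∂ₓ`, the other vectors are
tangent to the spheres, orthogonal to each other, and of Euclidean length `x²`. -/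
structure IsAdapted {m : ℕ} (y : E (m + 1)) (e : Fin (m + 1) → E (m + 1)) : Prop where
  zero : e 0 = y
  inner_eq : ∀ a b, inner ℝ (e a) (e b) = ‖y‖ ^ 2 * (rad a * rad b) + (‖y‖ ^ 2) ^ 2 * tang a b

lemma IsAdapted.inner_left {m : ℕ} {y : E (m + 1)} {e : Fin (m + 1) → E (m + 1)}
    (h : IsAdapted y e) (a : Fin (m + 1)) : inner ℝ y (e a) = ‖y‖ ^ 2 * rad a := by
  have := h.inner_eq 0 a
  rw [h.zero] at this
  simpa using this

lemma exists_orthonormal_frame {m : ℕ} {ξ : E (m + 1)} (hξ : ‖ξ‖ = 1) :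
    ∃ b : OrthonormalBasis (Fin (m + 1)) ℝ (E (m + 1)), b 0 = ξ := by
  have hv : Orthonormal ℝ (({0} : Set (Fin (m + 1))).domRestrict fun _ => ξ) := by
    constructor
    · intro i; exact hξ
    · intro i j hij; exact absurd (Subsingleton.elim i j) hij
  obtain ⟨b, hb⟩ := hv.exists_orthonormalBasis_extension_of_card_eq
    (ι := Fin (m + 1)) (by simp)
  exact ⟨b, hb 0 rfl⟩

/-- An orthonormal basis starting with `y / ‖y‖` is rescaled by `x` in the radial direction and by
`x²` in the tangential ones. With this scaling the hyperbolic metric has diagonal entries `1` and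
`(1 - x²/4)²`, so the frame stays nondegenerate up to infinity. -/
lemma exists_isAdapted {m : ℕ} {y : E (m + 1)} (hy : y ≠ 0) :
    ∃ e : Fin (m + 1) → E (m + 1), IsAdapted y e := by
  have hy' : ‖y‖ ≠ 0 := norm_ne_zero_iff.2 hy
  obtain ⟨b, hb⟩ := exists_orthonormal_frame (m := m) (ξ := ‖y‖⁻¹ • y)
    (by rw [norm_smul, norm_inv, norm_norm, inv_mul_cancel₀ hy'])
  have hbb : ∀ a c, inner ℝ (b a) (b c) = if a = c then (1 : ℝ) else 0 :=
    orthonormal_iff_ite.1 b.orthonormal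
  refine ⟨fun a => (if a = 0 then ‖y‖ else ‖y‖ ^ 2) • b a, ?_, ?_⟩
  · simp [hb, smul_smul, hy']
  · intro a c
    rw [inner_smul_left, inner_smul_right, hbb]
    refine Fin.cases ?_ (fun a => ?_) a <;> refine Fin.cases ?_ (fun c => ?_) c
    · simp [sq]
    · simp [(Fin.succ_ne_zero _).symm]
    · simp [(Fin.succ_ne_zero _)]
    · simp [(Fin.succ_ne_zero _)]; split_ifs <;> ring

/-! ### Jets of metrics of the form `α |dy|² + f (y · dy)²` -/

section Scalar

variable {n : ℕ} {y : E n}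

/-- The second directional derivative `∂ₖ ∂ₗ s`. -/
def d2 (s : E n → ℝ) (y k l : E n) : ℝ := fderiv ℝ (fun z => fderiv ℝ s z l) y k

lemma jetOne_eq {G : E n → Matrix (Fin n) (Fin n) ℝ}
    (hG : ∀ i j, ContDiffAt ℝ 2 (fun z => G z i j) y) (e : Fin n → E n) (a b c : Fin n) :
    jetOne (fun z => bilOf (G z)) y e a b c
      = fderiv ℝ (fun z => bilOf (G z) (e b) (e c)) y (e a) := by
  rw [jetOne, ← fderiv_eval₂ ((contDiffAt_bilOf hG).differentiableAt (by norm_num))]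

lemma jetTwo_eq {G : E n → Matrix (Fin n) (Fin n) ℝ}
    (hG : ∀ i j, ContDiffAt ℝ 2 (fun z => G z i j) y) (e : Fin n → E n) (a b c d : Fin n) :
    jetTwo (fun z => bilOf (G z)) y e a b c d
      = d2 (fun z => bilOf (G z) (e c) (e d)) y (e a) (e b) := by
  rw [jetTwo, ← fderiv_eval₃ (differentiableAt_fderiv_bilOf hG), d2]
  congr 1
  apply Filter.EventuallyEq.fderiv_eq
  filter_upwards [eventually_contDiffAt hG] with z hz
  rw [fderiv_eval₂ ((contDiffAt_bilOf hz).differentiableAt (by norm_num))]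

lemma d2_congr {s t : E n → ℝ} (h : s =ᶠ[𝓝 y] t) (k l : E n) : d2 s y k l = d2 t y k l := by
  unfold d2
  congr 1
  apply Filter.EventuallyEq.fderiv_eq
  filter_upwards [h.fderiv (𝕜 := ℝ)] with z hz
  rw [hz]

lemma differentiableAt_fderiv_apply {s : E n → ℝ} (hs : ContDiffAt ℝ 2 s y) (l : E n) :
    DifferentiableAt ℝ (fun z => fderiv ℝ s z l) y :=
  ((hs.fderiv_right (m := 1) (by norm_num)).differentiableAt (by norm_num)).clm_apply
    (differentiableAt_const l)

lemma eventually_differentiableAt {s : E n → ℝ} (hs : ContDiffAt ℝ 2 s y) :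
    ∀ᶠ z in 𝓝 y, DifferentiableAt ℝ s z := by
  filter_upwards [hs.eventually (by simp)] with z hz using hz.differentiableAt (by norm_num)

lemma d2_add {s t : E n → ℝ} (hs : ContDiffAt ℝ 2 s y) (ht : ContDiffAt ℝ 2 t y) (k l : E n) :
    d2 (fun z => s z + t z) y k l = d2 s y k l + d2 t y k l := by
  unfold d2
  have : (fun z => fderiv ℝ (fun z => s z + t z) z l) =ᶠ[𝓝 y]
      fun z => fderiv ℝ s z l + fderiv ℝ t z l := by
    filter_upwards [eventually_differentiableAt hs, eventually_differentiableAt ht] with z h1 h2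
    rw [fderiv_fun_add h1 h2]; rfl
  rw [this.fderiv_eq, fderiv_fun_add (differentiableAt_fderiv_apply hs l)
    (differentiableAt_fderiv_apply ht l)]
  rfl

lemma fderiv_mul_apply {s t : E n → ℝ} (hs : DifferentiableAt ℝ s y)
    (ht : DifferentiableAt ℝ t y) (k : E n) :
    fderiv ℝ (fun z => s z * t z) y k = fderiv ℝ s y k * t y + s y * fderiv ℝ t y k := by
  rw [fderiv_fun_mul hs ht]; simp; ring

lemma d2_mul {s t : E n → ℝ} (hs : ContDiffAt ℝ 2 s y) (ht : ContDiffAt ℝ 2 t y) (k l : E n) :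
    d2 (fun z => s z * t z) y k l = d2 s y k l * t y + fderiv ℝ s y l * fderiv ℝ t y k
      + fderiv ℝ s y k * fderiv ℝ t y l + s y * d2 t y k l := by
  have : (fun z => fderiv ℝ (fun z => s z * t z) z l) =ᶠ[𝓝 y]
      fun z => fderiv ℝ s z l * t z + s z * fderiv ℝ t z l := by
    filter_upwards [eventually_differentiableAt hs, eventually_differentiableAt ht] with z h1 h2
    rw [fderiv_mul_apply h1 h2]
  have hs' := hs.differentiableAt (by norm_num)
  have ht' := ht.differentiableAt (by norm_num)
  have hs2 := differentiableAt_fderiv_apply hs l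
  have ht2 := differentiableAt_fderiv_apply ht l
  rw [d2, this.fderiv_eq, fderiv_fun_add (hs2.fun_mul ht') (hs'.fun_mul ht2)]
  simp only [add_apply]
  rw [fderiv_mul_apply hs2 ht', fderiv_mul_apply hs' ht2]
  simp only [d2]
  ring

lemma fderiv_inner_const (u k : E n) : fderiv ℝ (fun z : E n => inner ℝ z u) y k = inner ℝ k u := by
  have : HasFDerivAt (fun z : E n => inner ℝ z u) (innerSL ℝ u) y := by
    have := (innerSL ℝ u).hasFDerivAt (x := y)
    refine this.congr_of_eventuallyEq (Filter.Eventually.of_forall fun z => ?_)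
    simp [real_inner_comm]
  rw [this.fderiv]; simp [real_inner_comm]

lemma contDiffAt_inner_const {m : WithTop ℕ∞} (u : E n) :
    ContDiffAt ℝ m (fun z : E n => inner ℝ z u) y :=
  contDiffAt_id.inner ℝ contDiffAt_const

lemma d2_inner_const (u k l : E n) : d2 (fun z : E n => inner ℝ z u) y k l = 0 := by
  simp [d2, fderiv_inner_const]

/-- First derivatives of a radial function. -/
lemma fderiv_radial {A : ℝ → ℝ} {A' : ℝ} (hA : HasDerivAt A A' (‖y‖ ^ 2)) (k : E n) :
    fderiv ℝ (fun z : E n => A (‖z‖ ^ 2)) y k = 2 * A' * inner ℝ y k := by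
  have h := hA.comp_hasFDerivAt y (hasStrictFDerivAt_norm_sq y).hasFDerivAt
  have h' : fderiv ℝ (fun z : E n => A (‖z‖ ^ 2)) y = _ := h.fderiv
  rw [h']; simp; ring

/-- Second derivatives of a radial function. -/
lemma d2_radial {A A' : ℝ → ℝ} {A'' : ℝ} (hA : ∀ᶠ t in 𝓝 (‖y‖ ^ 2), HasDerivAt A (A' t) t)
    (hA' : HasDerivAt A' A'' (‖y‖ ^ 2)) (k l : E n) :
    d2 (fun z : E n => A (‖z‖ ^ 2)) y k l
      = 4 * A'' * (inner ℝ y k * inner ℝ y l) + 2 * A' (‖y‖ ^ 2) * inner ℝ k l := by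
  have hc : Filter.Tendsto (fun z : E n => ‖z‖ ^ 2) (𝓝 y) (𝓝 (‖y‖ ^ 2)) := by
    have : Continuous fun z : E n => ‖z‖ ^ 2 := by fun_prop
    exact this.continuousAt
  have : (fun z => fderiv ℝ (fun z : E n => A (‖z‖ ^ 2)) z l) =ᶠ[𝓝 y]
      fun z => (2 * A' (‖z‖ ^ 2)) * inner ℝ z l := by
    filter_upwards [hc.eventually hA] with z hz
    rw [fderiv_radial hz]
  have hd : HasDerivAt (fun t => 2 * A' t) (2 * A'') (‖y‖ ^ 2) := hA'.const_mul 2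
  have hdiff : DifferentiableAt ℝ (fun z : E n => 2 * A' (‖z‖ ^ 2)) y :=
    (HasDerivAt.comp_hasFDerivAt (h₂ := fun t => 2 * A' t) (f := fun z : E n => ‖z‖ ^ 2) y hd (hasStrictFDerivAt_norm_sq y).hasFDerivAt).differentiableAt
  rw [d2, this.fderiv_eq, fderiv_mul_apply hdiff
    ((contDiffAt_inner_const (m := 1) l).differentiableAt (by norm_num)),
    fderiv_radial (A := fun t => 2 * A' t) hd, fderiv_inner_const]
  ring

lemma fderiv_quad {f : E n → ℝ} (hf : DifferentiableAt ℝ f y) (k u v : E n) :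
    fderiv ℝ (fun z : E n => f z * (inner ℝ z u * inner ℝ z v)) y k
      = fderiv ℝ f y k * (inner ℝ y u * inner ℝ y v)
        + f y * (inner ℝ k u * inner ℝ y v + inner ℝ y u * inner ℝ k v) := by
  have hu := fun u => (contDiffAt_inner_const (m := 1) (y := y) u).differentiableAt (by norm_num)
  rw [fderiv_mul_apply hf ((hu u).fun_mul (hu v)), fderiv_mul_apply (hu u) (hu v),
    fderiv_inner_const, fderiv_inner_const]

lemma d2_quad {f : E n → ℝ} (hf : ContDiffAt ℝ 2 f y) (k l u v : E n) :
    d2 (fun z : E n => f z * (inner ℝ z u * inner ℝ z v)) y k l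
      = d2 f y k l * (inner ℝ y u * inner ℝ y v)
        + fderiv ℝ f y l * (inner ℝ k u * inner ℝ y v + inner ℝ y u * inner ℝ k v)
        + fderiv ℝ f y k * (inner ℝ l u * inner ℝ y v + inner ℝ y u * inner ℝ l v)
        + f y * (inner ℝ l u * inner ℝ k v + inner ℝ k u * inner ℝ l v) := by
  have hu := fun u => contDiffAt_inner_const (m := 2) (y := y) u
  have hu' := fun u => (hu u).differentiableAt (by norm_num)
  rw [d2_mul hf ((hu u).mul (hu v)), d2_mul (hu u) (hu v), fderiv_mul_apply (hu' u) (hu' v),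
    fderiv_mul_apply (hu' u) (hu' v)]
  simp only [fderiv_inner_const, d2_inner_const]
  ring

end Scalar

/-! ### The hyperbolic metric in an adapted frame -/

section Hyperbolic

/-- The angular factor of the hyperbolic metric, as a function of `q = ‖y‖²`. -/
def hypα (t : ℝ) : ℝ := (t ^ 2)⁻¹ - t⁻¹ / 2 + 1 / 16

/-- The radial correction in the hyperbolic metric, as a function of `q = ‖y‖²`. -/
def hypβ (t : ℝ) : ℝ := -(t ^ 3)⁻¹ + 3 / 2 * (t ^ 2)⁻¹ - t⁻¹ / 16

lemma inner_eq_sum {n : ℕ} (u v : E n) : inner ℝ u v = ∑ i, u i * v i := by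
  simp [PiLp.inner_apply, mul_comm]

lemma bilOf_one {n : ℕ} (u v : E n) : bilOf (1 : Matrix (Fin n) (Fin n) ℝ) u v = inner ℝ u v := by
  rw [bilOf_apply, inner_eq_sum]
  simp [Matrix.one_apply]

lemma bilOf_smul {n : ℕ} (c : ℝ) (A : Matrix (Fin n) (Fin n) ℝ) (u v : E n) :
    bilOf (c • A) u v = c * bilOf A u v := by
  simp [bilOf_apply, Finset.mul_sum, mul_assoc]

lemma bilOf_add {n : ℕ} (A B : Matrix (Fin n) (Fin n) ℝ) (u v : E n) :
    bilOf (A + B) u v = bilOf A u v + bilOf B u v := by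
  simp [bilOf_apply, add_mul, Finset.sum_add_distrib]

lemma bilOf_sub {n : ℕ} (A B : Matrix (Fin n) (Fin n) ℝ) (u v : E n) :
    bilOf (A - B) u v = bilOf A u v - bilOf B u v := by
  simp [bilOf_apply, sub_mul, Finset.sum_sub_distrib]

lemma bilOf_dxSq {n : ℕ} (y u v : E n) :
    bilOf (dxSq y) u v = (‖y‖ ^ 2)⁻¹ * (inner ℝ y u * inner ℝ y v) := by
  rw [bilOf_apply, inner_eq_sum, inner_eq_sum, Finset.sum_mul_sum, Finset.mul_sum]
  refine Finset.sum_congr rfl fun i _ => ?_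
  rw [Finset.mul_sum]
  refine Finset.sum_congr rfl fun j _ => ?_
  simp only [dxSq, angle, Matrix.of_apply, PiLp.smul_apply, smul_eq_mul, sq, mul_inv]
  ring

/-- In the form `α |dy|² + β (y · dy)²` the coefficients depend on `‖y‖²` only, which reduces all
derivatives to those of functions of one variable. -/
lemma bilOf_hyperbolicMetric {n : ℕ} {y : E n} (hy : y ≠ 0) (u v : E n) :
    bilOf (hyperbolicMetric y) u v
      = hypα (‖y‖ ^ 2) * inner ℝ u v + hypβ (‖y‖ ^ 2) * (inner ℝ y u * inner ℝ y v) := by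
  have hy' : ‖y‖ ≠ 0 := norm_ne_zero_iff.2 hy
  rw [hyperbolicMetric, roundMetric]
  simp only [bilOf_smul, bilOf_add, bilOf_sub, bilOf_one, bilOf_dxSq, hypα, hypβ]
  field_simp
  ring

lemma contDiffAt_dxSq {n : ℕ} {y : E n} (hy : y ≠ 0) {m : WithTop ℕ∞} (i j : Fin n) :
    ContDiffAt ℝ m (fun z => dxSq z i j) y := by
  have h : ContDiffAt ℝ m (fun z : E n => ‖z‖) y := contDiffAt_norm ℝ hy
  have h' := h.inv (norm_ne_zero_iff.2 hy)
  have hc : ∀ i, ContDiffAt ℝ m (fun z : E n => z i) y := fun i => by fun_prop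
  simp only [dxSq, angle, Matrix.of_apply, PiLp.smul_apply, smul_eq_mul]
  exact (h'.mul (hc i)).mul (h'.mul (hc j))

lemma contDiffAt_hyperbolicMetric {n : ℕ} {y : E n} (hy : y ≠ 0) {m : WithTop ℕ∞} (i j : Fin n) :
    ContDiffAt ℝ m (fun z => hyperbolicMetric z i j) y := by
  have h : ContDiffAt ℝ m (fun z : E n => ‖z‖ ^ 2) y := (contDiffAt_norm ℝ hy).pow 2
  have h' := h.inv (pow_ne_zero 2 (norm_ne_zero_iff.2 hy))
  simp only [hyperbolicMetric, roundMetric, Matrix.smul_apply, Matrix.add_apply, Matrix.sub_apply,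
    smul_eq_mul]
  exact h'.mul ((contDiffAt_dxSq hy i j).add (((contDiffAt_const.sub (h.div_const 4)).pow 2).mul
    (h'.mul (contDiffAt_const.sub (contDiffAt_dxSq hy i j)))))

lemma hasDerivAt_hypα {t : ℝ} (ht : t ≠ 0) :
    HasDerivAt hypα (-2 * (t ^ 3)⁻¹ + (t ^ 2)⁻¹ / 2) t := by
  have h2 := (hasDerivAt_pow 2 t).fun_inv (pow_ne_zero 2 ht)
  have h1 := hasDerivAt_inv ht
  have := ((h2.fun_sub (h1.div_const 2)).add_const (1 / 16 : ℝ))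
  refine this.congr_deriv ?_
  field_simp; ring

lemma hasDerivAt_hypα' {t : ℝ} (ht : t ≠ 0) :
    HasDerivAt (fun t : ℝ => -2 * (t ^ 3)⁻¹ + (t ^ 2)⁻¹ / 2) (6 * (t ^ 4)⁻¹ - (t ^ 3)⁻¹) t := by
  have h3 := (hasDerivAt_pow 3 t).fun_inv (pow_ne_zero 3 ht)
  have h2 := (hasDerivAt_pow 2 t).fun_inv (pow_ne_zero 2 ht)
  refine ((h3.const_mul (-2)).fun_add (h2.div_const 2)).congr_deriv ?_
  field_simp; ring

lemma hasDerivAt_hypβ {t : ℝ} (ht : t ≠ 0) :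
    HasDerivAt hypβ (3 * (t ^ 4)⁻¹ - 3 * (t ^ 3)⁻¹ + (t ^ 2)⁻¹ / 16) t := by
  have h3 := (hasDerivAt_pow 3 t).fun_inv (pow_ne_zero 3 ht)
  have h2 := (hasDerivAt_pow 2 t).fun_inv (pow_ne_zero 2 ht)
  have h1 := hasDerivAt_inv ht
  refine ((h3.fun_neg.fun_add (h2.const_mul (3 / 2))).fun_sub (h1.div_const 16)).congr_deriv ?_
  field_simp; ring

lemma hasDerivAt_hypβ' {t : ℝ} (ht : t ≠ 0) :
    HasDerivAt (fun t : ℝ => 3 * (t ^ 4)⁻¹ - 3 * (t ^ 3)⁻¹ + (t ^ 2)⁻¹ / 16)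
      (-12 * (t ^ 5)⁻¹ + 9 * (t ^ 4)⁻¹ - (t ^ 3)⁻¹ / 8) t := by
  have h4 := (hasDerivAt_pow 4 t).fun_inv (pow_ne_zero 4 ht)
  have h3 := (hasDerivAt_pow 3 t).fun_inv (pow_ne_zero 3 ht)
  have h2 := (hasDerivAt_pow 2 t).fun_inv (pow_ne_zero 2 ht)
  refine (((h4.const_mul 3).fun_sub (h3.const_mul 3)).fun_add (h2.div_const 16)).congr_deriv ?_
  field_simp; ring

lemma contDiffAt_radial {n : ℕ} {y : E n} {m : WithTop ℕ∞} {A : ℝ → ℝ}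
    (hA : ContDiffAt ℝ m A (‖y‖ ^ 2)) : ContDiffAt ℝ m (fun z : E n => A (‖z‖ ^ 2)) y :=
  hA.comp y (contDiff_norm_sq ℝ).contDiffAt

lemma contDiffAt_hypα {t : ℝ} (ht : t ≠ 0) {m : WithTop ℕ∞} : ContDiffAt ℝ m hypα t := by
  unfold hypα
  exact (((contDiffAt_id.pow 2).inv (pow_ne_zero 2 ht)).sub ((contDiffAt_id.inv ht).div_const 2)).add
    contDiffAt_const

lemma contDiffAt_hypβ {t : ℝ} (ht : t ≠ 0) {m : WithTop ℕ∞} : ContDiffAt ℝ m hypβ t := by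
  unfold hypβ
  exact ((((contDiffAt_id.pow 3).inv (pow_ne_zero 3 ht)).neg.add (contDiffAt_const.mul
    ((contDiffAt_id.pow 2).inv (pow_ne_zero 2 ht))))).sub ((contDiffAt_id.inv ht).div_const 16)

/-- The powers of `‖y‖` in the frame cancel the poles of `hypα`, `hypβ` and their derivatives. What
remains is polynomial in `q = ‖y‖²`, hence has a limit `hypJet m 0` at infinity, which serves as the
base point of the linearisation. -/
lemma frameJet_hyperbolicMetric {m : ℕ} {y : E (m + 1)} (hy : y ≠ 0)
    {e : Fin (m + 1) → E (m + 1)} (he : IsAdapted y e) :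
    frameJet (fun z => bilOf (hyperbolicMetric z)) y e = hypJet m (‖y‖ ^ 2) := by
  have hq : ‖y‖ ^ 2 ≠ 0 := pow_ne_zero 2 (norm_ne_zero_iff.2 hy)
  have hev : ∀ u v : E (m + 1), (fun z => bilOf (hyperbolicMetric z) u v) =ᶠ[𝓝 y] fun z =>
      hypα (‖z‖ ^ 2) * inner ℝ u v + hypβ (‖z‖ ^ 2) * (inner ℝ z u * inner ℝ z v) := by
    intro u v
    filter_upwards [isOpen_ne.mem_nhds hy] with z hz
    exact bilOf_hyperbolicMetric hz u v
  have hne : ∀ᶠ t in 𝓝 (‖y‖ ^ 2), t ≠ 0 := isOpen_ne.mem_nhds hq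
  have cα : ContDiffAt ℝ 2 (fun z : E (m + 1) => hypα (‖z‖ ^ 2)) y :=
    contDiffAt_radial (contDiffAt_hypα hq)
  have cβ : ContDiffAt ℝ 2 (fun z : E (m + 1) => hypβ (‖z‖ ^ 2)) y :=
    contDiffAt_radial (contDiffAt_hypβ hq)
  have cq : ∀ u v : E (m + 1), ContDiffAt ℝ 2
      (fun z : E (m + 1) => hypβ (‖z‖ ^ 2) * (inner ℝ z u * inner ℝ z v)) y := fun u v =>
    cβ.mul ((contDiffAt_inner_const u).mul (contDiffAt_inner_const v))
  have cα' : ∀ u v : E (m + 1), ContDiffAt ℝ 2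
      (fun z : E (m + 1) => hypα (‖z‖ ^ 2) * inner ℝ u v) y := fun u v => cα.mul contDiffAt_const
  have dα := cα.differentiableAt (by norm_num)
  have dβ := cβ.differentiableAt (by norm_num)
  have hG := fun i j => contDiffAt_hyperbolicMetric hy (m := 2) i j
  simp only [frameJet, hypJet]
  congr 1
  · ext a b
    rw [(hev _ _).eq_of_nhds, he.inner_left, he.inner_left, he.inner_eq, hypα, hypβ]
    field_simp
    ring
  congr 1
  · ext k u v
    rw [jetOne_eq hG, (hev _ _).fderiv_eq, fderiv_fun_add ((cα' _ _).differentiableAt (by norm_num))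
      ((cq _ _).differentiableAt (by norm_num))]
    simp only [add_apply]
    rw [fderiv_quad dβ, fderiv_mul_apply dα (differentiableAt_const _),
      fderiv_radial (hasDerivAt_hypα hq), fderiv_radial (hasDerivAt_hypβ hq)]
    simp only [he.inner_left, he.inner_eq, hypα, hypβ, fderiv_const_apply, zero_apply,
      hypB]
    field_simp
    ring
  · ext k l u v
    rw [jetTwo_eq hG, d2_congr (hev _ _), d2_add (cα' _ _) (cq _ _), d2_quad cβ,
      d2_mul cα contDiffAt_const,
      d2_radial (hne.mono fun t ht => hasDerivAt_hypα ht) (hasDerivAt_hypα' hq),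
      d2_radial (hne.mono fun t ht => hasDerivAt_hypβ ht) (hasDerivAt_hypβ' hq),
      fderiv_radial (hasDerivAt_hypα hq), fderiv_radial (hasDerivAt_hypβ hq),
      fderiv_radial (hasDerivAt_hypβ hq)]
    simp only [he.inner_left, he.inner_eq, hypα, hypβ, fderiv_const_apply, zero_apply,
      hypD, d2]
    field_simp
    ring

end Hyperbolic

/-! ### Covariant derivatives in a frame -/

section Tensor

variable {n k : ℕ}

/-- The value of a covariant tensor, given by its components, on vectors. -/
def evalT (t : (Fin k → Fin n) → ℝ) (v : Fin k → E n) : ℝ := ∑ I, t I * ∏ a, v a (I a)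

/-- If the inverse metric is `∑ f_b ⊗ f_b`, the norm is the Euclidean norm of the components in the
frame `f`. -/
lemma tensorNorm_eq {A : Matrix (Fin n) (Fin n) ℝ} {ι : Type*} [Fintype ι] [DecidableEq ι]
    {f : ι → E n}
    (hf : ∀ i j, A⁻¹ i j = ∑ b, f b i * f b j) (t : (Fin k → Fin n) → ℝ) :
    tensorNorm A t = √(∑ c : Fin k → ι, evalT t (fun a => f (c a)) ^ 2) := by
  rw [tensorNorm]
  congr 1
  have : ∀ I J : Fin k → Fin n, ∏ a, A⁻¹ (I a) (J a)
      = ∑ c : Fin k → ι, (∏ a, f (c a) (I a)) * ∏ a, f (c a) (J a) := by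
    intro I J
    simp only [hf, Finset.prod_univ_sum, Fintype.piFinset_univ, Finset.prod_mul_distrib]
  simp only [this, Finset.sum_mul]
  calc _ = ∑ I : Fin k → Fin n, ∑ c : Fin k → ι, ∑ J : Fin k → Fin n,
        (∏ a, f (c a) (I a)) * (∏ a, f (c a) (J a)) * t I * t J :=
        Finset.sum_congr rfl fun I _ => Finset.sum_comm
    _ = ∑ c : Fin k → ι, ∑ I : Fin k → Fin n, ∑ J : Fin k → Fin n,
        (∏ a, f (c a) (I a)) * (∏ a, f (c a) (J a)) * t I * t J := Finset.sum_comm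
    _ = _ := Finset.sum_congr rfl fun c _ => by
        rw [evalT, sq, Finset.sum_mul_sum]
        exact Finset.sum_congr rfl fun I _ => Finset.sum_congr rfl fun J _ => by ring

lemma abs_evalT_le_tensorNorm {A : Matrix (Fin n) (Fin n) ℝ} {ι : Type*} [Fintype ι]
    [DecidableEq ι] {f : ι → E n}
    (hf : ∀ i j, A⁻¹ i j = ∑ b, f b i * f b j) (t : (Fin k → Fin n) → ℝ) (c : Fin k → ι) :
    |evalT t (fun a => f (c a))| ≤ tensorNorm A t := by
  rw [tensorNorm_eq hf]
  apply Real.abs_le_sqrt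
  exact Finset.single_le_sum (f := fun c : Fin k → ι => evalT t (fun a => f (c a)) ^ 2)
    (fun c _ => sq_nonneg _) (Finset.mem_univ c)

lemma evalT_toTensor (A : Matrix (Fin n) (Fin n) ℝ) (v : Fin 2 → E n) :
    evalT (toTensor A) v = bilOf A (v 0) (v 1) := by
  rw [evalT, bilOf_apply, ← Finset.sum_product', ← (finTwoArrowEquiv (Fin n)).symm.sum_comp]
  simp [toTensor, Fin.prod_univ_two]

/-- The Christoffel symbol as a bilinear map. -/
def christoffelVec (G : E n → Matrix (Fin n) (Fin n) ℝ) (y u w : E n) : E n :=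
  WithLp.toLp 2 fun l => ∑ i, ∑ j, christoffel G l i j y * (u i * w j)

lemma christoffelVec_apply (G : E n → Matrix (Fin n) (Fin n) ℝ) (y u w : E n) (l : Fin n) :
    christoffelVec G y u w l = ∑ i, ∑ j, christoffel G l i j y * (u i * w j) := rfl

lemma fderiv_eq_sum_pd (f : E n → ℝ) (y u : E n) : fderiv ℝ f y u = ∑ i, u i * pd i f y := by
  conv_lhs => rw [eq_sum_single u]
  simp [pd, stdFrame]

/-- Both sums run over pairs, and `(J, l) ↦ (Function.update J a l, J a)` is an involution
exchanging the entry at `a` with the extra index. -/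
lemma sum_update_swap (a : Fin k) (F : (Fin k → Fin n) → Fin n → Fin n → ℝ) :
    ∑ J : Fin k → Fin n, ∑ l, F J (J a) l
      = ∑ J : Fin k → Fin n, ∑ j, F (Function.update J a j) j (J a) := by
  rw [← Finset.sum_product', ← Finset.sum_product']
  refine Finset.sum_nbij' (fun p => (Function.update p.1 a p.2, p.1 a))
    (fun p => (Function.update p.1 a p.2, p.1 a)) ?_ ?_ ?_ ?_ ?_ <;> simp

/-- The usual formula `(∇_u T)(v) = ∂_u (T(v)) - ∑ T(…, Γ(u, vₐ), …)`, where the vectors `v` are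
kept constant in `ℝⁿ`. It lets covariant derivatives be evaluated on the adapted frame frozen at one
point. -/
lemma evalT_covDeriv (G : E n → Matrix (Fin n) (Fin n) ℝ) (T : E n → (Fin k → Fin n) → ℝ)
    {y : E n} (hT : ∀ I, DifferentiableAt ℝ (fun z => T z I) y) (u : E n) (v : Fin k → E n) :
    evalT (covDeriv G T y) (Fin.cons u v)
      = fderiv ℝ (fun z => evalT (T z) v) y u
        - ∑ a, evalT (T y) (Function.update v a (christoffelVec G y u (v a))) := by
  have h1 : fderiv ℝ (fun z => evalT (T z) v) y u
      = ∑ i, ∑ J : Fin k → Fin n, pd i (fun z => T z J) y * (u i * ∏ a, v a (J a)) := by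
    unfold evalT
    rw [fderiv_fun_sum fun J _ => (hT J).mul_const _]
    simp only [sum_apply]
    rw [Finset.sum_comm]
    refine Finset.sum_congr rfl fun J _ => ?_
    rw [fderiv_mul_const (hT J), smul_apply, fderiv_eq_sum_pd, smul_eq_mul, Finset.mul_sum]
    exact Finset.sum_congr rfl fun i _ => by ring
  have h2 : ∀ a, evalT (T y) (Function.update v a (christoffelVec G y u (v a)))
      = ∑ i, ∑ J : Fin k → Fin n, ∑ l, christoffel G l i (J a) y * T y (Function.update J a l)
          * (u i * ∏ b, v b (J b)) := by
    intro a
    have h3 : ∀ i, ∑ J : Fin k → Fin n, ∑ l, christoffel G l i (J a) y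
          * T y (Function.update J a l) * (u i * ∏ b, v b (J b))
        = ∑ J : Fin k → Fin n, ∑ j, christoffel G (J a) i j y * T y J
          * (u i * (v a j * ∏ b ∈ Finset.univ.erase a, v b (J b))) := by
      intro i
      have := sum_update_swap a (fun J j l => christoffel G l i j y * T y (Function.update J a l)
          * (u i * ∏ b, v b (J b)))
      rw [this]
      refine Finset.sum_congr rfl fun J _ => Finset.sum_congr rfl fun j _ => ?_
      rw [Function.update_idem, Function.update_eq_self,
        ← Finset.mul_prod_erase Finset.univ _ (Finset.mem_univ a), Function.update_self]
      congr 3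
      refine Finset.prod_congr rfl fun b hb => ?_
      rw [Function.update_of_ne (Finset.ne_of_mem_erase hb)]
    simp only [h3]
    rw [Finset.sum_comm, evalT]
    refine Finset.sum_congr rfl fun J _ => ?_
    rw [← Finset.mul_prod_erase Finset.univ _ (Finset.mem_univ a), Function.update_self,
      christoffelVec_apply, Finset.sum_mul, Finset.mul_sum]
    refine Finset.sum_congr rfl fun i _ => ?_
    rw [Finset.sum_mul, Finset.mul_sum]
    refine Finset.sum_congr rfl fun j _ => ?_
    have : ∏ b ∈ Finset.univ.erase a, Function.update v a (christoffelVec G y u (v a)) b (J b)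
        = ∏ b ∈ Finset.univ.erase a, v b (J b) := by
      refine Finset.prod_congr rfl fun b hb => ?_
      rw [Function.update_of_ne (Finset.ne_of_mem_erase hb)]
    rw [this]; ring
  rw [h1]
  simp only [h2]
  have h3 : ∀ F : Fin k → Fin n → (Fin k → Fin n) → ℝ,
      ∑ a, ∑ i, ∑ J, F a i J = ∑ i, ∑ J, ∑ a, F a i J := fun F => by
    rw [Finset.sum_comm]
    exact Finset.sum_congr rfl fun i _ => Finset.sum_comm
  rw [h3, evalT, ← (Fin.consEquiv fun _ => Fin n).sum_comp, Fintype.sum_prod_type,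
    ← Finset.sum_sub_distrib]
  refine Finset.sum_congr rfl fun i _ => ?_
  rw [← Finset.sum_sub_distrib]
  refine Finset.sum_congr rfl fun J _ => ?_
  simp only [Fin.consEquiv, Equiv.coe_fn_mk, covDeriv, Fin.cons_zero, Fin.tail_cons,
    Fin.prod_univ_succ, Fin.cons_succ, sub_mul, Finset.sum_mul]

end Tensor

/-! ### Christoffel symbols and their first derivatives in a frame -/

section Connection

variable {n : ℕ} {G : E n → Matrix (Fin n) (Fin n) ℝ} {y : E n}

lemma sum_mul_single {X : E n → ℝ} (hX : IsLinearMap ℝ X) (u : E n) :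
    ∑ i, u i * X (stdFrame n i) = X u := by
  conv_rhs => rw [eq_sum_single u]
  refine ((map_sum hX.mk' (fun i => u i • stdFrame n i) Finset.univ).trans ?_).symm
  exact Finset.sum_congr rfl fun i _ => hX.map_smul _ _

/-- The components of the Christoffel symbols in a frame. -/
def frameChr (A : Fin n → Fin n → ℝ) (B : Fin n → Fin n → Fin n → ℝ) (s b c : Fin n) : ℝ :=
  ∑ t, A s t * lowerChr B t b c

/-- The components of the derivative of the Christoffel symbols in a frame. -/
def frameChrDeriv (A : Fin n → Fin n → ℝ) (B : Fin n → Fin n → Fin n → ℝ)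
    (D : Fin n → Fin n → Fin n → Fin n → ℝ) (a s b c : Fin n) : ℝ :=
  ∑ t, A s t * (dLowerChr D a t b c - ∑ q, ∑ r, A q r * (B a t q * lowerChr B r b c))

lemma isLinearMap_firstForm (B : E n →L[ℝ] E n →L[ℝ] E n →L[ℝ] ℝ) :
    (∀ i j, IsLinearMap ℝ fun q => firstForm B q i j) ∧
    (∀ q j, IsLinearMap ℝ fun i => firstForm B q i j) ∧
    (∀ q i, IsLinearMap ℝ fun j => firstForm B q i j) :=
  ⟨fun i j => ⟨fun u v => by simp [firstForm]; ring, fun c v => by simp [firstForm]; ring⟩,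
   fun i j => ⟨fun u v => by simp [firstForm]; ring, fun c v => by simp [firstForm]; ring⟩,
   fun i j => ⟨fun u v => by simp [firstForm]; ring, fun c v => by simp [firstForm]; ring⟩⟩

lemma isLinearMap_secondForm (D : E n →L[ℝ] E n →L[ℝ] E n →L[ℝ] E n →L[ℝ] ℝ) :
    (∀ q i j, IsLinearMap ℝ fun l => secondForm D l q i j) ∧
    (∀ l i j, IsLinearMap ℝ fun q => secondForm D l q i j) ∧
    (∀ l q j, IsLinearMap ℝ fun i => secondForm D l q i j) ∧
    (∀ l q i, IsLinearMap ℝ fun j => secondForm D l q i j) :=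
  ⟨fun q i j => ⟨fun u v => by simp [secondForm]; ring, fun c v => by simp [secondForm]; ring⟩,
   fun q i j => ⟨fun u v => by simp [secondForm]; ring, fun c v => by simp [secondForm]; ring⟩,
   fun q i j => ⟨fun u v => by simp [secondForm]; ring, fun c v => by simp [secondForm]; ring⟩,
   fun q i j => ⟨fun u v => by simp [secondForm]; ring, fun c v => by simp [secondForm]; ring⟩⟩

lemma isLinearMap_const_mul (c : ℝ) {f : E n → ℝ} (h : IsLinearMap ℝ f) :
    IsLinearMap ℝ fun v => c * f v :=
  ⟨fun u v => by rw [h.map_add]; ring, fun a v => by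
    rw [h.map_smul]; simp only [smul_eq_mul]; ring⟩

lemma isLinearMap_mul_const (c : ℝ) {f : E n → ℝ} (h : IsLinearMap ℝ f) :
    IsLinearMap ℝ fun v => f v * c :=
  ⟨fun u v => by rw [h.map_add]; ring, fun a v => by
    rw [h.map_smul]; simp only [smul_eq_mul]; ring⟩

lemma isLinearMap_sub {f g : E n → ℝ} (h : IsLinearMap ℝ f) (h' : IsLinearMap ℝ g) :
    IsLinearMap ℝ fun v => f v - g v :=
  ⟨fun u v => by rw [h.map_add, h'.map_add]; ring, fun a v => by
    rw [h.map_smul, h'.map_smul]; simp only [smul_eq_mul]; ring⟩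

/-- Raising an index in a frame. -/
lemma sum_inv_frame {A : Matrix (Fin n) (Fin n) ℝ} {e : Fin n → E n} {A' : Fin n → Fin n → ℝ}
    (hA : ∀ i j, A i j = ∑ a, ∑ b, e a i * A' a b * e b j) {X : E n → ℝ} (hX : IsLinearMap ℝ X)
    (l : Fin n) : ∑ p, A l p * X (stdFrame n p) = ∑ s, (∑ t, A' s t * X (e t)) * e s l := by
  simp only [hA, Finset.sum_mul]
  rw [Finset.sum_comm]
  refine Finset.sum_congr rfl fun s _ => ?_
  rw [Finset.sum_comm]
  refine Finset.sum_congr rfl fun t _ => ?_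
  rw [← sum_mul_single hX (e t), Finset.mul_sum, Finset.sum_mul]
  exact Finset.sum_congr rfl fun p _ => by ring

lemma christoffel_eq (hG : ∀ i j, ContDiffAt ℝ 2 (fun z => G z i j) y) (l i j : Fin n) :
    christoffel G l i j y = ∑ p, (G y)⁻¹ l p *
      firstForm (fderiv ℝ (fun z => bilOf (G z)) y) (stdFrame n p) (stdFrame n i) (stdFrame n j) :=
  (christoffel_eventuallyEq hG l i j).eq_of_nhds

lemma christoffelVec_frame (hG : ∀ i j, ContDiffAt ℝ 2 (fun z => G z i j) y) {e : Fin n → E n}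
    {A' : Fin n → Fin n → ℝ} (hA : ∀ i j, (G y)⁻¹ i j = ∑ a, ∑ b, e a i * A' a b * e b j)
    (b c : Fin n) :
    christoffelVec G y (e b) (e c)
      = ∑ s, frameChr A' (jetOne (fun z => bilOf (G z)) y e) s b c • e s := by
  obtain ⟨L1, L2, L3⟩ := isLinearMap_firstForm (fderiv ℝ (fun z => bilOf (G z)) y)
  ext l
  rw [christoffelVec_apply]
  simp only [christoffel_eq hG, sum_inv_frame hA (L1 _ _)]
  have h : ∀ t, ∑ i, ∑ j, firstForm (fderiv ℝ (fun z => bilOf (G z)) y) (e t) (stdFrame n i)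
      (stdFrame n j) * (e b i * e c j)
      = lowerChr (jetOne (fun z => bilOf (G z)) y e) t b c := by
    intro t
    change _ = firstForm (fderiv ℝ (fun z => bilOf (G z)) y) (e t) (e b) (e c)
    rw [← sum_mul_single (L2 _ _) (e b)]
    refine Finset.sum_congr rfl fun i _ => ?_
    rw [← sum_mul_single (L3 _ _) (e c), Finset.mul_sum]
    exact Finset.sum_congr rfl fun j _ => by ring
  simp only [Finset.sum_mul]
  have h2 : ∀ f : Fin n → Fin n → Fin n → Fin n → ℝ, ∑ i, ∑ j, ∑ s, ∑ t, f i j s t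
      = ∑ s, ∑ t, ∑ i, ∑ j, f i j s t := by
    intro f
    calc _ = ∑ i, ∑ s, ∑ j, ∑ t, f i j s t := Finset.sum_congr rfl fun i _ => Finset.sum_comm
      _ = ∑ s, ∑ i, ∑ j, ∑ t, f i j s t := Finset.sum_comm
      _ = ∑ s, ∑ i, ∑ t, ∑ j, f i j s t := Finset.sum_congr rfl fun a _ =>
          Finset.sum_congr rfl fun i _ => Finset.sum_comm
      _ = _ := Finset.sum_congr rfl fun a _ => Finset.sum_comm
  rw [h2]
  simp only [frameChr, WithLp.ofLp_sum, Finset.sum_apply, PiLp.smul_apply, smul_eq_mul,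
    Finset.sum_mul]
  refine Finset.sum_congr rfl fun s _ => Finset.sum_congr rfl fun t _ => ?_
  rw [← h t, Finset.mul_sum, Finset.sum_mul]
  refine Finset.sum_congr rfl fun i _ => ?_
  rw [Finset.mul_sum, Finset.sum_mul]
  exact Finset.sum_congr rfl fun j _ => by ring

lemma differentiableAt_christoffel (hG : ∀ i j, ContDiffAt ℝ 2 (fun z => G z i j) y)
    (hdet : (G y).det ≠ 0) (l i j : Fin n) : DifferentiableAt ℝ (christoffel G l i j) y := by
  refine (christoffel_eventuallyEq hG l i j).differentiableAt_iff.2 ?_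
  refine DifferentiableAt.fun_sum fun m _ => ?_
  exact ((contDiffAt_inv_entry hG hdet l m).differentiableAt (by norm_num)).fun_mul
    (differentiableAt_lowerChr hG m i j)

lemma differentiableAt_christoffelVec (hG : ∀ i j, ContDiffAt ℝ 2 (fun z => G z i j) y)
    (hdet : (G y).det ≠ 0) (u w : E n) :
    DifferentiableAt ℝ (fun z => christoffelVec G z u w) y := by
  rw [differentiableAt_euclidean]
  intro l
  simp only [christoffelVec_apply]
  exact DifferentiableAt.fun_sum fun i _ => DifferentiableAt.fun_sum fun j _ =>
    (differentiableAt_christoffel hG hdet l i j).mul_const _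

/-- This is `pd_christoffel` with each index carried over to the frame: the raised index by
`sum_inv_frame`, the inner contraction by `sum_contract`, and the lower slots by linearity. The
quadratic term in `frameChrDeriv` comes from the derivative of the inverse metric. -/
lemma fderiv_christoffelVec_frame (hG : ∀ i j, ContDiffAt ℝ 2 (fun z => G z i j) y)
    (hdet : (G y).det ≠ 0) {e : Fin n → E n}
    {A' : Fin n → Fin n → ℝ} (hA : ∀ i j, (G y)⁻¹ i j = ∑ a, ∑ b, e a i * A' a b * e b j)
    (a b c : Fin n) :
    fderiv ℝ (fun z => christoffelVec G z (e b) (e c)) y (e a)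
      = ∑ s, frameChrDeriv A' (jetOne (fun z => bilOf (G z)) y e)
          (jetTwo (fun z => bilOf (G z)) y e) a s b c • e s := by
  set B := fderiv ℝ (fun z => bilOf (G z)) y with hB
  set D := fderiv ℝ (fderiv ℝ (fun z => bilOf (G z))) y with hD
  obtain ⟨L1, L2, L3⟩ := isLinearMap_firstForm B
  obtain ⟨M1, M2, M3, M4⟩ := isLinearMap_secondForm D
  have hΓ := differentiableAt_christoffelVec hG hdet (e b) (e c)
  have hdc := differentiableAt_christoffel hG hdet
  have hpc : ∀ k l i j, pd k (christoffel G l i j) y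
      = ∑ s, (∑ t, A' s t * (secondForm D (stdFrame n k) (e t) (stdFrame n i) (stdFrame n j)
        - ∑ q, ∑ r, A' q r * (B (stdFrame n k) (e t) (e q) *
          firstForm B (e r) (stdFrame n i) (stdFrame n j)))) * e s l := by
    intro k l i j
    rw [pd_christoffel hG hdet, ← Finset.sum_sub_distrib]
    have h0 : ∀ p, ∑ q, ∑ r, (G y)⁻¹ l p * ((G y)⁻¹ q r *
          (jetOne (fun z => bilOf (G z)) y (stdFrame n) k p q *
            lowerChr (jetOne (fun z => bilOf (G z)) y (stdFrame n)) r i j))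
        = (G y)⁻¹ l p * ∑ q, ∑ r, A' q r * (B (stdFrame n k) (stdFrame n p) (e q) *
          firstForm B (e r) (stdFrame n i) (stdFrame n j)) := by
      intro p
      simp only [← Finset.mul_sum]
      congr 1
      exact sum_contract (e := stdFrame n) (e' := e) (P := fun i a => e a i)
        (fun a => eq_sum_single (e a)) hA (fun u v => B (stdFrame n k) (stdFrame n p) u *
          firstForm B v (stdFrame n i) (stdFrame n j))
        (fun v => isLinearMap_mul_const _ ⟨map_add _, map_smul _⟩)
        (fun u => isLinearMap_const_mul _ (L1 _ _))
    simp only [h0, ← mul_sub]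
    refine sum_inv_frame hA (X := fun u => secondForm D (stdFrame n k) u (stdFrame n i)
      (stdFrame n j) - ∑ q, ∑ r, A' q r * (B (stdFrame n k) u (e q) *
          firstForm B (e r) (stdFrame n i) (stdFrame n j))) (isLinearMap_sub (M2 _ _ _) ?_) l
    exact isLinearMap_sum _ fun q => isLinearMap_sum _ fun r => isLinearMap_const_mul _
      (isLinearMap_mul_const _ ⟨fun u v => by simp, fun c u => by simp⟩)
  -- The three sums over the standard basis reassemble the vectors `e c`, `e b`, `e a`, in this
  -- order.
  have hX : ∀ t, ∑ k, e a k * ∑ i, e b i * ∑ j, e c j *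
      (secondForm D (stdFrame n k) (e t) (stdFrame n i) (stdFrame n j)
        - ∑ q, ∑ r, A' q r * (B (stdFrame n k) (e t) (e q) *
          firstForm B (e r) (stdFrame n i) (stdFrame n j)))
      = secondForm D (e a) (e t) (e b) (e c)
        - ∑ q, ∑ r, A' q r * (B (e a) (e t) (e q) * firstForm B (e r) (e b) (e c)) := by
    intro t
    have s3 : ∀ k i, ∑ j, e c j *
      (secondForm D (stdFrame n k) (e t) (stdFrame n i) (stdFrame n j)
        - ∑ q, ∑ r, A' q r * (B (stdFrame n k) (e t) (e q) *
          firstForm B (e r) (stdFrame n i) (stdFrame n j))) = _ := fun k i =>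
      sum_mul_single (X := fun w => secondForm D (stdFrame n k) (e t) (stdFrame n i) w
        - ∑ q, ∑ r, A' q r * (B (stdFrame n k) (e t) (e q) *
          firstForm B (e r) (stdFrame n i) w)) (isLinearMap_sub (M4 _ _ _)
        (isLinearMap_sum _ fun q => isLinearMap_sum _ fun r => isLinearMap_const_mul _
          (isLinearMap_const_mul _ (L3 _ _)))) (e c)
    have s2 : ∀ k, ∑ i, e b i *
      (secondForm D (stdFrame n k) (e t) (stdFrame n i) (e c)
        - ∑ q, ∑ r, A' q r * (B (stdFrame n k) (e t) (e q) *
          firstForm B (e r) (stdFrame n i) (e c))) = _ := fun k =>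
      sum_mul_single (X := fun w => secondForm D (stdFrame n k) (e t) w (e c)
        - ∑ q, ∑ r, A' q r * (B (stdFrame n k) (e t) (e q) *
          firstForm B (e r) w (e c))) (isLinearMap_sub (M3 _ _ _)
        (isLinearMap_sum _ fun q => isLinearMap_sum _ fun r => isLinearMap_const_mul _
          (isLinearMap_const_mul _ (L2 _ _)))) (e b)
    have s1 : ∑ k, e a k *
      (secondForm D (stdFrame n k) (e t) (e b) (e c)
        - ∑ q, ∑ r, A' q r * (B (stdFrame n k) (e t) (e q) *
          firstForm B (e r) (e b) (e c))) = _ :=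
      sum_mul_single (X := fun w => secondForm D w (e t) (e b) (e c)
        - ∑ q, ∑ r, A' q r * (B w (e t) (e q) *
          firstForm B (e r) (e b) (e c))) (isLinearMap_sub (M1 _ _ _)
        (isLinearMap_sum _ fun q => isLinearMap_sum _ fun r => isLinearMap_const_mul _
          (isLinearMap_mul_const _ ⟨fun u v => by simp, fun c u => by simp⟩))) (e a)
    simp only [s3, s2, s1]
  ext l
  have h1 : fderiv ℝ (fun z => christoffelVec G z (e b) (e c)) y (e a) l
      = fderiv ℝ (fun z => christoffelVec G z (e b) (e c) l) y (e a) := by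
    have := ((EuclideanSpace.proj (𝕜 := ℝ) l : E n →L[ℝ] ℝ).hasFDerivAt.comp y
      hΓ.hasFDerivAt).fderiv
    have h' : fderiv ℝ (fun z => christoffelVec G z (e b) (e c) l) y = _ := this
    rw [h']; rfl
  rw [h1, fderiv_eq_sum_pd]
  simp only [christoffelVec_apply]
  have h2 : ∀ k, pd k (fun z => ∑ i, ∑ j, christoffel G l i j z * (e b i * e c j)) y
      = ∑ i, ∑ j, pd k (christoffel G l i j) y * (e b i * e c j) := by
    intro k
    rw [pd_sum fun i _ => DifferentiableAt.fun_sum fun j _ => (hdc l i j).mul_const _]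
    refine Finset.sum_congr rfl fun i _ => ?_
    rw [pd_sum fun j _ => (hdc l i j).mul_const _]
    refine Finset.sum_congr rfl fun j _ => ?_
    rw [pd, fderiv_mul_const (hdc l i j), smul_apply, smul_eq_mul, pd, mul_comm]
  simp only [h2, hpc]
  simp only [frameChrDeriv, WithLp.ofLp_sum, Finset.sum_apply, PiLp.smul_apply, smul_eq_mul]
  have h3 : ∀ (g : Fin n → Fin n → Fin n → Fin n → Fin n → ℝ),
      ∑ k, e a k * ∑ i, ∑ j, (∑ s, (∑ t, A' s t * g t k i j l) * e s l) * (e b i * e c j)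
      = ∑ s, (∑ t, A' s t * ∑ k, e a k * ∑ i, e b i * ∑ j, e c j * g t k i j l) * e s l := by
    intro g
    simp only [Finset.sum_mul, Finset.mul_sum]
    have h2 : ∀ f : Fin n → Fin n → Fin n → Fin n → Fin n → ℝ, ∑ k, ∑ i, ∑ j, ∑ s, ∑ t, f k i j s t
        = ∑ s, ∑ t, ∑ k, ∑ i, ∑ j, f k i j s t := by
      intro f
      calc _ = ∑ k, ∑ i, ∑ s, ∑ j, ∑ t, f k i j s t := Finset.sum_congr rfl fun k _ =>
            Finset.sum_congr rfl fun i _ => Finset.sum_comm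
        _ = ∑ k, ∑ i, ∑ s, ∑ t, ∑ j, f k i j s t := Finset.sum_congr rfl fun k _ =>
            Finset.sum_congr rfl fun i _ => Finset.sum_congr rfl fun s _ => Finset.sum_comm
        _ = ∑ k, ∑ s, ∑ i, ∑ t, ∑ j, f k i j s t := Finset.sum_congr rfl fun k _ =>
            Finset.sum_comm
        _ = ∑ k, ∑ s, ∑ t, ∑ i, ∑ j, f k i j s t := Finset.sum_congr rfl fun k _ =>
            Finset.sum_congr rfl fun s _ => Finset.sum_comm
        _ = ∑ s, ∑ k, ∑ t, ∑ i, ∑ j, f k i j s t := Finset.sum_comm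
        _ = _ := Finset.sum_congr rfl fun a _ => Finset.sum_comm
    rw [h2]
    refine Finset.sum_congr rfl fun s _ => Finset.sum_congr rfl fun t _ =>
      Finset.sum_congr rfl fun k _ => Finset.sum_congr rfl fun i _ =>
      Finset.sum_congr rfl fun j _ => by ring
  rw [h3 (fun t k i j _ => secondForm D (stdFrame n k) (e t) (stdFrame n i) (stdFrame n j)
        - ∑ q, ∑ r, A' q r * (B (stdFrame n k) (e t) (e q) *
          firstForm B (e r) (stdFrame n i) (stdFrame n j)))]
  simp only [hX]
  rfl

end Connection

/-! ### Decay in the hyperbolic norms controls the two-jet in adapted frames -/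

section Decay

variable {m : ℕ}

/-- The inverse of the hyperbolic metric in an adapted frame. -/
def hypInv (q : ℝ) (a b : Fin (m + 1)) : ℝ :=
  rad a * rad b + ((1 - q / 4) ^ 2)⁻¹ * tang a b

lemma hypJet_mul_hypInv {q : ℝ} (hq : 1 - q / 4 ≠ 0) :
    Matrix.of (hypJet m q).1 * Matrix.of (hypInv (m := m) q) = 1 := by
  have h : 1 - q / 2 + q ^ 2 / 16 = (1 - q / 4) ^ 2 := by ring
  ext i j
  rw [Matrix.mul_apply]
  refine Fin.cases ?_ (fun i => ?_) i <;> refine Fin.cases ?_ (fun j => ?_) j <;>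
    simp [Fin.sum_univ_succ, hypJet, hypInv, Matrix.one_apply, (Fin.succ_ne_zero _).symm]
  rw [h]
  split_ifs with h'
  · exact mul_inv_cancel₀ (pow_ne_zero 2 hq)
  · rfl

lemma hypInv_eq {q : ℝ} (hq : 1 - q / 4 ≠ 0) :
    (Matrix.of (hypJet m q).1)⁻¹ = Matrix.of (hypInv (m := m) q) :=
  Matrix.inv_eq_right_inv (hypJet_mul_hypInv hq)

lemma det_hypJet_ne {q : ℝ} (hq : 1 - q / 4 ≠ 0) : (Matrix.of (hypJet m q).1).det ≠ 0 :=
  (Matrix.isUnit_det_of_right_inverse (hypJet_mul_hypInv hq)).ne_zero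

/-- The frame components are continuous in `q` on `[0, 1]`, including the value `q = 0` at infinity,
so compactness gives a bound that is uniform on the whole end. -/
lemma exists_bound_hypChr (m : ℕ) : ∃ K : ℝ, 0 < K ∧ ∀ q ∈ Set.Icc (0 : ℝ) 1,
    (∀ s b c : Fin (m + 1), |frameChr (hypInv q) (hypB q) s b c| ≤ K) ∧
    (∀ a s b c : Fin (m + 1), |frameChrDeriv (hypInv q) (hypB q) (hypD q) a s b c| ≤ K) := by
  have hI : ∀ a b : Fin (m + 1), ContinuousOn (fun q => hypInv q a b) (Set.Icc (0 : ℝ) 1) := by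
    intro a b
    unfold hypInv
    refine continuousOn_const.add (ContinuousOn.mul (ContinuousOn.inv₀ (by fun_prop) ?_)
      continuousOn_const)
    intro q hq
    have : (1 - q / 4) ≠ 0 := by linarith [hq.2]
    positivity
  have hB : ∀ a b c : Fin (m + 1), ContinuousOn (fun q => hypB q a b c) (Set.Icc (0 : ℝ) 1) := by
    intro a b c
    unfold hypB
    fun_prop
  have hD : ∀ a b c d : Fin (m + 1),
      ContinuousOn (fun q => hypD q a b c d) (Set.Icc (0 : ℝ) 1) := by
    intro a b c d
    unfold hypD
    fun_prop
  have hL : ∀ a b c : Fin (m + 1),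
      ContinuousOn (fun q => lowerChr (hypB q) a b c) (Set.Icc (0 : ℝ) 1) := by
    intro a b c
    unfold lowerChr
    exact continuousOn_const.mul (((hB _ _ _).add (hB _ _ _)).sub (hB _ _ _))
  have hM : ∀ a b c d : Fin (m + 1),
      ContinuousOn (fun q => dLowerChr (hypD q) a b c d) (Set.Icc (0 : ℝ) 1) := by
    intro a b c d
    unfold dLowerChr
    exact continuousOn_const.mul (((hD _ _ _ _).add (hD _ _ _ _)).sub (hD _ _ _ _))
  have h1 : ∀ p : Fin (m + 1) × Fin (m + 1) × Fin (m + 1), ∃ K, ∀ q ∈ Set.Icc (0 : ℝ) 1,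
      |frameChr (hypInv q) (hypB q) p.1 p.2.1 p.2.2| ≤ K := fun p =>
    isCompact_Icc.exists_bound_of_continuousOn
      (continuousOn_finsetSum _ fun t _ => (hI _ _).mul (hL _ _ _))
  have h2 : ∀ p : Fin (m + 1) × Fin (m + 1) × Fin (m + 1) × Fin (m + 1), ∃ K,
      ∀ q ∈ Set.Icc (0 : ℝ) 1,
      |frameChrDeriv (hypInv q) (hypB q) (hypD q) p.1 p.2.1 p.2.2.1 p.2.2.2| ≤ K := fun p =>
    isCompact_Icc.exists_bound_of_continuousOn
      (continuousOn_finsetSum _ fun t _ => (hI _ _).mul ((hM _ _ _ _).sub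
        (continuousOn_finsetSum _ fun q _ => continuousOn_finsetSum _ fun r _ =>
          (hI _ _).mul ((hB _ _ _).mul (hL _ _ _)))))
  choose K1 hK1 using h1
  choose K2 hK2 using h2
  refine ⟨∑ p, |K1 p| + ∑ p, |K2 p| + 1, by positivity, fun q hq => ⟨fun s b c => ?_,
    fun a s b c => ?_⟩⟩
  · have e1 := (hK1 (s, b, c) q hq).trans (le_abs_self _)
    have e2 := Finset.single_le_sum (f := fun p => |K1 p|) (fun p _ => abs_nonneg _)
      (Finset.mem_univ (s, b, c))
    have e3 : 0 ≤ ∑ p, |K2 p| := by positivity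
    simp only at e1 e2
    linarith
  · have e1 := (hK2 (a, s, b, c) q hq).trans (le_abs_self _)
    have e2 := Finset.single_le_sum (f := fun p => |K2 p|) (fun p _ => abs_nonneg _)
      (Finset.mem_univ (a, s, b, c))
    have e3 : 0 ≤ ∑ p, |K1 p| := by positivity
    simp only at e1 e2
    linarith

lemma evalT_smul {n k : ℕ} (t : (Fin k → Fin n) → ℝ) (r : Fin k → ℝ) (v : Fin k → E n) :
    evalT t (fun a => r a • v a) = (∏ a, r a) * evalT t v := by
  simp only [evalT, PiLp.smul_apply, smul_eq_mul, Finset.prod_mul_distrib, Finset.mul_sum]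
  exact Finset.sum_congr rfl fun I _ => by ring

lemma evalT_update_sum {n k : ℕ} (t : (Fin k → Fin n) → ℝ) (v : Fin k → E n) (a : Fin k)
    {ι : Type*} [Fintype ι] (c : ι → ℝ) (w : ι → E n) :
    evalT t (Function.update v a (∑ s, c s • w s))
      = ∑ s, c s * evalT t (Function.update v a (w s)) := by
  simp only [evalT, Finset.mul_sum]
  rw [Finset.sum_comm]
  refine Finset.sum_congr rfl fun I _ => ?_
  simp only [← Finset.mul_prod_erase Finset.univ _ (Finset.mem_univ a), Function.update_self,
    WithLp.ofLp_sum, Finset.sum_apply, PiLp.smul_apply, smul_eq_mul, Finset.sum_mul,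
    Finset.mul_sum]
  refine Finset.sum_congr rfl fun s _ => ?_
  have : ∀ u, ∏ b ∈ Finset.univ.erase a, Function.update v a u b (I b)
      = ∏ b ∈ Finset.univ.erase a, v b (I b) := fun u =>
    Finset.prod_congr rfl fun b hb => by rw [Function.update_of_ne (Finset.ne_of_mem_erase hb)]
  rw [this, this]; ring

/-- The adapted frame is orthogonal for the hyperbolic metric, with lengths `σ b` equal to `1` or `1
- ‖y‖²/4`. Since these are at most `1`, values on the frame are dominated by those on the normalised
frame. -/
lemma evalT_le_tensorNorm_hyperbolic {k : ℕ} {y : E (m + 1)} (hy : y ≠ 0) (hy1 : ‖y‖ < 1)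
    {e : Fin (m + 1) → E (m + 1)} (he : IsAdapted y e) (t : (Fin k → Fin (m + 1)) → ℝ)
    (c : Fin k → Fin (m + 1)) :
    |evalT t (fun a => e (c a))| ≤ tensorNorm (hyperbolicMetric y) t := by
  have hq : ‖y‖ ^ 2 < 1 := by nlinarith [norm_nonneg y]
  have hq0 : 0 ≤ ‖y‖ ^ 2 := by positivity
  have hs : 0 < 1 - ‖y‖ ^ 2 / 4 := by linarith
  have hinv := (inv_eq_frame (G := hyperbolicMetric) (y := y) e (by
    rw [frameJet_hyperbolicMetric hy he]; exact det_hypJet_ne hs.ne')).2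
  rw [frameJet_hyperbolicMetric hy he, hypInv_eq hs.ne'] at hinv
  set σ : Fin (m + 1) → ℝ := fun b => if b = 0 then 1 else 1 - ‖y‖ ^ 2 / 4 with hσ
  have hσ0 : ∀ b, 0 < σ b := fun b => by simp only [hσ]; split_ifs <;> linarith
  have hσ1 : ∀ b, σ b ≤ 1 := fun b => by simp only [hσ]; split_ifs <;> linarith
  have hf : ∀ i j, (hyperbolicMetric y)⁻¹ i j
      = ∑ b, ((σ b)⁻¹ • e b) i * ((σ b)⁻¹ • e b) j := by
    intro i j
    rw [hinv]
    refine Finset.sum_congr rfl fun a _ => ?_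
    have : ∀ b, hypInv (‖y‖ ^ 2) a b = if a = b then (σ a)⁻¹ * (σ a)⁻¹ else 0 := by
      intro b
      refine Fin.cases ?_ (fun a => ?_) a <;> refine Fin.cases ?_ (fun b => ?_) b <;>
        simp [hypInv, hσ, (Fin.succ_ne_zero _).symm, sq]
    simp only [Matrix.of_apply, this, PiLp.smul_apply, smul_eq_mul]
    rw [Finset.sum_eq_single a]
    · simp; ring
    · intro b _ hb; simp [hb.symm]
    · simp
  have h1 := abs_evalT_le_tensorNorm hf t c
  have h2 : evalT t (fun a => e (c a))
      = (∏ a, σ (c a)) * evalT t (fun a => (σ (c a))⁻¹ • e (c a)) := by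
    rw [← evalT_smul]
    congr 1
    ext1 a
    rw [smul_smul, mul_inv_cancel₀ (hσ0 _).ne', one_smul]
  rw [h2, abs_mul]
  have h3 : |∏ a, σ (c a)| ≤ 1 := by
    rw [abs_of_nonneg (Finset.prod_nonneg fun a _ => (hσ0 _).le)]
    exact Finset.prod_le_one (fun a _ => (hσ0 _).le) fun a _ => hσ1 _
  calc _ ≤ 1 * |evalT t (fun a => (σ (c a))⁻¹ • e (c a))| := by gcongr
    _ ≤ _ := by rw [one_mul]; exact h1

lemma abs_sum_mul_le {ι : Type*} [Fintype ι] {c x : ι → ℝ} {K N : ℝ}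
    (hK : 0 ≤ K) (hc : ∀ i, |c i| ≤ K) (hx : ∀ i, |x i| ≤ N) :
    |∑ i, c i * x i| ≤ Fintype.card ι * (K * N) := by
  refine (Finset.abs_sum_le_sum_abs _ _).trans ?_
  refine (Finset.sum_le_sum fun i _ => (?_ : |c i * x i| ≤ K * N)).trans (by simp)
  rw [abs_mul]
  exact mul_le_mul (hc i) (hx i) (abs_nonneg _) hK

set_option maxHeartbeats 1600000 in
-- Ordinary derivatives of `λ` are covariant derivatives plus Christoffel corrections. In an adapted
-- frame the Christoffel symbols of the hyperbolic metric and their derivatives are bounded, so the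
-- invariant `C²` norm controls the coordinate two-jet, without loss of powers of `x`.
lemma frameJet_deviation_le (m : ℕ) : ∃ K : ℝ, 0 < K ∧
    ∀ (G : E (m + 1) → Matrix (Fin (m + 1)) (Fin (m + 1)) ℝ) (y : E (m + 1))
      (e : Fin (m + 1) → E (m + 1)) (N : ℝ), y ≠ 0 → ‖y‖ < 1 → IsAdapted y e →
      (∀ i j, ContDiffAt ℝ 2 (fun z => G z i j) y) →
      normC2 hyperbolicMetric (deviation G) y ≤ N →
      ‖frameJet (fun z => bilOf (G z - hyperbolicMetric z)) y e‖ ≤ K * N := by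
  obtain ⟨K, hK, hKb⟩ := exists_bound_hypChr m
  set M : ℝ := (m + 1 : ℝ) with hM
  have hM0 : 0 < M := by positivity
  -- The sum of the bounds `h1` and `h2` for first and second derivatives. Each contraction with a
  -- Christoffel symbol costs a factor `M * K`, where `M` is the dimension.
  refine ⟨1 + 2 * (M * K) + (1 + 3 * (M * K) + 2 * (M * (K * (1 + 2 * (M * K))))
    + 2 * (M * K)), by positivity, ?_⟩
  intro G y e N hy hy1 he hG hN
  have hq : ‖y‖ ^ 2 < 1 := by nlinarith [norm_nonneg y]
  have hq0 : 0 ≤ ‖y‖ ^ 2 := by positivity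
  have hs : 1 - ‖y‖ ^ 2 / 4 ≠ 0 := by linarith
  obtain ⟨hΓ, hdΓ⟩ := hKb (‖y‖ ^ 2) ⟨hq0, hq.le⟩
  set Λ : E (m + 1) → Matrix (Fin (m + 1)) (Fin (m + 1)) ℝ := fun z => G z - hyperbolicMetric z
    with hΛdef
  have hH := fun i j => contDiffAt_hyperbolicMetric hy (m := 2) i j
  have hΛ : ∀ i j, ContDiffAt ℝ 2 (fun z => Λ z i j) y := fun i j => (hG i j).sub (hH i j)
  have hjet := frameJet_hyperbolicMetric hy he
  have hj1 : jetOne (fun z => bilOf (hyperbolicMetric z)) y e = hypB (‖y‖ ^ 2) :=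
    congrArg (fun J => J.2.1) hjet
  have hj2 : jetTwo (fun z => bilOf (hyperbolicMetric z)) y e = hypD (‖y‖ ^ 2) :=
    congrArg (fun J => J.2.2) hjet
  obtain ⟨hdet, hinv⟩ := inv_eq_frame (G := hyperbolicMetric) (y := y) e (by
    rw [hjet]; exact det_hypJet_ne hs)
  rw [hjet, hypInv_eq hs] at hinv
  simp only [Matrix.of_apply] at hinv
  have hchr : ∀ b c, christoffelVec hyperbolicMetric y (e b) (e c) = _ :=
    fun b c => christoffelVec_frame hH hinv b c
  have hdchr : ∀ a b c, fderiv ℝ (fun z => christoffelVec hyperbolicMetric z (e b) (e c)) y (e a)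
      = _ := fun a b c => fderiv_christoffelVec_frame hH hdet hinv a b c
  rw [hj1] at hchr
  rw [hj1, hj2] at hdchr
  have hn0 : ∀ {k : ℕ} (t : (Fin k → Fin (m + 1)) → ℝ), 0 ≤ tensorNorm (hyperbolicMetric y) t :=
    fun t => Real.sqrt_nonneg _
  have hdev : deviation G = fun z => toTensor (Λ z) := rfl
  have hT0 : ∀ c : Fin 2 → Fin (m + 1), |evalT (deviation G y) (fun a => e (c a))| ≤ N := by
    intro c
    refine (evalT_le_tensorNorm_hyperbolic hy hy1 he _ c).trans (le_trans ?_ hN)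
    rw [normC2]
    linarith [hn0 (covDeriv hyperbolicMetric (deviation G) y),
      hn0 (covDeriv hyperbolicMetric (covDeriv hyperbolicMetric (deviation G)) y)]
  have hT1 : ∀ c : Fin 3 → Fin (m + 1),
      |evalT (covDeriv hyperbolicMetric (deviation G) y) (fun a => e (c a))| ≤ N := by
    intro c
    refine (evalT_le_tensorNorm_hyperbolic hy hy1 he _ c).trans (le_trans ?_ hN)
    rw [normC2]
    linarith [hn0 (deviation G y),
      hn0 (covDeriv hyperbolicMetric (covDeriv hyperbolicMetric (deviation G)) y)]
  have hT2 : ∀ c : Fin 4 → Fin (m + 1),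
      |evalT (covDeriv hyperbolicMetric (covDeriv hyperbolicMetric (deviation G)) y)
        (fun a => e (c a))| ≤ N := by
    intro c
    refine (evalT_le_tensorNorm_hyperbolic hy hy1 he _ c).trans (le_trans ?_ hN)
    rw [normC2]
    linarith [hn0 (deviation G y), hn0 (covDeriv hyperbolicMetric (deviation G) y)]
  have hN0 : 0 ≤ N := (abs_nonneg _).trans (hT0 fun _ => 0)
  have hdL : ∀ᶠ z in 𝓝 y, ∀ I, DifferentiableAt ℝ (fun z => deviation G z I) z := by
    filter_upwards [eventually_contDiffAt hΛ] with z hz I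
    exact (hz (I 0) (I 1)).differentiableAt (by norm_num)
  have h0 : ∀ c d, |bilOf (Λ y) (e c) (e d)| ≤ N := by
    intro c d
    have := hT0 ![c, d]
    rwa [hdev, evalT_toTensor] at this
  -- the first covariant derivative near `y`
  have hcov : ∀ (u v w : E (m + 1)), ∀ᶠ z in 𝓝 y,
      evalT (covDeriv hyperbolicMetric (deviation G) z) ![u, v, w]
      = fderiv ℝ (fun z => bilOf (Λ z)) z u v w
        - bilOf (Λ z) (christoffelVec hyperbolicMetric z u v) w
        - bilOf (Λ z) v (christoffelVec hyperbolicMetric z u w) := by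
    intro u v w
    filter_upwards [hdL, eventually_contDiffAt hΛ] with z hz hz'
    have h := evalT_covDeriv hyperbolicMetric (deviation G) hz u ![v, w]
    simp only [hdev, evalT_toTensor, Fin.sum_univ_two] at h
    rw [← fderiv_eval₂ ((contDiffAt_bilOf hz').differentiableAt (by norm_num))]
    simp only [hdev]
    have hc : (Fin.cons u ![v, w] : Fin 3 → E (m + 1)) = ![u, v, w] := rfl
    rw [hc] at h
    rw [h]
    simp [sub_sub]
  have h1 : ∀ a c d, |fderiv ℝ (fun z => bilOf (Λ z)) y (e a) (e c) (e d)|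
      ≤ (1 + 2 * (M * K)) * N := by
    intro a c d
    have h := (hcov (e a) (e c) (e d)).self_of_nhds
    have hb := hT1 ![a, c, d]
    have hv : (fun i => e (![a, c, d] i)) = ![e a, e c, e d] := by
      ext1 i; fin_cases i <;> rfl
    rw [hv, h] at hb
    have e1 : |bilOf (Λ y) (christoffelVec hyperbolicMetric y (e a) (e c)) (e d)| ≤ M * (K * N) := by
      rw [hchr]
      simp only [map_sum, map_smul, sum_apply, smul_apply, smul_eq_mul]
      have := abs_sum_mul_le hK.le (fun s => hΓ s a c) (fun s => h0 s d)
      simpa [hM] using this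
    have e2 : |bilOf (Λ y) (e c) (christoffelVec hyperbolicMetric y (e a) (e d))| ≤ M * (K * N) := by
      rw [hchr]
      simp only [map_sum, map_smul, smul_eq_mul]
      have := abs_sum_mul_le hK.le (fun s => hΓ s a d) (fun s => h0 c s)
      simpa [hM] using this
    obtain ⟨b1, b2⟩ := abs_le.1 hb
    obtain ⟨b3, b4⟩ := abs_le.1 e1
    obtain ⟨b5, b6⟩ := abs_le.1 e2
    exact abs_le.2 ⟨by linarith, by linarith⟩
  have h2 : ∀ a b c d, |fderiv ℝ (fderiv ℝ (fun z => bilOf (Λ z))) y (e a) (e b) (e c) (e d)|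
      ≤ (1 + 3 * (M * K) + 2 * (M * (K * (1 + 2 * (M * K)))) + 2 * (M * K)) * N := by
    intro a b c d
    have hcd : ∀ I, DifferentiableAt ℝ
        (fun z => covDeriv hyperbolicMetric (deviation G) z I) y := by
      intro I
      unfold covDeriv
      have hpd : DifferentiableAt ℝ (fun z => pd (I 0) (fun z => deviation G z (Fin.tail I)) z) y :=
        differentiableAt_fderiv_apply (hΛ (Fin.tail I 0) (Fin.tail I 1)) _
      refine hpd.fun_sub (DifferentiableAt.fun_sum fun a _ => DifferentiableAt.fun_sum fun l _ => ?_)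
      exact (differentiableAt_christoffel hH hdet _ _ _).fun_mul
        ((hΛ _ _).differentiableAt (by norm_num))
    have h := evalT_covDeriv hyperbolicMetric (covDeriv hyperbolicMetric (deviation G)) hcd
      (e a) ![e b, e c, e d]
    have hb := hT2 ![a, b, c, d]
    have hv : (fun i => e (![a, b, c, d] i)) = Fin.cons (e a) ![e b, e c, e d] := by
      ext1 i; fin_cases i <;> rfl
    rw [hv, h] at hb
    have hF := (contDiffAt_bilOf hΛ).differentiableAt (by norm_num)
    have hF2 := differentiableAt_fderiv_bilOf hΛ
    have hg := fun b c => differentiableAt_christoffelVec hH hdet (e b) (e c)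
    -- Product rule applied to `hcov`, which holds on a neighbourhood of `y`: derivatives fall both
    -- on `λ` and on the Christoffel vectors.
    have hder : fderiv ℝ (fun z => evalT (covDeriv hyperbolicMetric (deviation G) z)
        ![e b, e c, e d]) y (e a)
        = fderiv ℝ (fderiv ℝ (fun z => bilOf (Λ z))) y (e a) (e b) (e c) (e d)
          - (fderiv ℝ (fun z => bilOf (Λ z)) y (e a)
              (christoffelVec hyperbolicMetric y (e b) (e c)) (e d)
            + bilOf (Λ y) (fderiv ℝ (fun z => christoffelVec hyperbolicMetric z (e b) (e c)) y
              (e a)) (e d))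
          - (fderiv ℝ (fun z => bilOf (Λ z)) y (e a) (e c)
              (christoffelVec hyperbolicMetric y (e b) (e d))
            + bilOf (Λ y) (e c) (fderiv ℝ (fun z => christoffelVec hyperbolicMetric z (e b) (e d)) y
              (e a))) := by
      have H := (((((hF2.hasFDerivAt.clm_apply (hasFDerivAt_const (e b) y)).clm_apply
          (hasFDerivAt_const (e c) y)).clm_apply (hasFDerivAt_const (e d) y)).fun_sub
        ((hF.hasFDerivAt.clm_apply (hg b c).hasFDerivAt).clm_apply
          (hasFDerivAt_const (e d) y))).fun_sub
        ((hF.hasFDerivAt.clm_apply (hasFDerivAt_const (e c) y)).clm_apply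
          (hg b d).hasFDerivAt)).congr_of_eventuallyEq (hcov (e b) (e c) (e d))
      rw [H.fderiv]
      simp
      ring
    rw [hder] at hb
    -- The corrections for the three slots of `∇λ` in the second covariant derivative.
    have t1 : ∀ i : Fin 3, ∀ v : Fin 3 → Fin (m + 1), |evalT (covDeriv hyperbolicMetric (deviation G) y)
        (Function.update (fun j => e (v j)) i (christoffelVec hyperbolicMetric y (e a) (e (v i))))|
        ≤ M * (K * N) := by
      intro i v
      rw [hchr, evalT_update_sum]
      have := abs_sum_mul_le hK.le (fun s => hΓ s a (v i)) (fun s => ?_ : ∀ s,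
        |evalT (covDeriv hyperbolicMetric (deviation G) y)
          (Function.update (fun j => e (v j)) i (e s))| ≤ N)
      · simpa [hM] using this
      · have := hT1 (Function.update v i s)
        convert this using 3
        ext1 j
        by_cases hj : j = i
        · subst hj; simp
        · simp [hj]
    have hv3 : (fun j => e (![b, c, d] j)) = ![e b, e c, e d] := by
      ext1 i; fin_cases i <;> rfl
    have e0 := t1 0 ![b, c, d]
    have e1 := t1 1 ![b, c, d]
    have e2 := t1 2 ![b, c, d]
    rw [hv3] at e0 e1 e2
    have f1 : |fderiv ℝ (fun z => bilOf (Λ z)) y (e a)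
        (christoffelVec hyperbolicMetric y (e b) (e c)) (e d)|
        ≤ M * (K * ((1 + 2 * (M * K)) * N)) := by
      rw [hchr]
      simp only [map_sum, map_smul, sum_apply, smul_apply, smul_eq_mul]
      have := abs_sum_mul_le hK.le (fun s => hΓ s b c) (fun s => h1 a s d)
      simpa [hM] using this
    have f2 : |fderiv ℝ (fun z => bilOf (Λ z)) y (e a) (e c)
        (christoffelVec hyperbolicMetric y (e b) (e d))|
        ≤ M * (K * ((1 + 2 * (M * K)) * N)) := by
      rw [hchr]
      simp only [map_sum, map_smul, smul_eq_mul]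
      have := abs_sum_mul_le hK.le (fun s => hΓ s b d) (fun s => h1 a c s)
      simpa [hM] using this
    have f3 : |bilOf (Λ y) (fderiv ℝ (fun z => christoffelVec hyperbolicMetric z (e b) (e c)) y
        (e a)) (e d)| ≤ M * (K * N) := by
      rw [hdchr]
      simp only [map_sum, map_smul, sum_apply, smul_apply, smul_eq_mul]
      have := abs_sum_mul_le hK.le (fun s => hdΓ a s b c) (fun s => h0 s d)
      simpa [hM] using this
    have f4 : |bilOf (Λ y) (e c) (fderiv ℝ (fun z => christoffelVec hyperbolicMetric z (e b) (e d))
        y (e a))| ≤ M * (K * N) := by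
      rw [hdchr]
      simp only [map_sum, map_smul, smul_eq_mul]
      have := abs_sum_mul_le hK.le (fun s => hdΓ a s b d) (fun s => h0 c s)
      simpa [hM] using this
    rw [Fin.sum_univ_three] at hb
    simp only [Matrix.cons_val_zero, Matrix.cons_val_one, Matrix.cons_val] at hb e0 e1 e2
    obtain ⟨b1, b2⟩ := abs_le.1 hb
    obtain ⟨a1, a2⟩ := abs_le.1 e0
    obtain ⟨a3, a4⟩ := abs_le.1 e1
    obtain ⟨a5, a6⟩ := abs_le.1 e2
    obtain ⟨c1, c2⟩ := abs_le.1 f1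
    obtain ⟨c3, c4⟩ := abs_le.1 f2
    obtain ⟨c5, c6⟩ := abs_le.1 f3
    obtain ⟨c7, c8⟩ := abs_le.1 f4
    exact abs_le.2 ⟨by linarith, by linarith⟩
  have hMK : 0 ≤ M * K * N := by positivity
  have hMK2 : 0 ≤ M * (K * (1 + 2 * (M * K))) * N := by positivity
  have hKN : 0 ≤ (1 + 2 * (M * K) + (1 + 3 * (M * K) + 2 * (M * (K * (1 + 2 * (M * K))))
    + 2 * (M * K))) * N := by positivity
  rw [frameJet, Prod.norm_def, Prod.norm_def]
  refine max_le ?_ (max_le ?_ ?_)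
  · refine (pi_norm_le_iff_of_nonneg hKN).2 fun a => (pi_norm_le_iff_of_nonneg hKN).2 fun b => ?_
    refine (h0 a b).trans ?_
    nlinarith
  · refine (pi_norm_le_iff_of_nonneg hKN).2 fun a => (pi_norm_le_iff_of_nonneg hKN).2 fun b =>
      (pi_norm_le_iff_of_nonneg hKN).2 fun c => ?_
    refine (h1 a b c).trans ?_
    nlinarith
  · refine (pi_norm_le_iff_of_nonneg hKN).2 fun a => (pi_norm_le_iff_of_nonneg hKN).2 fun b =>
      (pi_norm_le_iff_of_nonneg hKN).2 fun c => (pi_norm_le_iff_of_nonneg hKN).2 fun d => ?_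
    refine (h2 a b c d).trans ?_
    nlinarith

end Decay

/-! ### Functions of the angle -/

section Angle

variable {n : ℕ}

lemma angle_smul {t : ℝ} (ht : 0 < t) (y : E n) : angle (t • y) = angle y := by
  rw [angle, angle, norm_smul, Real.norm_of_nonneg ht.le, smul_smul, mul_inv]
  congr 1
  field_simp

lemma norm_angle {y : E n} (hy : y ≠ 0) : ‖angle y‖ = 1 := by
  rw [angle, norm_smul, norm_inv, norm_norm, inv_mul_cancel₀ (norm_ne_zero_iff.2 hy)]

lemma norm_smul_angle {y : E n} (hy : y ≠ 0) : ‖y‖ • angle y = y := by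
  rw [angle, smul_smul, mul_inv_cancel₀ (norm_ne_zero_iff.2 hy), one_smul]

lemma angle_of_norm_one {y : E n} (hy : ‖y‖ = 1) : angle y = y := by
  rw [angle, hy, inv_one, one_smul]

variable {s : E n → ℝ} (hs : ∀ t : ℝ, 0 < t → ∀ y, s (t • y) = s y)
include hs

lemma fderiv_homogeneous {t : ℝ} (ht : 0 < t) (y u : E n) :
    fderiv ℝ s y u = t * fderiv ℝ s (t • y) u := by
  have h : s = fun z => s (t • z) := by ext z; rw [hs t ht]
  conv_lhs => rw [h]
  rw [fderiv_comp_smul]; simp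

lemma d2_homogeneous {t : ℝ} (ht : 0 < t) (y u v : E n) :
    d2 s y u v = t ^ 2 * d2 s (t • y) u v := by
  have h : (fun z => fderiv ℝ s z v) = t • fun z => fderiv ℝ s (t • z) v := by
    ext z; exact fderiv_homogeneous hs ht z v
  unfold d2
  conv_lhs => rw [h]
  rw [fderiv_const_smul_field]
  simp only [Pi.smul_apply, smul_apply, smul_eq_mul]
  have := fderiv_comp_smul (𝕜 := ℝ) (f := fun z => fderiv ℝ s z v) (x := y) t
  rw [this]; simp; ring

lemma fderiv_homogeneous_self {y : E n} (hd : DifferentiableAt ℝ s y) :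
    fderiv ℝ s y y = 0 := by
  have h1 : HasDerivAt (fun t : ℝ => t • y) y 1 := by
    simpa using (hasDerivAt_id (1 : ℝ)).smul_const y
  have h2 : HasDerivAt (fun t : ℝ => s (t • y)) (fderiv ℝ s y y) 1 :=
    HasFDerivAt.comp_hasDerivAt (f := fun t : ℝ => t • y) (x := (1 : ℝ)) (l := s)
      (by simpa using hd.hasFDerivAt) h1
  have h3 : (fun t : ℝ => s (t • y)) =ᶠ[𝓝 1] fun _ => s y := by
    filter_upwards [lt_mem_nhds (zero_lt_one (α := ℝ))] with t ht using hs t ht y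
  exact h2.unique ((hasDerivAt_const (1 : ℝ) (s y)).congr_of_eventuallyEq h3)

/-- Derivatives of order `j` of a function homogeneous of degree `0` are homogeneous of degree `-j`,
so bounds on the compact unit sphere propagate to all of the collar. -/
lemma exists_bound_homogeneous (hc : ContDiffOn ℝ 2 s {0}ᶜ) : ∃ C : ℝ, 0 < C ∧ ∀ y : E n, y ≠ 0 →
    |s y| ≤ C ∧ (∀ u, |fderiv ℝ s y u| ≤ C * (‖u‖ / ‖y‖)) ∧
    ∀ u v, |d2 s y u v| ≤ C * (‖u‖ / ‖y‖ * (‖v‖ / ‖y‖)) := by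
  have hca : ∀ y : E n, y ≠ 0 → ContDiffAt ℝ 2 s y := fun y hy =>
    hc.contDiffAt (isOpen_compl_singleton.mem_nhds hy)
  have hne : ∀ y ∈ Metric.sphere (0 : E n) 1, y ≠ 0 := by
    intro y hy h
    rw [h] at hy; simp at hy
  have hcomp := isCompact_sphere (0 : E n) 1
  obtain ⟨C0, h0⟩ := hcomp.exists_bound_of_continuousOn (f := s)
    fun y hy => (hca y (hne y hy)).continuousAt.continuousWithinAt
  obtain ⟨C1, h1⟩ := hcomp.exists_bound_of_continuousOn (f := fderiv ℝ s)
    fun y hy => ((hca y (hne y hy)).fderiv_right (m := 1)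
      (by norm_num)).continuousAt.continuousWithinAt
  obtain ⟨C2, h2⟩ := hcomp.exists_bound_of_continuousOn (f := fderiv ℝ (fderiv ℝ s))
    fun y hy => (((hca y (hne y hy)).fderiv_right (m := 1)
      (by norm_num)).fderiv_right (m := 0) (by norm_num)).continuousAt.continuousWithinAt
  refine ⟨|C0| + |C1| + |C2| + 1, by positivity, fun y hy => ?_⟩
  have hy' : 0 < ‖y‖ := norm_pos_iff.2 hy
  have hθ : ‖y‖⁻¹ • y ∈ Metric.sphere (0 : E n) 1 := by
    rw [mem_sphere_zero_iff_norm]; exact norm_angle hy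
  have g0 := (h0 _ hθ).trans (le_abs_self _)
  have g1 := (h1 _ hθ).trans (le_abs_self _)
  have g2 := (h2 _ hθ).trans (le_abs_self _)
  have hi : 0 < ‖y‖⁻¹ := inv_pos.2 hy'
  refine ⟨?_, fun u => ?_, fun u v => ?_⟩
  · rw [hs _ hi] at g0
    rw [Real.norm_eq_abs] at g0
    linarith [abs_nonneg C1, abs_nonneg C2]
  · rw [fderiv_homogeneous hs hi, abs_mul, abs_of_pos hi]
    have := (fderiv ℝ s (‖y‖⁻¹ • y)).le_opNorm u
    rw [Real.norm_eq_abs] at this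
    calc _ ≤ ‖y‖⁻¹ * (‖fderiv ℝ s (‖y‖⁻¹ • y)‖ * ‖u‖) := by gcongr
      _ ≤ ‖y‖⁻¹ * ((|C0| + |C1| + |C2| + 1) * ‖u‖) := by
        gcongr; linarith [abs_nonneg C0, abs_nonneg C2]
      _ = _ := by rw [div_eq_mul_inv]; ring
  · rw [d2_homogeneous hs hi, abs_mul, abs_of_pos (pow_pos hi 2)]
    have hd : d2 s (‖y‖⁻¹ • y) u v = fderiv ℝ (fderiv ℝ s) (‖y‖⁻¹ • y) u v := by
      have hdf : DifferentiableAt ℝ (fderiv ℝ s) (‖y‖⁻¹ • y) :=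
        ((hca _ (hne _ hθ)).fderiv_right (m := 1) (by norm_num)).differentiableAt (by norm_num)
      rw [d2, (hdf.hasFDerivAt.clm_apply (hasFDerivAt_const v _)).fderiv]; simp
    rw [hd]
    have := (fderiv ℝ (fderiv ℝ s) (‖y‖⁻¹ • y)).le_opNorm₂ u v
    rw [Real.norm_eq_abs] at this
    calc _ ≤ ‖y‖⁻¹ ^ 2 * (‖fderiv ℝ (fderiv ℝ s) (‖y‖⁻¹ • y)‖ * ‖u‖ * ‖v‖) := by gcongr
      _ ≤ ‖y‖⁻¹ ^ 2 * ((|C0| + |C1| + |C2| + 1) * ‖u‖ * ‖v‖) := by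
        gcongr; linarith [abs_nonneg C0, abs_nonneg C1]
      _ = _ := by rw [div_eq_mul_inv, div_eq_mul_inv]; ring

end Angle

/-! ### Additivity of jets -/

section Additivity

variable {n : ℕ} {y : E n}

lemma bilOf_add' (A B : Matrix (Fin n) (Fin n) ℝ) : bilOf (A + B) = bilOf A + bilOf B := by
  ext u v; simp [bilOf_add]

lemma frameJet_add {G H : E n → Matrix (Fin n) (Fin n) ℝ}
    (hG : ∀ i j, ContDiffAt ℝ 2 (fun z => G z i j) y)
    (hH : ∀ i j, ContDiffAt ℝ 2 (fun z => H z i j) y) (e : Fin n → E n) :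
    frameJet (fun z => bilOf (G z + H z)) y e
      = frameJet (fun z => bilOf (G z)) y e + frameJet (fun z => bilOf (H z)) y e := by
  have h1 : ∀ᶠ z in 𝓝 y, fderiv ℝ (fun z => bilOf (G z + H z)) z
      = fderiv ℝ (fun z => bilOf (G z)) z + fderiv ℝ (fun z => bilOf (H z)) z := by
    filter_upwards [eventually_contDiffAt hG, eventually_contDiffAt hH] with z h1 h2
    simp only [bilOf_add']
    exact fderiv_fun_add ((contDiffAt_bilOf h1).differentiableAt (by norm_num))
      ((contDiffAt_bilOf h2).differentiableAt (by norm_num))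
  have h2 : fderiv ℝ (fderiv ℝ (fun z => bilOf (G z + H z))) y
      = fderiv ℝ (fderiv ℝ (fun z => bilOf (G z))) y
        + fderiv ℝ (fderiv ℝ (fun z => bilOf (H z))) y := by
    rw [Filter.EventuallyEq.fderiv_eq h1]
    exact fderiv_fun_add (differentiableAt_fderiv_bilOf hG) (differentiableAt_fderiv_bilOf hH)
  simp only [frameJet, Prod.mk_add_mk]
  congr 1
  · ext a b; simp [bilOf_add]
  congr 1
  · ext a b c
    simp only [jetOne, h1.self_of_nhds]; rfl
  · ext a b c d
    simp only [jetTwo, h2]; rfl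

end Additivity

/-! ### The two-jet of a radial perturbation -/

section Bump

variable {m : ℕ}

/-- The tensor `xⁿ⁻² a(θ) X(x²) dx²`. -/
def radialBump {n : ℕ} (a : E n → ℝ) (X : ℝ → ℝ) (y : E n) : Matrix (Fin n) (Fin n) ℝ :=
  (‖y‖ ^ (n - 2) * a (angle y) * X (‖y‖ ^ 2)) • dxSq y

/-- The exponent `n / 2 - 2`. -/
def bumpExp (n : ℕ) : ℝ := n / 2 - 2

/-- Since `dx² = (y · dy)² / q` with `q = x²`, the coefficient of `(y · dy)²` in the perturbation is
`q^(n/2 - 2) a X`. The real exponent covers odd `n`. -/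
lemma rpow_bumpExp {n : ℕ} {x : ℝ} (hx : 0 < x) :
    (x ^ 2) ^ bumpExp n * (x ^ 2) ^ 2 = x ^ n := by
  rw [bumpExp, ← Real.rpow_natCast (x ^ 2) 2, ← Real.rpow_add (by positivity),
    ← Real.rpow_natCast x 2, ← Real.rpow_mul hx.le, ← Real.rpow_natCast x n]
  congr 1
  push_cast; ring

lemma bilOf_radialBump {n : ℕ} (hn : 2 ≤ n) (a : E n → ℝ) (X : ℝ → ℝ) {y : E n} (hy : y ≠ 0)
    (u v : E n) : bilOf (radialBump a X y) u v
      = ((‖y‖ ^ 2) ^ bumpExp n * X (‖y‖ ^ 2)) * a (angle y) * (inner ℝ y u * inner ℝ y v) := by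
  have hy' : 0 < ‖y‖ := norm_pos_iff.2 hy
  have h := rpow_bumpExp (n := n) hy'
  have h2 : ‖y‖ ^ (n - 2) * ‖y‖ ^ 2 = ‖y‖ ^ n := by rw [← pow_add]; congr 1; omega
  rw [radialBump, bilOf_smul, bilOf_dxSq]
  have h3 : ‖y‖ ^ (n - 2) * (‖y‖ ^ 2)⁻¹ = (‖y‖ ^ 2) ^ bumpExp n := by
    have h4 : (‖y‖ ^ 2) ^ bumpExp n = ‖y‖ ^ n / (‖y‖ ^ 2) ^ 2 := by
      rw [eq_div_iff (by positivity), h]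
    rw [h4, ← h2]; field_simp
  rw [← h3]; ring

lemma contDiffAt_radialBump {n : ℕ} {k : WithTop ℕ∞} {a : E n → ℝ} {X : ℝ → ℝ} {y : E n}
    (hy : y ≠ 0) (ha : ContDiffAt ℝ k (fun y => a (angle y)) y) (hX : ContDiffAt ℝ k X (‖y‖ ^ 2))
    (i j : Fin n) : ContDiffAt ℝ k (fun z => radialBump a X z i j) y := by
  have h : ContDiffAt ℝ k (fun z : E n => ‖z‖) y := contDiffAt_norm ℝ hy
  simp only [radialBump, Matrix.smul_apply, smul_eq_mul]
  exact (((h.pow _).mul ha).mul (contDiffAt_radial hX)).mul (contDiffAt_dxSq hy i j)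

lemma radialBump_isSymm {n : ℕ} (a : E n → ℝ) (X : ℝ → ℝ) (y : E n) :
    (radialBump a X y).IsSymm := by
  ext i j; simp [radialBump, dxSq, mul_comm]

/-- The part of the two-jet of `f (y · dy)²` which is not in the component `00`. -/
def bumpRest (q φ : ℝ) (d : Fin (m + 1) → ℝ) : Jet (m + 1) :=
  (0, fun k u v => q * φ * (tang k u * rad v + tang k v * rad u),
    fun k l u v => q * d l * (tang k u * rad v + tang k v * rad u)
      + q * d k * (tang l u * rad v + tang l v * rad u)
      + q * φ * (tang k v * rad l * rad u + tang k u * rad l * rad v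
        + tang l u * rad k * rad v + tang l v * rad k * rad u)
      + q ^ 2 * φ * (tang l u * tang k v + tang k u * tang l v))

/-- The split separates the part `radJet`, on which the linearised curvature is known exactly, from
`bumpRest`, all of whose terms carry a factor `q`. -/
lemma frameJet_radialBump (hm : 1 ≤ m) {a : E (m + 1) → ℝ} {X : ℝ → ℝ} {y : E (m + 1)} (hy : y ≠ 0)
    (ha : ContDiffAt ℝ 2 (fun y => a (angle y)) y) (hX : ContDiffAt ℝ 2 X (‖y‖ ^ 2))
    {e : Fin (m + 1) → E (m + 1)} (he : IsAdapted y e) {f : E (m + 1) → ℝ}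
    (hf : f = fun z => ((‖z‖ ^ 2) ^ bumpExp (m + 1) * X (‖z‖ ^ 2)) * a (angle z))
    (hfc : ContDiffAt ℝ 2 f y) {q φ : ℝ} {d : Fin (m + 1) → ℝ}
    {P : Fin (m + 1) → Fin (m + 1) → ℝ} (hq : q = ‖y‖ ^ 2) (hφ : φ = q ^ 2 * f y)
    (hd : ∀ k, d k = q ^ 2 * fderiv ℝ f y (e k)) (hP : ∀ k l, P k l = q ^ 2 * d2 f y (e k) (e l)) :
    frameJet (fun z => bilOf (radialBump a X z)) y e
      = radJet φ (fun k => d k + 2 * φ * rad k)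
          (fun k l => P k l + 2 * d l * rad k + 2 * d k * rad l + 2 * φ * (rad k * rad l))
        + bumpRest q φ d := by
  have hev : ∀ u v : E (m + 1), (fun z => bilOf (radialBump a X z) u v) =ᶠ[𝓝 y] fun z =>
      f z * (inner ℝ z u * inner ℝ z v) := by
    intro u v
    filter_upwards [isOpen_ne.mem_nhds hy] with z hz
    rw [bilOf_radialBump (by omega) a X hz, hf]
  have hG := fun i j => contDiffAt_radialBump hy ha hX i j
  simp only [frameJet, radJet, bumpRest, Prod.mk_add_mk]
  congr 1
  · ext a b
    simp only [(hev _ _).eq_of_nhds, he.inner_left, hφ, ← hq, Pi.add_apply, Pi.zero_apply]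
    ring
  congr 1
  · ext k u v
    rw [jetOne_eq hG, (hev _ _).fderiv_eq, fderiv_quad (hfc.differentiableAt (by norm_num))]
    simp only [he.inner_left, he.inner_eq, hφ, hd, ← hq, Pi.add_apply]
    ring
  · ext k l u v
    rw [jetTwo_eq hG, d2_congr (hev _ _), d2_quad hfc]
    simp only [he.inner_left, he.inner_eq, hφ, hd, hP, ← hq, Pi.add_apply]
    ring

end Bump

/-! ### The scalar curvature of a radial perturbation -/

section Estimate

variable {m : ℕ}

lemma rad_nonneg (a : Fin (m + 1)) : 0 ≤ rad a := by unfold rad; split_ifs <;> norm_num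
lemma rad_le_one (a : Fin (m + 1)) : rad a ≤ 1 := by unfold rad; split_ifs <;> norm_num
lemma tang_nonneg (a b : Fin (m + 1)) : 0 ≤ tang a b := by unfold tang; split_ifs <;> norm_num
lemma tang_le_one (a b : Fin (m + 1)) : tang a b ≤ 1 := by unfold tang; split_ifs <;> norm_num

lemma mul_mem_unit {a b : ℝ} (ha : 0 ≤ a ∧ a ≤ 1) (hb : 0 ≤ b ∧ b ≤ 1) : 0 ≤ a * b ∧ a * b ≤ 1 :=
  ⟨mul_nonneg ha.1 hb.1, mul_le_one₀ ha.2 hb.1 hb.2⟩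

lemma abs_mul_le_of_unit {a s N : ℝ} (ha : |a| ≤ N) (hs : 0 ≤ s ∧ s ≤ 1) : |a * s| ≤ N := by
  rw [abs_mul, abs_of_nonneg hs.1]
  nlinarith [abs_nonneg a]

lemma rad_mem (a : Fin (m + 1)) : 0 ≤ rad a ∧ rad a ≤ 1 := ⟨rad_nonneg a, rad_le_one a⟩
lemma tang_mem (a b : Fin (m + 1)) : 0 ≤ tang a b ∧ tang a b ≤ 1 :=
  ⟨tang_nonneg a b, tang_le_one a b⟩

lemma norm_jet_le {n : ℕ} {J : Jet n} {N : ℝ} (hN : 0 ≤ N) (h0 : ∀ a b, |J.1 a b| ≤ N)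
    (h1 : ∀ a b c, |J.2.1 a b c| ≤ N) (h2 : ∀ a b c d, |J.2.2 a b c d| ≤ N) : ‖J‖ ≤ N := by
  rw [Prod.norm_def, Prod.norm_def]
  refine max_le ?_ (max_le ?_ ?_)
  · exact (pi_norm_le_iff_of_nonneg hN).2 fun a => (pi_norm_le_iff_of_nonneg hN).2 fun b => h0 a b
  · exact (pi_norm_le_iff_of_nonneg hN).2 fun a => (pi_norm_le_iff_of_nonneg hN).2 fun b =>
      (pi_norm_le_iff_of_nonneg hN).2 fun c => h1 a b c
  · exact (pi_norm_le_iff_of_nonneg hN).2 fun a => (pi_norm_le_iff_of_nonneg hN).2 fun b =>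
      (pi_norm_le_iff_of_nonneg hN).2 fun c => (pi_norm_le_iff_of_nonneg hN).2 fun d => h2 a b c d

lemma norm_radJet_le {φ N : ℝ} {p : Fin (m + 1) → ℝ} {P : Fin (m + 1) → Fin (m + 1) → ℝ}
    (hφ : |φ| ≤ N) (hp : ∀ k, |p k| ≤ N) (hP : ∀ k l, |P k l| ≤ N) : ‖radJet φ p P‖ ≤ N :=
  norm_jet_le ((abs_nonneg _).trans hφ)
    (fun a b => abs_mul_le_of_unit hφ (mul_mem_unit (rad_mem a) (rad_mem b)))
    (fun k a b => abs_mul_le_of_unit (hp k) (mul_mem_unit (rad_mem a) (rad_mem b)))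
    (fun k l a b => abs_mul_le_of_unit (hP k l) (mul_mem_unit (rad_mem a) (rad_mem b)))

lemma abs_mul_le_mul {a s N c : ℝ} (ha : |a| ≤ N) (hs : 0 ≤ s) (hs' : s ≤ c) :
    |a * s| ≤ c * N := by
  rw [abs_mul, abs_of_nonneg hs]
  nlinarith [abs_nonneg a]

/-- The factor `10 = 2 + 2 + 4 + 2` counts the products of `rad` and `tang` in the four groups of
second derivatives, each product lying in `[0, 1]`. -/
lemma norm_bumpRest_le {q φ N : ℝ} {d : Fin (m + 1) → ℝ} (hq : 0 ≤ q) (hq1 : q ≤ 1)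
    (hφ : |φ| ≤ N) (hd : ∀ k, |d k| ≤ N) : ‖bumpRest q φ d‖ ≤ 10 * q * N := by
  have hN : 0 ≤ N := (abs_nonneg _).trans hφ
  have t : ∀ a b c : Fin (m + 1), 0 ≤ tang a b * rad c ∧ tang a b * rad c ≤ 1 := fun a b c =>
    mul_mem_unit (tang_mem _ _) (rad_mem _)
  have t3 : ∀ a b c d : Fin (m + 1), 0 ≤ tang a b * rad c * rad d ∧ tang a b * rad c * rad d ≤ 1 :=
    fun a b c d => mul_mem_unit (t _ _ _) (rad_mem _)
  have t4 : ∀ a b c d : Fin (m + 1), 0 ≤ tang a b * tang c d ∧ tang a b * tang c d ≤ 1 :=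
    fun a b c d => mul_mem_unit (tang_mem _ _) (tang_mem _ _)
  refine norm_jet_le (by positivity) (fun a b => ?_) (fun k u v => ?_) (fun k l u v => ?_)
  · simp [bumpRest]; positivity
  · simp only [bumpRest]
    rw [mul_assoc, abs_mul, abs_of_nonneg hq, mul_comm (10 : ℝ), mul_assoc]
    have := abs_mul_le_mul (s := tang k u * rad v + tang k v * rad u) (c := 2) hφ
      (by linarith [(t k u v).1, (t k v u).1]) (by linarith [(t k u v).2, (t k v u).2])
    exact mul_le_mul_of_nonneg_left (this.trans (by linarith)) hq
  · simp only [bumpRest]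
    have e : q * d l * (tang k u * rad v + tang k v * rad u)
      + q * d k * (tang l u * rad v + tang l v * rad u)
      + q * φ * (tang k v * rad l * rad u + tang k u * rad l * rad v
        + tang l u * rad k * rad v + tang l v * rad k * rad u)
      + q ^ 2 * φ * (tang l u * tang k v + tang k u * tang l v)
      = q * (d l * (tang k u * rad v + tang k v * rad u)
      + d k * (tang l u * rad v + tang l v * rad u)
      + φ * (tang k v * rad l * rad u + tang k u * rad l * rad v
        + tang l u * rad k * rad v + tang l v * rad k * rad u)
      + φ * (q * (tang l u * tang k v + tang k u * tang l v))) := by ring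
    rw [e, abs_mul, abs_of_nonneg hq, show 10 * q * N = q * (10 * N) by ring]
    refine mul_le_mul_of_nonneg_left ?_ hq
    have a1 := abs_le.1 (abs_mul_le_mul (s := tang k u * rad v + tang k v * rad u) (c := 2) (hd l)
      (by linarith [(t k u v).1, (t k v u).1]) (by linarith [(t k u v).2, (t k v u).2]))
    have a2 := abs_le.1 (abs_mul_le_mul (s := tang l u * rad v + tang l v * rad u) (c := 2) (hd k)
      (by linarith [(t l u v).1, (t l v u).1]) (by linarith [(t l u v).2, (t l v u).2]))
    have a3 := abs_le.1 (abs_mul_le_mul (s := tang k v * rad l * rad u + tang k u * rad l * rad v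
        + tang l u * rad k * rad v + tang l v * rad k * rad u) (c := 4) hφ
      (by linarith [(t3 k v l u).1, (t3 k u l v).1, (t3 l u k v).1, (t3 l v k u).1])
      (by linarith [(t3 k v l u).2, (t3 k u l v).2, (t3 l u k v).2, (t3 l v k u).2]))
    have a4 := abs_le.1 (abs_mul_le_mul (s := q * (tang l u * tang k v + tang k u * tang l v))
      (c := 2) hφ
      (mul_nonneg hq (by linarith [(t4 l u k v).1, (t4 k u l v).1]))
      (by nlinarith [(t4 l u k v).1, (t4 k u l v).1, (t4 l u k v).2, (t4 k u l v).2]))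
    exact abs_le.2 ⟨by linarith [a1.1, a2.1, a3.1, a4.1], by linarith [a1.2, a2.2, a3.2, a4.2]⟩

/-- The derivatives of `t ↦ tᵖ X(t)`. -/
lemma hasDerivAt_rpow_mul {X : ℝ → ℝ} (hX : ContDiff ℝ ∞ X) (p : ℝ) {t : ℝ} (ht : 0 < t) :
    HasDerivAt (fun t => t ^ p * X t) (p * t ^ (p - 1) * X t + t ^ p * deriv X t) t ∧
    HasDerivAt (fun t => p * t ^ (p - 1) * X t + t ^ p * deriv X t)
      (p * (p - 1) * t ^ (p - 2) * X t + 2 * p * t ^ (p - 1) * deriv X t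
        + t ^ p * deriv (deriv X) t) t := by
  have h1 : ∀ p : ℝ, HasDerivAt (fun t : ℝ => t ^ p) (p * t ^ (p - 1)) t := fun p =>
    Real.hasDerivAt_rpow_const (Or.inl ht.ne')
  have hX1 : HasDerivAt X (deriv X t) t := (hX.differentiable (by simp) t).hasDerivAt
  have hX2 : HasDerivAt (deriv X) (deriv (deriv X) t) t :=
    ((hX.iterate_deriv 1).differentiable (by simp) t).hasDerivAt
  refine ⟨(h1 p).fun_mul hX1, ?_⟩
  refine ((((h1 (p - 1)).const_mul p).fun_mul hX1).fun_add ((h1 p).fun_mul hX2)).congr_deriv ?_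
  have : p - 1 - 1 = p - 2 := by ring
  rw [this]; ring

lemma rpow_sub_nat {q : ℝ} (hq : 0 < q) (p : ℝ) :
    q * q ^ (p - 1) = q ^ p ∧ q ^ 2 * q ^ (p - 2) = q ^ p := by
  constructor
  · rw [Real.rpow_sub_one hq.ne']; field_simp
  · rw [Real.rpow_sub hq]; norm_cast; field_simp

/-- The rescaled derivatives of the coefficient of a radial perturbation in an adapted frame. -/
lemma bump_derivatives {b : E (m + 1) → ℝ} {X : ℝ → ℝ} (hX : ContDiff ℝ ∞ X) {y : E (m + 1)}
    (hy : y ≠ 0) (hb : ContDiffAt ℝ 2 b y) {e : Fin (m + 1) → E (m + 1)} (he : IsAdapted y e) (p : ℝ)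
    {q X0 X1 X2 W : ℝ} (hq : q = ‖y‖ ^ 2) (h0 : X0 = X q) (h1 : X1 = q * deriv X q)
    (h2 : X2 = q ^ 2 * deriv (deriv X) q) (hW : W = q ^ p * q ^ 2) :
    ContDiffAt ℝ 2 (fun z => ((‖z‖ ^ 2) ^ p * X (‖z‖ ^ 2)) * b z) y ∧
    (∀ k, q ^ 2 * fderiv ℝ (fun z => ((‖z‖ ^ 2) ^ p * X (‖z‖ ^ 2)) * b z) y (e k)
      = W * (2 * (p * X0 + X1) * rad k * b y + X0 * fderiv ℝ b y (e k))) ∧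
    (∀ k l, q ^ 2 * d2 (fun z => ((‖z‖ ^ 2) ^ p * X (‖z‖ ^ 2)) * b z) y (e k) (e l)
      = W * ((4 * (p * (p - 1) * X0 + 2 * p * X1 + X2) + 2 * (p * X0 + X1)) * (rad k * rad l) * b y
        + 2 * (p * X0 + X1) * q * tang k l * b y
        + 2 * (p * X0 + X1) * (rad l * fderiv ℝ b y (e k) + rad k * fderiv ℝ b y (e l))
        + X0 * d2 b y (e k) (e l))) := by
  have hqp : 0 < q := by rw [hq]; have := norm_pos_iff.2 hy; positivity
  obtain ⟨r1, r2⟩ := rpow_sub_nat hqp p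
  have hqp' : 0 < ‖y‖ ^ 2 := hq ▸ hqp
  have hcR : ContDiffAt ℝ 2 (fun t : ℝ => t ^ p * X t) (‖y‖ ^ 2) :=
    (Real.contDiffAt_rpow_const_of_ne hqp'.ne').mul (hX.of_le (WithTop.coe_le_coe.2 (le_top : (2 : ℕ∞) ≤ ⊤))).contDiffAt
  have hcR' : ContDiffAt ℝ 2 (fun z : E (m + 1) => (‖z‖ ^ 2) ^ p * X (‖z‖ ^ 2)) y :=
    contDiffAt_radial hcR
  have hd1 : ∀ k, fderiv ℝ (fun z : E (m + 1) => (‖z‖ ^ 2) ^ p * X (‖z‖ ^ 2)) y k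
      = 2 * (p * q ^ (p - 1) * X q + q ^ p * deriv X q) * inner ℝ y k := by
    intro k
    have := fderiv_radial (y := y) (A := fun t => t ^ p * X t)
      (hasDerivAt_rpow_mul hX p hqp').1 k
    rw [this, hq]
  have hd2 : ∀ k l, d2 (fun z : E (m + 1) => (‖z‖ ^ 2) ^ p * X (‖z‖ ^ 2)) y k l
      = 4 * (p * (p - 1) * q ^ (p - 2) * X q + 2 * p * q ^ (p - 1) * deriv X q
        + q ^ p * deriv (deriv X) q) * (inner ℝ y k * inner ℝ y l)
        + 2 * (p * q ^ (p - 1) * X q + q ^ p * deriv X q) * inner ℝ k l := by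
    intro k l
    have := d2_radial (y := y) (A := fun t => t ^ p * X t)
      ((lt_mem_nhds hqp').mono fun t ht => (hasDerivAt_rpow_mul hX p ht).1)
      (hasDerivAt_rpow_mul hX p hqp').2 k l
    rw [this, hq]
  refine ⟨hcR'.mul hb, fun k => ?_, fun k l => ?_⟩
  · rw [fderiv_mul_apply (hcR'.differentiableAt (by norm_num)) (hb.differentiableAt (by norm_num)),
      hd1, he.inner_left, ← hq, hW, h0, h1, ← r1]
    ring
  · rw [d2_mul hcR' hb, hd1, hd1, hd2, he.inner_left, he.inner_left, he.inner_eq, ← hq, hW, h0, h1,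
      h2]
    have r3 : q ^ (p - 1) = q * q ^ (p - 2) := by
      have : q * q ^ (p - 1) = q * (q * q ^ (p - 2)) := by rw [r1, ← r2]; ring
      exact mul_left_cancel₀ hqp.ne' this
    rw [r3, ← r2]
    ring

lemma IsAdapted.norm_eq {y : E (m + 1)} {e : Fin (m + 1) → E (m + 1)} (he : IsAdapted y e) :
    ‖e 0‖ = ‖y‖ ∧ ∀ a : Fin m, ‖e a.succ‖ = ‖y‖ ^ 2 := by
  refine ⟨by rw [he.zero], fun a => ?_⟩
  have h := he.inner_eq a.succ a.succ
  rw [real_inner_self_eq_norm_sq] at h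
  have h2 : ‖e a.succ‖ ^ 2 = (‖y‖ ^ 2) ^ 2 := by simpa using h
  exact (sq_eq_sq₀ (norm_nonneg _) (by positivity)).1 h2

end Estimate

/-! ### The linearised curvature of the radial perturbation -/

section CurvatureEstimate

variable {m : ℕ}

lemma angle_homogeneous {n : ℕ} (a : E n → ℝ) (t : ℝ) (ht : 0 < t) (y : E n) :
    a (angle (t • y)) = a (angle y) := by rw [angle_smul ht]

set_option maxHeartbeats 1000000 in
/-- The two-jet of a radial perturbation, up to its component `∂₀∂₀g₀₀`, and its image under the
linearised scalar curvature. -/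
lemma exists_bump_jet_bound (hm : 1 ≤ m) {a : E (m + 1) → ℝ}
    (ha : ContDiffOn ℝ 2 (fun y => a (angle y)) {0}ᶜ) :
    ∃ C : ℝ, 0 < C ∧ ∀ (X : ℝ → ℝ) (y : E (m + 1)) (e : Fin (m + 1) → E (m + 1)) (S : ℝ),
      ContDiff ℝ ∞ X → y ≠ 0 → ‖y‖ < 1 → IsAdapted y e → 0 ≤ X (‖y‖ ^ 2) →
      S = X (‖y‖ ^ 2) + |‖y‖ ^ 2 * deriv X (‖y‖ ^ 2)| →
      ∃ (δ : Jet (m + 1)) (s : ℝ),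
        frameJet (fun z => bilOf (radialBump a X z)) y e
          = δ + (0, 0, fun k l u v => s * (rad k * rad l * rad u * rad v)) ∧
        ‖δ‖ ≤ C * (‖y‖ ^ (m + 1) * S) ∧
        |fderiv ℝ jetCurv (hypJet m 0) δ
          + 2 * m * ‖y‖ ^ (m + 1) * a (angle y) * (‖y‖ ^ 2 * deriv X (‖y‖ ^ 2))|
          ≤ C * ‖y‖ ^ 2 * (‖y‖ ^ (m + 1) * S) := by
  obtain ⟨C, hC, hCb⟩ := exists_bound_homogeneous (angle_homogeneous a) ha
  set p := bumpExp (m + 1) with hp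
  -- This relation for the exponent is what makes the terms without derivatives of `X` cancel in
  -- `hlin`.
  have hp2 : 2 * (p + 1) = m - 1 := by rw [hp, bumpExp]; push_cast; ring
  -- `r` dominates `1`, `|p|` and `|p - 1|`, hence all coefficients produced by differentiating the
  -- power.
  set r : ℝ := |p| + 1 with hr
  have hr1 : 1 ≤ r := by rw [hr]; linarith [abs_nonneg p]
  set D : ℝ := 40 * r ^ 2 * C with hD
  set F : ℝ := ‖fderiv ℝ jetCurv (hypJet m 0)‖ with hF
  have hF0 : 0 ≤ F := norm_nonneg _
  have hD0 : 0 < D := by positivity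
  -- `11 D` bounds `δ` (the radial part `D` and the rest `10 D`); the other two terms bound the
  -- linearised curvature of `bumpRest` and the tangential trace of `P'`.
  refine ⟨11 * D + F * (10 * D) + m * (3 * r ^ 2 * C), by positivity, ?_⟩
  intro X y e S hX hy hy1 he hX0 hS
  have hy' : 0 < ‖y‖ := norm_pos_iff.2 hy
  set q := ‖y‖ ^ 2 with hq
  set X0 := X q with hX0d
  set X1 := q * deriv X q with hX1d
  set X2 := q ^ 2 * deriv (deriv X) q with hX2d
  set W := ‖y‖ ^ (m + 1) with hW
  set A := a (angle y) with hA
  have hq0 : 0 < q := by positivity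
  have hq1 : q ≤ 1 := by rw [hq]; nlinarith
  have hWp : 0 < W := by positivity
  have hWe : W = q ^ p * q ^ 2 := (rpow_bumpExp hy').symm
  have hac : ContDiffAt ℝ 2 (fun y => a (angle y)) y :=
    ha.contDiffAt (isOpen_compl_singleton.mem_nhds hy)
  obtain ⟨hb0, hb1, hb2⟩ := hCb y hy
  obtain ⟨hn0, hns⟩ := he.norm_eq
  have hne : ∀ k, ‖e k‖ / ‖y‖ ≤ 1 := by
    intro k
    rw [div_le_one hy']
    refine Fin.cases hn0.le (fun k => ?_) k
    rw [hns]; nlinarith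
  set b1 : Fin (m + 1) → ℝ := fun k => fderiv ℝ (fun y => a (angle y)) y (e k) with hb1d
  set b2 : Fin (m + 1) → Fin (m + 1) → ℝ := fun k l => d2 (fun y => a (angle y)) y (e k) (e l)
    with hb2d
  have hb1' : ∀ k, |b1 k| ≤ C := fun k => (hb1 _).trans (mul_le_of_le_one_right hC.le (hne k))
  have hb2' : ∀ k l, |b2 k l| ≤ C := fun k l => (hb2 _ _).trans
    (mul_le_of_le_one_right hC.le (mul_le_one₀ (hne k) (by positivity) (hne l)))
  -- The tangential frame vectors have length `x²`, so two tangential derivatives of a function of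
  -- the angle gain a full factor `q = x²`.
  have hb2s : ∀ k : Fin m, |b2 k.succ k.succ| ≤ C * q := by
    intro k
    refine (hb2 _ _).trans (le_of_eq ?_)
    rw [hns, hq]; field_simp
  -- Euler's relation: a function of the angle is constant along rays.
  have hb10 : b1 0 = 0 := by
    rw [hb1d]; simp only [he.zero]
    exact fderiv_homogeneous_self (angle_homogeneous a) (hac.differentiableAt (by norm_num))
  obtain ⟨hfc, hfd, hfD⟩ := bump_derivatives hX hy hac he p hq hX0d hX1d hX2d hWe
  set f : E (m + 1) → ℝ := fun z => ((‖z‖ ^ 2) ^ p * X (‖z‖ ^ 2)) * a (angle z) with hf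
  set φ : ℝ := W * (X0 * A) with hφ
  have hφf : φ = q ^ 2 * f y := by rw [hφ, hWe, hf, hX0d, hA, hq]; ring
  set d : Fin (m + 1) → ℝ := fun k => W * (2 * (p * X0 + X1) * rad k * A + X0 * b1 k) with hd
  set P : Fin (m + 1) → Fin (m + 1) → ℝ := fun k l =>
    W * ((4 * (p * (p - 1) * X0 + 2 * p * X1 + X2) + 2 * (p * X0 + X1)) * (rad k * rad l) * A
        + 2 * (p * X0 + X1) * q * tang k l * A
        + 2 * (p * X0 + X1) * (rad l * b1 k + rad k * b1 l)
        + X0 * b2 k l) with hP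
  have hjet := frameJet_radialBump hm hy hac (hX.of_le (WithTop.coe_le_coe.2
    (le_top : (2 : ℕ∞) ≤ ⊤))).contDiffAt he hf hfc hq hφf (d := d) (P := P)
    (fun k => (hfd k).symm) (fun k l => (hfD k l).symm)
  set T : ℝ := p * X0 + X1 with hT
  set U : ℝ := p * (p - 1) * X0 + 2 * p * X1 with hU
  have hX1S : |X1| ≤ S := by rw [hS]; linarith
  have hX0S : |X0| ≤ S := by rw [hS, abs_of_nonneg hX0]; linarith [abs_nonneg X1]
  have hS0 : 0 ≤ S := (abs_nonneg _).trans hX0S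
  have hTS : |T| ≤ r * S := by
    rw [hS, hT, hr]
    refine (abs_add_le _ _).trans ?_
    rw [abs_mul, abs_of_nonneg hX0]
    nlinarith only [hX0, abs_nonneg p, abs_nonneg X1, mul_nonneg (abs_nonneg p) (abs_nonneg X1)]
  have hUS : |U| ≤ 3 * r ^ 2 * S := by
    rw [hU]
    have hp1 : |p - 1| ≤ r := by
      rw [hr]; exact (abs_sub _ _).trans (by simp)
    have hpr : |p| ≤ r := by rw [hr]; linarith
    have e1 : |p * (p - 1) * X0| ≤ r * r * S := by
      rw [abs_mul, abs_mul]; gcongr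
    have e2 : |2 * p * X1| ≤ 2 * r * S := by
      rw [abs_mul, abs_mul, abs_two]; gcongr
    refine (abs_add_le _ _).trans ?_
    nlinarith only [e1, e2, mul_nonneg (mul_nonneg (by linarith only [hr1] : 0 ≤ r) hS0) (by linarith only [hr1] : 0 ≤ r - 1)]
  have hr2 : r ≤ r ^ 2 := by nlinarith only [hr1]
  have h1r2 : 1 ≤ r ^ 2 := by nlinarith only [hr1]
  have hrS : r * S ≤ r ^ 2 * S := mul_le_mul_of_nonneg_right hr2 hS0
  have h1S : S ≤ r ^ 2 * S := le_mul_of_one_le_left hS0 h1r2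
  set N : ℝ := W * S with hN
  have hN0 : 0 ≤ N := by positivity
  have hWmul : ∀ {x c : ℝ}, |x| ≤ c * (r ^ 2 * S * C) → |W * x| ≤ c * (r ^ 2 * C) * N := by
    intro x c hx
    rw [abs_mul, abs_of_pos hWp, hN]
    refine (mul_le_mul_of_nonneg_left hx hWp.le).trans (le_of_eq (by ring))
  have hTr : ∀ {c : ℝ}, |c| ≤ C → |T * c| ≤ r ^ 2 * S * C := by
    intro c hc
    rw [abs_mul]
    exact mul_le_mul (hTS.trans hrS) hc (abs_nonneg _) (by positivity)
  have hXr : ∀ {c : ℝ}, |c| ≤ C → |X0 * c| ≤ r ^ 2 * S * C := by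
    intro c hc
    rw [abs_mul]
    exact mul_le_mul (hX0S.trans h1S) hc (abs_nonneg _) (by positivity)
  have hUr : ∀ {c : ℝ}, |c| ≤ C → |U * c| ≤ 3 * (r ^ 2 * S * C) := by
    intro c hc
    rw [abs_mul]
    refine (mul_le_mul hUS hc (abs_nonneg _) (by positivity)).trans (le_of_eq (by ring))
  have hφN : |φ| ≤ 1 * (r ^ 2 * C) * N := hWmul (by rw [one_mul]; exact hXr hb0)
  have hdN : ∀ k, |d k| ≤ 3 * (r ^ 2 * C) * N := by
    intro k
    refine hWmul ?_
    have e1 := abs_le.1 (abs_mul_le_of_unit (hTr hb0) (rad_mem k))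
    have e2 := abs_le.1 (hXr (hb1' k))
    exact abs_le.2 ⟨by linarith only [e1.1, e2.1], by linarith only [e1.2, e2.2]⟩
  -- The second derivatives of the radial component with the terms in `X2` left out. These have only
  -- the all-radial component and form the separate summand with `s = 4 W X2 A`, which the curvature
  -- does not see.
  set P' : Fin (m + 1) → Fin (m + 1) → ℝ := fun k l =>
    W * ((4 * U + 2 * T) * (rad k * rad l) * A + 2 * T * q * tang k l * A
        + 2 * T * (rad l * b1 k + rad k * b1 l) + X0 * b2 k l)
      + 2 * d l * rad k + 2 * d k * rad l + 2 * φ * (rad k * rad l) with hP'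
  have hP'N : ∀ k l, |P' k l| ≤ D * N := by
    intro k l
    have e1 := abs_le.1 (abs_mul_le_of_unit (hUr hb0) (mul_mem_unit (rad_mem k) (rad_mem l)))
    have e2 := abs_le.1 (abs_mul_le_of_unit (hTr hb0) (mul_mem_unit (rad_mem k) (rad_mem l)))
    have e3 := abs_le.1 (abs_mul_le_of_unit (hTr hb0)
      (mul_mem_unit ⟨hq0.le, hq1⟩ (tang_mem k l)))
    have e4 := abs_le.1 (abs_mul_le_of_unit (hTr (hb1' k)) (rad_mem l))
    have e5 := abs_le.1 (abs_mul_le_of_unit (hTr (hb1' l)) (rad_mem k))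
    have e6 := abs_le.1 (hXr (hb2' k l))
    have e7 := abs_le.1 (abs_mul_le_of_unit (hdN l) (rad_mem k))
    have e8 := abs_le.1 (abs_mul_le_of_unit (hdN k) (rad_mem l))
    have e9 := abs_le.1 (abs_mul_le_of_unit hφN (mul_mem_unit (rad_mem k) (rad_mem l)))
    have e0 : |W * ((4 * U + 2 * T) * (rad k * rad l) * A + 2 * T * q * tang k l * A
        + 2 * T * (rad l * b1 k + rad k * b1 l) + X0 * b2 k l)| ≤ 21 * (r ^ 2 * C) * N := by
      refine hWmul (abs_le.2 ⟨?_, ?_⟩)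
      · linarith only [e1.1, e2.1, e3.1, e4.1, e5.1, e6.1]
      · linarith only [e1.2, e2.2, e3.2, e4.2, e5.2, e6.2]
    have e0' := abs_le.1 e0
    have hz : 0 ≤ r ^ 2 * C * N := by positivity
    have hDN : D * N = 40 * (r ^ 2 * C * N) := by rw [hD]; ring
    rw [hDN]
    refine abs_le.2 ⟨?_, ?_⟩
    · linarith only [e0'.1, e7.1, e8.1, e9.1, hz]
    · linarith only [e0'.2, e7.2, e8.2, e9.2, hz]
  set p' : Fin (m + 1) → ℝ := fun k => d k + 2 * φ * rad k with hp'
  have hz : 0 ≤ r ^ 2 * C * N := by positivity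
  have hDN : D * N = 40 * (r ^ 2 * C * N) := by rw [hD]; ring
  have hφD : |φ| ≤ D * N := by linarith only [hφN, hDN, hz]
  have hdD : ∀ k, |d k| ≤ D * N := fun k => by linarith only [hdN k, hDN, hz]
  have hp'N : ∀ k, |p' k| ≤ D * N := by
    intro k
    have e1 := abs_le.1 (abs_mul_le_of_unit hφN (rad_mem k))
    have e2 := abs_le.1 (hdN k)
    rw [hDN]
    exact abs_le.2 ⟨by linarith only [e1.1, e2.1, hz], by linarith only [e1.2, e2.2, hz]⟩
  have hrest : ‖bumpRest q φ d‖ ≤ 10 * q * (D * N) := norm_bumpRest_le hq0.le hq1 hφD hdD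
  have hmain : ‖radJet φ p' P'‖ ≤ D * N := norm_radJet_le hφD hp'N hP'N
  refine ⟨radJet φ p' P' + bumpRest q φ d, 4 * (W * X2 * A), ?_, ?_, ?_⟩
  · rw [hjet]
    have : ∀ (x y z w : Jet (m + 1)), x = z + w → x + y = z + y + w := by
      rintro x y z w rfl; abel
    refine this _ _ _ _ ?_
    simp only [radJet, Prod.mk_add_mk, add_zero]
    congr 2
    ext k l u v
    simp only [Pi.add_apply, hP, hP']
    ring
  · have : 10 * q * (D * N) ≤ 10 * (D * N) := by
      have : 0 ≤ D * N := by positivity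
      nlinarith only [this, hq1]
    refine (norm_add_le _ _).trans ((add_le_add hmain (hrest.trans this)).trans ?_)
    have : 0 ≤ (F * (10 * D) + m * (3 * r ^ 2 * C)) * N := by positivity
    linarith only [this]
  · have hl := (fderiv ℝ jetCurv (hypJet m 0)).le_opNorm (bumpRest q φ d)
    rw [map_add, fderiv_jetCurv_radJet]
    have hs : |∑ k : Fin m, P' k.succ k.succ| ≤ m * (3 * r ^ 2 * C * (q * N)) := by
      refine (Finset.abs_sum_le_sum_abs _ _).trans ?_
      have : ∀ k : Fin m, |P' k.succ k.succ| ≤ 3 * r ^ 2 * C * (q * N) := by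
        intro k
        simp only [hP', rad_succ, tang_succ, mul_zero, zero_mul, add_zero, zero_add, if_true,
          mul_one]
        have e1 := abs_le.1 (hTr hb0)
        have e2 : |X0 * b2 k.succ k.succ| ≤ q * (r ^ 2 * S * C) := by
          rw [abs_mul]
          calc _ ≤ (r ^ 2 * S) * (C * q) :=
                mul_le_mul (hX0S.trans h1S) (hb2s k) (abs_nonneg _) (by positivity)
            _ = _ := by ring
        have e2 := abs_le.1 e2
        have e3 : |2 * T * q * A + X0 * b2 k.succ k.succ| ≤ 3 * (q * (r ^ 2 * S * C)) := by
          refine abs_le.2 ⟨?_, ?_⟩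
          · linarith only [e2.1, mul_le_mul_of_nonneg_left e1.1 hq0.le]
          · linarith only [e2.2, mul_le_mul_of_nonneg_left e1.2 hq0.le]
        rw [abs_mul, abs_of_pos hWp]
        refine (mul_le_mul_of_nonneg_left e3 hWp.le).trans (le_of_eq ?_)
        rw [hN]; ring
      refine (Finset.sum_le_sum fun k _ => this k).trans ?_
      simp
    -- The cancellation at the heart of the construction: of the radial terms of the linearised
    -- curvature only the one with `X1 = q X'` survives, namely `-2 m W A X1`.
    have hlin : (m : ℝ) * (m - 1) * φ - m * p' 0 + 2 * m * W * A * X1 = 0 := by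
      simp only [hp', hd, hb10, rad_zero]
      rw [hφ, hT, ← hp2]
      ring
    have hF' : |fderiv ℝ jetCurv (hypJet m 0) (bumpRest q φ d)| ≤ F * (10 * q * (D * N)) := by
      rw [← Real.norm_eq_abs]
      exact hl.trans (mul_le_mul_of_nonneg_left hrest hF0)
    have hz' : 0 ≤ D * (q * N) := by positivity
    have e1 := abs_le.1 hs
    have e2 := abs_le.1 hF'
    refine abs_le.2 ⟨?_, ?_⟩
    · linarith only [e1.2, e2.1, hlin, hz']
    · linarith only [e1.1, e2.2, hlin, hz']

end CurvatureEstimate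

/-! ### From the linearised to the actual change of curvature -/

section CurvatureEstimate

variable {m : ℕ}

lemma exists_norm_hypJet_sub_le (m : ℕ) : ∃ C : ℝ, 0 < C ∧ ∃ r : ℝ, 0 < r ∧ ∀ q : ℝ, 0 ≤ q → q < r →
    ‖hypJet m q - hypJet m 0‖ ≤ C * q := by
  have hc : ContDiff ℝ 1 (hypJet m) := by
    unfold hypJet
    refine ContDiff.prodMk ?_ (ContDiff.prodMk ?_ ?_)
    · fun_prop
    · unfold hypB; fun_prop
    · unfold hypD; fun_prop
  obtain ⟨K, t, ht, hK⟩ := hc.contDiffAt (x := 0) |>.exists_lipschitzOnWith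
  obtain ⟨r, hr, hball⟩ := Metric.mem_nhds_iff.1 ht
  refine ⟨K + 1, by positivity, r, hr, fun q hq hqr => ?_⟩
  have hq' : q ∈ Metric.ball (0 : ℝ) r := by simpa [abs_of_nonneg hq] using hqr
  have := hK.norm_sub_le (hball hq') (hball (Metric.mem_ball_self hr))
  rw [sub_zero, Real.norm_eq_abs, abs_of_nonneg hq] at this
  linarith

/-- The change of the scalar curvature caused by a radial perturbation of an asymptotically
hyperbolic metric. -/
theorem exists_scalarCurvature_add_radialBump_bound (hm : 1 ≤ m) {a : E (m + 1) → ℝ}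
    (ha : ContDiffOn ℝ 2 (fun y => a (angle y)) {0}ᶜ) (C₁ B : ℝ) :
    ∃ C : ℝ, 0 < C ∧ ∃ ρ : ℝ, 0 < ρ ∧ ρ < 1 ∧
      ∀ (G : E (m + 1) → Matrix (Fin (m + 1)) (Fin (m + 1)) ℝ) (X : ℝ → ℝ) (y : E (m + 1)) (S : ℝ),
      y ≠ 0 → ‖y‖ < ρ → (∀ i j, ContDiffAt ℝ 2 (fun z => G z i j) y) →
      (∀ᶠ z in 𝓝 y, (G z).IsSymm) →
      normC2 hyperbolicMetric (deviation G) y ≤ C₁ * ‖y‖ ^ (m + 1) →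
      ContDiff ℝ ∞ X → 0 ≤ X (‖y‖ ^ 2) →
      S = X (‖y‖ ^ 2) + |‖y‖ ^ 2 * deriv X (‖y‖ ^ 2)| → S ≤ B →
      |scalarCurvature (fun z => G z + radialBump a X z) y - scalarCurvature G y
        + 2 * m * ‖y‖ ^ (m + 1) * a (angle y) * (‖y‖ ^ 2 * deriv X (‖y‖ ^ 2))|
        ≤ C * ‖y‖ ^ 2 * (‖y‖ ^ (m + 1) * S) := by
  obtain ⟨C₂, hC₂, hjet⟩ := exists_bump_jet_bound hm ha
  obtain ⟨K, hK, hdev⟩ := frameJet_deviation_le m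
  obtain ⟨C₃, hC₃, r₃, hr₃, hhyp⟩ := exists_norm_hypJet_sub_le m
  obtain ⟨K₂, hK₂, r₂, hr₂, hsec⟩ := exists_second_order_bound
    (contDiffAt_jetCurv (det_hypJet (m := m)))
  have hdet : ∃ r > 0, ∀ J : Jet (m + 1), ‖J - hypJet m 0‖ < r → (Matrix.of J.1).det ≠ 0 := by
    have hc : ContinuousAt (fun J : Jet (m + 1) => (Matrix.of J.1).det) (hypJet m 0) := by
      refine (contDiffAt_det (m := 0) fun i j => ?_).continuousAt
      simp only [Matrix.of_apply]
      fun_prop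
    obtain ⟨r, hr, h⟩ := Metric.mem_nhds_iff.1 (hc.eventually_ne det_hypJet)
    exact ⟨r, hr, fun J hJ => h (by rwa [Metric.mem_ball, dist_eq_norm])⟩
  obtain ⟨r₄, hr₄, hdet⟩ := hdet
  -- In units of `q`, this bounds the distance from the jet of `g` to the limiting hyperbolic jet
  -- plus the size of the perturbation: reference metric, deviation, perturbation.
  set D : ℝ := C₃ + K * |C₁| + C₂ * |B| + 1 with hD
  have hD0 : 0 < D := by positivity
  -- For `‖y‖ < ρ` both jets lie where the second-order expansion of `jetCurv` is valid and where
  -- the metric is nondegenerate.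
  obtain ⟨ρ, hρ0, hρ1, hρ2, hρ3, hρ4⟩ : ∃ ρ : ℝ, 0 < ρ ∧ ρ < 1 ∧ ρ < r₃ ∧ D * ρ < r₂ ∧ D * ρ < r₄ := by
    have h2 : 0 < r₂ / D := by positivity
    have h4 : 0 < r₄ / D := by positivity
    obtain ⟨ρ, h0, h⟩ := exists_between (show 0 < min (min 1 r₃) (min (r₂ / D) (r₄ / D)) by positivity)
    simp only [lt_min_iff] at h
    refine ⟨ρ, h0, h.1.1, h.1.2, ?_, ?_⟩
    · have := (lt_div_iff₀ hD0).1 h.2.1; linarith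
    · have := (lt_div_iff₀ hD0).1 h.2.2; linarith
  refine ⟨K₂ * C₂ * D + C₂, by positivity, ρ, hρ0, hρ1, ?_⟩
  intro G X y S hy hyρ hG hs hN hX hX0 hS hSB
  have hy' : 0 < ‖y‖ := norm_pos_iff.2 hy
  have hy1 : ‖y‖ < 1 := hyρ.trans hρ1
  obtain ⟨e, he⟩ := exists_isAdapted hy
  obtain ⟨δ, s, hδ, hδn, hδl⟩ := hjet X y e S hX hy hy1 he hX0 hS
  have hdev := hdev G y e _ hy hy1 he hG hN
  set q := ‖y‖ ^ 2 with hq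
  set W := ‖y‖ ^ (m + 1) with hW
  have hq0 : 0 < q := by positivity
  have hqy : q ≤ ‖y‖ := by rw [hq]; nlinarith
  have hS0 : 0 ≤ S := by rw [hS]; positivity
  -- As `m + 1 ≥ 2`, the decay `xⁿ` of `λ` and of the perturbation is no worse than the `O(x²)`
  -- deviation of the reference metric from its limit.
  have hWq : W ≤ q := pow_le_pow_of_le_one hy'.le hy1.le (by omega)
  have hW0 : 0 < W := by positivity
  have hsplit : frameJet (fun z => bilOf (G z)) y e
      = hypJet m q + frameJet (fun z => bilOf (G z - hyperbolicMetric z)) y e := by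
    rw [← frameJet_hyperbolicMetric hy he, ← frameJet_add
      (H := fun z => G z - hyperbolicMetric z) (fun i j => contDiffAt_hyperbolicMetric hy i j)
      (fun i j => (hG i j).sub (contDiffAt_hyperbolicMetric hy i j))]
    simp only [add_sub_cancel]
  set J := frameJet (fun z => bilOf (G z)) y e with hJ
  have hac : ContDiffAt ℝ 2 (fun y => a (angle y)) y :=
    ha.contDiffAt (isOpen_compl_singleton.mem_nhds hy)
  have hbump := fun i j => contDiffAt_radialBump hy hac (hX.of_le (WithTop.coe_le_coe.2
    (le_top : (2 : ℕ∞) ≤ ⊤))).contDiffAt i j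
  have hJ' : frameJet (fun z => bilOf (G z + radialBump a X z)) y e
      = J + δ + (0, 0, fun k l u v => s * (rad k * rad l * rad u * rad v)) := by
    rw [frameJet_add hG hbump, hδ, add_assoc]
  have hJn : ‖J - hypJet m 0‖ ≤ (C₃ + K * |C₁|) * q := by
    have e1 := hhyp q hq0.le (by linarith)
    have e2 : K * (C₁ * W) ≤ K * (|C₁| * q) := by
      gcongr
      exact le_abs_self _
    rw [hsplit, add_sub_right_comm]
    refine (norm_add_le _ _).trans ?_
    linarith
  have hδn' : ‖δ‖ ≤ C₂ * |B| * q := by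
    refine hδn.trans ?_
    rw [mul_assoc]
    refine mul_le_mul_of_nonneg_left ?_ hC₂.le
    rw [mul_comm |B|]
    exact mul_le_mul hWq (hSB.trans (le_abs_self _)) hS0 hq0.le
  have hsum : ‖J - hypJet m 0‖ + ‖δ‖ ≤ D * q := by rw [hD]; linarith
  have hDq : D * q ≤ D * ρ := mul_le_mul_of_nonneg_left (hqy.trans hyρ.le) hD0.le
  have hd1 : (Matrix.of J.1).det ≠ 0 := hdet J (by linarith [norm_nonneg δ])
  have hd2 : (Matrix.of (J + δ + (0, 0, fun k l u v =>
      s * (rad k * rad l * rad u * rad v)) : Jet (m + 1)).1).det ≠ 0 := by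
    have : (J + δ + (0, 0, fun k l u v => s * (rad k * rad l * rad u * rad v)) : Jet (m + 1)).1
      = (J + δ).1 := by simp
    rw [this]
    refine hdet _ ?_
    rw [add_sub_right_comm]
    exact (norm_add_le _ _).trans_lt (by linarith)
  rw [scalarCurvature_eq_jetCurv hG hs e hd1, scalarCurvature_eq_jetCurv
    (G := fun z => G z + radialBump a X z) (fun i j => (hG i j).add (hbump i j)) (hs.mono fun z hz => hz.add (radialBump_isSymm a X z)) e
    (by rw [hJ']; exact hd2), hJ', jetCurv_add_radial]
  have hsec := hsec J δ (by linarith [norm_nonneg δ]) (by linarith [norm_nonneg (J - hypJet m 0)])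
  -- The nonlinear error is the size `W S` of the perturbation times the distance `O(q)` from the
  -- limiting jet, the same order as the error in the linear term.
  have hfin : K₂ * ‖δ‖ * (‖J - hypJet m 0‖ + ‖δ‖) ≤ K₂ * (C₂ * (W * S)) * (D * q) := by
    gcongr
  have e1 := abs_le.1 (hsec.trans hfin)
  have e2 := abs_le.1 hδl
  refine abs_le.2 ⟨?_, ?_⟩
  · linarith only [e1.1, e2.1]
  · linarith only [e1.2, e2.2]

end CurvatureEstimate

/-! ### The cutoff function -/

section Cutoff

/-- A function of `t = x²` which equals `exp (-K t)` for `t ≤ ε²` and vanishes for `t ≥ 2 ε²`. -/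
def radialCutoff (K ε t : ℝ) : ℝ := Real.exp (-(K * t)) * Real.smoothTransition (2 - t / ε ^ 2)

variable {K ε t : ℝ}

lemma contDiff_radialCutoff {k : ℕ∞} : ContDiff ℝ k (radialCutoff K ε) := by
  unfold radialCutoff
  exact (Real.contDiff_exp.comp (by fun_prop)).mul
    (Real.smoothTransition.contDiff.comp (by fun_prop))

lemma radialCutoff_nonneg : 0 ≤ radialCutoff K ε t :=
  mul_nonneg (Real.exp_pos _).le (Real.smoothTransition.nonneg _)

lemma radialCutoff_le_one (hK : 0 ≤ K) (ht : 0 ≤ t) : radialCutoff K ε t ≤ 1 :=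
  mul_le_one₀ (Real.exp_le_one_iff.2 (by nlinarith [mul_nonneg hK ht])) (Real.smoothTransition.nonneg _)
    (Real.smoothTransition.le_one _)

lemma radialCutoff_of_le (hε : 0 < ε) (ht : t ≤ ε ^ 2) :
    radialCutoff K ε t = Real.exp (-(K * t)) := by
  rw [radialCutoff, Real.smoothTransition.one_of_one_le, mul_one]
  have : t / ε ^ 2 ≤ 1 := (div_le_one (by positivity)).2 ht
  linarith

lemma radialCutoff_of_ge (hε : 0 < ε) (ht : 2 * ε ^ 2 ≤ t) : radialCutoff K ε t = 0 := by
  rw [radialCutoff, Real.smoothTransition.zero_of_nonpos, mul_zero]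
  have : 2 ≤ t / ε ^ 2 := (le_div_iff₀ (by positivity)).2 ht
  linarith

lemma exists_deriv_smoothTransition_bound : ∃ M : ℝ, 0 < M ∧ ∀ s : ℝ,
    0 ≤ deriv Real.smoothTransition s ∧ deriv Real.smoothTransition s ≤ M ∧
    (s < 0 → deriv Real.smoothTransition s = 0) := by
  have hneg : ∀ s : ℝ, s < 0 → deriv Real.smoothTransition s = 0 := by
    intro s hs
    have : Real.smoothTransition =ᶠ[𝓝 s] fun _ => 0 := by
      filter_upwards [gt_mem_nhds hs] with t ht using Real.smoothTransition.zero_of_nonpos ht.le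
    rw [this.deriv_eq]; simp
  have hpos : ∀ s : ℝ, 1 < s → deriv Real.smoothTransition s = 0 := by
    intro s hs
    have : Real.smoothTransition =ᶠ[𝓝 s] fun _ => 1 := by
      filter_upwards [lt_mem_nhds hs] with t ht using Real.smoothTransition.one_of_one_le ht.le
    rw [this.deriv_eq]; simp
  have hc : Continuous (deriv Real.smoothTransition) :=
    (Real.smoothTransition.contDiff (n := 1)).continuous_deriv le_rfl
  obtain ⟨M, hM⟩ := isCompact_Icc.exists_bound_of_continuousOn (s := Set.Icc (0 : ℝ) 1) hc.continuousOn
  refine ⟨|M| + 1, by positivity, fun s => ⟨Real.smoothTransition.monotone.deriv_nonneg, ?_, hneg s⟩⟩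
  rcases lt_or_ge s 0 with h | h
  · rw [hneg s h]; positivity
  rcases lt_or_ge 1 s with h' | h'
  · rw [hpos s h']; positivity
  have := (le_abs_self _).trans (hM s ⟨h, h'⟩)
  linarith [le_abs_self M]

lemma deriv_radialCutoff : deriv (radialCutoff K ε) t
    = -(K * radialCutoff K ε t
      + Real.exp (-(K * t)) * (deriv Real.smoothTransition (2 - t / ε ^ 2) / ε ^ 2)) := by
  have h1 : HasDerivAt (fun t : ℝ => Real.exp (-(K * t))) (Real.exp (-(K * t)) * -(K * 1)) t :=
    ((hasDerivAt_id t).const_mul K).neg.exp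
  have h2 : HasDerivAt Real.smoothTransition (deriv Real.smoothTransition (2 - t / ε ^ 2))
      (2 - t / ε ^ 2) :=
    ((Real.smoothTransition.contDiff (n := 1)).differentiable (by norm_num) _).hasDerivAt
  have h3 : HasDerivAt (fun t : ℝ => Real.smoothTransition (2 - t / ε ^ 2))
      (deriv Real.smoothTransition (2 - t / ε ^ 2) * -(1 / ε ^ 2)) t :=
    HasDerivAt.comp (h := fun t : ℝ => 2 - t / ε ^ 2) t h2 (((hasDerivAt_id' t).div_const (ε ^ 2)).const_sub 2)
  have := (h1.fun_mul h3).deriv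
  unfold radialCutoff
  rw [this]; ring

/-- The bounds for `t X'(t)`. -/
lemma exists_radialCutoff_bound : ∃ M : ℝ, 0 < M ∧ ∀ K ε t : ℝ, 0 ≤ K → 0 < ε → 0 ≤ t →
    K * t * radialCutoff K ε t ≤ -(t * deriv (radialCutoff K ε) t) ∧
    -(t * deriv (radialCutoff K ε) t) ≤ K * t + M ∧
    -(t * deriv (radialCutoff K ε) t) ≤ (K + M / ε ^ 2) * t := by
  obtain ⟨M, hM, hb⟩ := exists_deriv_smoothTransition_bound
  refine ⟨2 * M, by positivity, fun K ε t hK hε ht => ?_⟩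
  obtain ⟨h0, h1, h2⟩ := hb (2 - t / ε ^ 2)
  set η := deriv Real.smoothTransition (2 - t / ε ^ 2)
  have hE0 : 0 < Real.exp (-(K * t)) := Real.exp_pos _
  have hE1 : Real.exp (-(K * t)) ≤ 1 := Real.exp_le_one_iff.2 (by nlinarith [mul_nonneg hK ht])
  have hX1 := radialCutoff_le_one (ε := ε) hK ht
  have hε2 : 0 < ε ^ 2 := by positivity
  have e : -(t * deriv (radialCutoff K ε) t)
      = K * t * radialCutoff K ε t + Real.exp (-(K * t)) * (t / ε ^ 2 * η) := by
    rw [deriv_radialCutoff]; ring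
  have hη : 0 ≤ t / ε ^ 2 * η := by positivity
  have hKt : K * t * radialCutoff K ε t ≤ K * t := mul_le_of_le_one_right (by positivity) hX1
  have hEη : Real.exp (-(K * t)) * (t / ε ^ 2 * η) ≤ t / ε ^ 2 * η := mul_le_of_le_one_left hη hE1
  rw [e]
  refine ⟨by linarith [mul_nonneg hE0.le hη], ?_, ?_⟩
  -- The derivative of the transition vanishes for `t > 2 ε²`, so `t / ε²` may be replaced by `2`
  -- and this bound is free of `ε`. The last bound of the lemma depends on `ε` but is linear in `t`;
  -- it provides the order `xⁿ⁺²`.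
  · have : t / ε ^ 2 * η ≤ 2 * M := by
      rcases lt_or_ge (2 - t / ε ^ 2) 0 with h | h
      · rw [h2 h]; simp; positivity
      · exact mul_le_mul (by linarith) h1 h0 (by norm_num)
    linarith
  · have : t / ε ^ 2 * η ≤ t / ε ^ 2 * (2 * M) := by gcongr; linarith
    have e2 : (K + 2 * M / ε ^ 2) * t = K * t + t / ε ^ 2 * (2 * M) := by ring
    linarith

variable {m : ℕ}

lemma exists_bounds_sphere {s : E (m + 1) → ℝ} (hs : ContinuousOn (fun y => s (angle y)) {0}ᶜ)
    (hpos : ∀ y : E (m + 1), y ≠ 0 → 0 < s (angle y)) :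
    ∃ c C : ℝ, 0 < c ∧ ∀ y : E (m + 1), y ≠ 0 → c ≤ s (angle y) ∧ s (angle y) ≤ C := by
  have hsub : Metric.sphere (0 : E (m + 1)) 1 ⊆ {0}ᶜ := by
    rintro y hy rfl; simp at hy
  have hne : (Metric.sphere (0 : E (m + 1)) 1).Nonempty := NormedSpace.sphere_nonempty.2 zero_le_one
  obtain ⟨y₁, h₁, hmin⟩ := (isCompact_sphere (0 : E (m + 1)) 1).exists_isMinOn hne (hs.mono hsub)
  obtain ⟨y₂, h₂, hmax⟩ := (isCompact_sphere (0 : E (m + 1)) 1).exists_isMaxOn hne (hs.mono hsub)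
  refine ⟨s (angle y₁), s (angle y₂), hpos _ (hsub h₁), fun y hy => ?_⟩
  have hmem : angle y ∈ Metric.sphere (0 : E (m + 1)) 1 := by simp [norm_angle hy]
  have e : angle (angle y) = angle y := angle_of_norm_one (norm_angle hy)
  have m1 := hmin hmem
  have m2 := hmax hmem
  simp only [Set.mem_ofPred_eq, e] at m1 m2
  exact ⟨m1, m2⟩

/-- With a suitable cutoff, a positive radial perturbation does not decrease the scalar curvature. -/
theorem exists_radialCutoff_scalarCurvature (hm : 1 ≤ m) {a : E (m + 1) → ℝ}
    (ha : ContDiffOn ℝ 2 (fun y => a (angle y)) {0}ᶜ)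
    (hpos : ∀ y : E (m + 1), y ≠ 0 → 0 < a (angle y)) (C₁ : ℝ) :
    ∃ K ρ : ℝ, 0 ≤ K ∧ 0 < ρ ∧ ∀ ε : ℝ, 0 < ε → ∃ C : ℝ, 0 ≤ C ∧
      ∀ (G : E (m + 1) → Matrix (Fin (m + 1)) (Fin (m + 1)) ℝ) (y : E (m + 1)),
      y ≠ 0 → ‖y‖ < ρ → (∀ i j, ContDiffAt ℝ 2 (fun z => G z i j) y) →
      (∀ᶠ z in 𝓝 y, (G z).IsSymm) →
      normC2 hyperbolicMetric (deviation G) y ≤ C₁ * ‖y‖ ^ (m + 1) →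
      0 ≤ scalarCurvature (fun z => G z + radialBump a (radialCutoff K ε) z) y
        - scalarCurvature G y ∧
      scalarCurvature (fun z => G z + radialBump a (radialCutoff K ε) z) y
        - scalarCurvature G y ≤ C * ‖y‖ ^ (m + 1 + 2) := by
  obtain ⟨M, hM, hcut⟩ := exists_radialCutoff_bound
  obtain ⟨c, C₀, hc, hcb⟩ := exists_bounds_sphere ha.continuousOn hpos
  obtain ⟨C, hC, ρ, hρ, hρ1, hmain⟩ :=
    exists_scalarCurvature_add_radialBump_bound hm ha C₁ (2 + M)
  have hm' : (1 : ℝ) ≤ m := by exact_mod_cast hm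
  -- `C` is the error constant and `c` the minimum of `a`. The choice `K c = C` lets the decay of
  -- `exp (-K t)` compensate the error term `C q X`. Here `C` was obtained for the bound `S ≤ 2 +
  -- M`, which involves neither `K` nor `ε`.
  set K := C / c with hK
  have hK0 : 0 < K := by positivity
  have hKc : K * c = C := by rw [hK]; field_simp
  have hC₀ : 0 ≤ C₀ := by
    obtain ⟨y, hy⟩ := exists_ne (0 : E (m + 1))
    exact hc.le.trans ((hcb y hy).1.trans (hcb y hy).2)
  -- The restrictions `‖y‖ < 1` and `‖y‖ < K⁻¹` guarantee `K q ≤ 1`.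
  refine ⟨K, min ρ (min 1 K⁻¹), hK0.le, by positivity, fun ε hε =>
    ⟨2 * m * C₀ * (K + M / ε ^ 2) + C * (2 + M), by positivity, ?_⟩⟩
  intro G y hy hyρ hG hs hN
  have hy' : 0 < ‖y‖ := norm_pos_iff.2 hy
  simp only [lt_min_iff] at hyρ
  obtain ⟨hyρ, hy1, hyK⟩ := hyρ
  set X := radialCutoff K ε with hX
  set q := ‖y‖ ^ 2 with hq
  have hq0 : 0 ≤ q := by positivity
  have hKq : K * q ≤ 1 := by
    have e1 : q ≤ K⁻¹ := by rw [hq]; nlinarith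
    calc K * q ≤ K * K⁻¹ := by gcongr
      _ = 1 := mul_inv_cancel₀ hK0.ne'
  obtain ⟨c1, c2, c3⟩ := hcut K ε q hK0.le hε hq0
  set u := -(q * deriv X q) with hu
  have hX0 : 0 ≤ X q := radialCutoff_nonneg
  have hX1 : X q ≤ 1 := radialCutoff_le_one hK0.le hq0
  have hu0 : 0 ≤ u := le_trans (by positivity) c1
  have hSu : X q + |q * deriv X q| = X q + u := by
    rw [← abs_neg, ← hu, abs_of_nonneg hu0]
  have hSB : X q + u ≤ 2 + M := by linarith
  have hmain := hmain G X y (X q + u) hy hyρ hG hs hN contDiff_radialCutoff hX0 hSu.symm hSB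
  set W := ‖y‖ ^ (m + 1) with hW
  have hW0 : 0 < W := by positivity
  obtain ⟨a1, a2⟩ := hcb y hy
  have hux : q * deriv X q = -u := by rw [hu]; ring
  rw [← hq, hux] at hmain
  obtain ⟨b1, b2⟩ := abs_le.1 hmain
  constructor
  -- The main term `2 m a u` contains two copies of `c u`: one absorbs `C q X`, by `K q X ≤ u`, and
  -- the other absorbs `C q u`, by `K q ≤ 1`.
  · have e1 : c * u ≤ m * a (angle y) * u := by
      refine mul_le_mul_of_nonneg_right ?_ hu0
      nlinarith
    have e2 : C * q * X q ≤ c * u := by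
      rw [← hKc]
      nlinarith
    have e3 : C * q * u ≤ c * u := by
      rw [← hKc]
      have : K * c * q * u = (K * q) * (c * u) := by ring
      rw [this]
      exact mul_le_of_le_one_left (by positivity) hKq
    have e4 : 0 ≤ W * (2 * (m * a (angle y) * u) - C * q * X q - C * q * u) :=
      mul_nonneg hW0.le (by linarith)
    nlinarith only [e4, b1]
  · have e1 : 2 * m * W * a (angle y) * u ≤ 2 * m * W * C₀ * ((K + M / ε ^ 2) * q) := by
      gcongr
    have e2 : C * q * (W * (X q + u)) ≤ C * q * (W * (2 + M)) := by gcongr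
    have e3 : ‖y‖ ^ (m + 1 + 2) = W * q := by rw [hW, hq]; ring
    rw [e3]
    nlinarith only [e1, e2, b2]

end Cutoff

/-! ### Perturbations of Riemannian metrics -/

section Manifold

variable {n : ℕ} {M : Type*} [TopologicalSpace M] [ChartedSpace (E n) M]

/-- The differential of a function. -/
def differential (x : M → ℝ) (p : M) : TangentSpace 𝓘(ℝ, E n) p →L[ℝ] ℝ :=
  mfderiv 𝓘(ℝ, E n) 𝓘(ℝ, ℝ) x p

/-- The bilinear form `b dx²` on the tangent spaces. -/
def sqForm (b x : M → ℝ) (p : M) :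
    TangentSpace 𝓘(ℝ, E n) p →L[ℝ] TangentSpace 𝓘(ℝ, E n) p →L[ℝ] ℝ :=
  b p • (differential x p).smulRight (differential x p)

lemma sqForm_apply (b x : M → ℝ) (p : M) (v w : TangentSpace 𝓘(ℝ, E n) p) :
    sqForm b x p v w = b p * (differential x p v * differential x p w) := by
  simp [sqForm]

variable [IsManifold 𝓘(ℝ, E n) ∞ M] {k : ℕ∞}

/-- In the trivialisation at `p` the form reads `b • η ⊗ η`, with `η` the coordinate expression of
the differential of `x`; its smoothness is that of `b` and `η`. -/
lemma contMDiffAt_sqForm {b x : M → ℝ} {p : M}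
    (hb : ContMDiffAt 𝓘(ℝ, E n) 𝓘(ℝ, ℝ) ∞ b p) (hx : ContMDiffAt 𝓘(ℝ, E n) 𝓘(ℝ, ℝ) ∞ x p) :
    ContMDiffAt 𝓘(ℝ, E n) (𝓘(ℝ, E n).prod 𝓘(ℝ, E n →L[ℝ] E n →L[ℝ] ℝ)) k
      (fun q => Bundle.TotalSpace.mk' (E n →L[ℝ] E n →L[ℝ] ℝ)
        (E := fun q : M => TangentSpace 𝓘(ℝ, E n) q →L[ℝ] TangentSpace 𝓘(ℝ, E n) q →L[ℝ] ℝ) q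
        (sqForm b x q)) p := by
  rw [contMDiffAt_hom_bundle]
  refine ⟨contMDiffAt_id, ?_⟩
  have hη := hx.mfderiv_const (m := (k : WithTop ℕ∞)) (by
    exact_mod_cast le_top)
  set η := inTangentCoordinates 𝓘(ℝ, E n) 𝓘(ℝ, ℝ) id x (mfderiv 𝓘(ℝ, E n) 𝓘(ℝ, ℝ) x) p with hηd
  have hb' : ContMDiffAt 𝓘(ℝ, E n) 𝓘(ℝ, ℝ) k b p := hb.of_le (by exact_mod_cast le_top)
  have h1 : ContMDiffAt 𝓘(ℝ, E n) 𝓘(ℝ, E n →L[ℝ] E n →L[ℝ] ℝ) k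
      (fun q => b q • ContinuousLinearMap.smulRight (η q) (η q)) p := by
    have hF : ContDiff ℝ k (fun z : ℝ × (E n →L[ℝ] ℝ) => z.1 • z.2.smulRight z.2) := by
      refine contDiff_fst.smul ?_
      exact contDiff_snd.smulRight contDiff_snd
    exact hF.contMDiff.contMDiffAt.comp p (hb'.prodMk_space hη)
  refine h1.congr_of_eventuallyEq ?_
  have hmem := (trivializationAt (E n) (TangentSpace 𝓘(ℝ, E n)) p).open_baseSet.mem_nhds
    (FiberBundle.mem_baseSet_trivializationAt' p)
  filter_upwards [hmem] with q hq
  ext v w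
  rw [inCoordinates_apply_eq₂ hq hq (by simp)]
  simp [sqForm_apply, hηd, inTangentCoordinates, ContinuousLinearMap.inCoordinates, differential]
  left
  have e : ∀ u, (trivializationAt (E n) (TangentSpace 𝓘(ℝ, E n)) p).symm q u
      = (trivializationAt (E n) (TangentSpace 𝓘(ℝ, E n)) p).symmL ℝ q u := fun u =>
    (Bundle.Trivialization.symmL_apply _ hq u).symm
  rw [e, e]
  rfl

/-- The metric `g + b dx²`. -/
def addSqForm (g : RMetric n k M) (b x : M → ℝ) (hb : ∀ p, 0 ≤ b p)
    (hsm : ∀ p, ContMDiffAt 𝓘(ℝ, E n) (𝓘(ℝ, E n).prod 𝓘(ℝ, E n →L[ℝ] E n →L[ℝ] ℝ)) k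
      (fun q => Bundle.TotalSpace.mk' (E n →L[ℝ] E n →L[ℝ] ℝ)
        (E := fun q : M => TangentSpace 𝓘(ℝ, E n) q →L[ℝ] TangentSpace 𝓘(ℝ, E n) q →L[ℝ] ℝ) q
        (sqForm b x q)) p) : RMetric n k M where
  inner p := g.inner p + sqForm b x p
  symm p v w := by
    simp only [add_apply, sqForm_apply, g.symm p v w]; ring
  pos p v hv := by
    simp only [add_apply, sqForm_apply]
    have := g.pos p v hv
    have := mul_nonneg (hb p) (mul_self_nonneg (differential x p v))
    linarith
  -- The unit ball of the larger metric is contained in that of `g`.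
  isVonNBounded p := by
    refine (g.isVonNBounded p).subset fun v hv => ?_
    simp only [Set.mem_ofPred_eq, add_apply, sqForm_apply] at hv ⊢
    have := mul_nonneg (hb p) (mul_self_nonneg (differential x p v))
    linarith
  contMDiff p := (g.contMDiff p).add_section (hsm p)

/-- The components of a metric in a chart are as regular as the metric. -/
lemma contDiffAt_coordMetric (hk : 2 ≤ k) {φ : OpenPartialHomeomorph M (E n)}
    (hφ : φ ∈ IsManifold.maximalAtlas 𝓘(ℝ, E n) ∞ M) (g : RMetric n k M) {y : E n}
    (hy : y ∈ φ.target) (i j : Fin n) :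
    ContDiffAt ℝ 2 (fun z => coordMetric φ g z i j) y := by
  have hs : ContMDiffAt 𝓘(ℝ, E n) 𝓘(ℝ, E n) ∞ φ.symm y := contMDiffAt_symm_of_mem_maximalAtlas hφ hy
  have hv : ∀ u : E n, ContMDiffAt 𝓘(ℝ, E n) (𝓘(ℝ, E n).prod 𝓘(ℝ, E n)) 2
      (fun z => Bundle.TotalSpace.mk' (E n) (E := fun q : M => TangentSpace 𝓘(ℝ, E n) q)
        (φ.symm z) (mfderiv 𝓘(ℝ, E n) 𝓘(ℝ, E n) φ.symm z (u : E n))) y := by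
    intro u
    have h1 := hs.mfderiv_const (m := 2) (by norm_cast)
    have h2 : ContMDiffAt 𝓘(ℝ, E n) (𝓘(ℝ, E n).prod 𝓘(ℝ, E n)) 2
        (fun z : E n => Bundle.TotalSpace.mk' (E n) (E := fun q : E n => TangentSpace 𝓘(ℝ, E n) q)
          z u) y :=
      contMDiffAt_vectorSpace_iff_contDiffAt.2 contDiffAt_const
    have h3 : ContMDiffAt 𝓘(ℝ, E n) 𝓘(ℝ, E n) 2 φ.symm y := hs.of_le (by norm_cast)
    exact ContMDiffAt.clm_apply_of_inCoordinates (F₁ := E n) (F₂ := E n)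
      (E₁ := fun q : E n => TangentSpace 𝓘(ℝ, E n) q) (E₂ := fun q : M => TangentSpace 𝓘(ℝ, E n) q)
      (b₁ := id) (b₂ := φ.symm)
      (ϕ := fun z => mfderiv 𝓘(ℝ, E n) 𝓘(ℝ, E n) φ.symm z) (v := fun z => u) h1 h2 h3
  have hg : ContMDiffAt 𝓘(ℝ, E n) (𝓘(ℝ, E n).prod 𝓘(ℝ, E n →L[ℝ] E n →L[ℝ] ℝ)) 2
      (fun z => Bundle.TotalSpace.mk' (E n →L[ℝ] E n →L[ℝ] ℝ)
        (E := fun q : M => TangentSpace 𝓘(ℝ, E n) q →L[ℝ] TangentSpace 𝓘(ℝ, E n) q →L[ℝ] ℝ)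
        (φ.symm z) (g.inner (φ.symm z))) y :=
    ((g.contMDiff (φ.symm y)).of_le (WithTop.coe_le_coe.2 hk)).comp y (hs.of_le (by norm_cast))
  have h : ContMDiffAt 𝓘(ℝ, E n) (𝓘(ℝ, E n).prod 𝓘(ℝ, ℝ)) 2
      (fun z => Bundle.TotalSpace.mk' ℝ (E := Bundle.Trivial M ℝ) (φ.symm z)
        (coordMetric φ g z i j)) y := by
    apply ContMDiffAt.clm_bundle_apply₂ (F₁ := E n) (F₂ := E n)
    · exact hg
    · exact hv (EuclideanSpace.single i 1)
    · exact hv (EuclideanSpace.single j 1)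
  simp only [Bundle.contMDiffAt_totalSpace] at h
  exact h.2.contDiffAt

end Manifold

/-! ### The perturbation of the metric on the collar -/

section CollarPerturbation

variable {n : ℕ} {M : Type*} [TopologicalSpace M] [ChartedSpace (E n) M]

lemma IsEndChart.mem_target {x₀ : ℝ} {φ : OpenPartialHomeomorph M (E n)}
    (hφ : IsEndChart x₀ φ) {p : M} (hp : p ∈ φ.source) : φ p ≠ 0 ∧ ‖φ p‖ < x₀ := by
  have h := φ.map_source hp
  rw [hφ.target_eq] at h
  exact ⟨norm_pos_iff.1 h.1, h.2⟩

open Classical in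
/-- The coefficient `xⁿ⁻² a(θ) X(x²)` of a radial perturbation, extended by zero outside of the
collar. -/
def collarCoeff (φ : OpenPartialHomeomorph M (E n)) (a : E n → ℝ) (X : ℝ → ℝ) (p : M) : ℝ :=
  if p ∈ φ.source then ‖φ p‖ ^ (n - 2) * a (angle (φ p)) * X (‖φ p‖ ^ 2) else 0

variable [IsManifold 𝓘(ℝ, E n) ∞ M] {k : ℕ∞} {x₀ : ℝ} {φ : OpenPartialHomeomorph M (E n)}

lemma collarCoeff_eq_zero {a : E n → ℝ} {X : ℝ → ℝ} {δ : ℝ} (hX : ∀ t, δ ^ 2 ≤ t → X t = 0)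
    (hδ : 0 ≤ δ) {p : M} (hp : ¬ (p ∈ φ.source ∧ ‖φ p‖ ≤ δ)) : collarCoeff φ a X p = 0 := by
  unfold collarCoeff
  split_ifs with h
  · rw [hX, mul_zero]
    have : δ < ‖φ p‖ := by
      by_contra h'; exact hp ⟨h, not_lt.1 h'⟩
    gcongr
  · rfl

lemma collarCoeff_nonneg (hφ : IsEndChart x₀ φ) {a : E n → ℝ} (ha : ∀ y, y ≠ 0 → 0 < a (angle y))
    {X : ℝ → ℝ} (hX : ∀ t, 0 ≤ X t) (p : M) : 0 ≤ collarCoeff φ a X p := by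
  unfold collarCoeff
  split_ifs with h
  · have := ha _ (hφ.mem_target h).1
    have := hX (‖φ p‖ ^ 2)
    positivity
  · rfl

/-- Inside the collar the form is built from smooth functions of the coordinates. At a point
outside, the set `{x ≤ δ}` being closed in `M` yields a neighbourhood on which the coefficient
vanishes; this is where it matters that the collar is an end. -/
lemma contMDiffAt_sqForm_collarCoeff (hφ : IsEndChart x₀ φ) {a : E n → ℝ}
    (ha : ContDiffOn ℝ ∞ (fun y => a (angle y)) {0}ᶜ) {X : ℝ → ℝ} (hX : ContDiff ℝ ∞ X) {δ : ℝ}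
    (hX0 : ∀ t, δ ^ 2 ≤ t → X t = 0) (hδ : 0 ≤ δ) (hδx : δ < x₀) (p : M) :
    ContMDiffAt 𝓘(ℝ, E n) (𝓘(ℝ, E n).prod 𝓘(ℝ, E n →L[ℝ] E n →L[ℝ] ℝ)) k
      (fun q => Bundle.TotalSpace.mk' (E n →L[ℝ] E n →L[ℝ] ℝ)
        (E := fun q : M => TangentSpace 𝓘(ℝ, E n) q →L[ℝ] TangentSpace 𝓘(ℝ, E n) q →L[ℝ] ℝ) q
        (sqForm (collarCoeff φ a X) (fun q => ‖φ q‖) q)) p := by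
  by_cases hp : p ∈ φ.source
  · have hne := (hφ.mem_target hp).1
    have hφp : ContMDiffAt 𝓘(ℝ, E n) 𝓘(ℝ, E n) ∞ φ p :=
      contMDiffAt_of_mem_maximalAtlas hφ.mem_maximalAtlas hp
    have hN : ContDiffAt ℝ ∞ (fun y : E n => ‖y‖) (φ p) := contDiffAt_norm ℝ hne
    have hac : ContDiffAt ℝ ∞ (fun y => a (angle y)) (φ p) :=
      ha.contDiffAt (isOpen_compl_singleton.mem_nhds hne)
    have hb : ContDiffAt ℝ ∞ (fun y : E n => ‖y‖ ^ (n - 2) * a (angle y) * X (‖y‖ ^ 2)) (φ p) :=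
      ((hN.pow _).mul hac).mul (contDiffAt_radial hX.contDiffAt)
    refine contMDiffAt_sqForm ?_ (hN.contMDiffAt.comp p hφp)
    refine (hb.contMDiffAt.comp p hφp).congr_of_eventuallyEq ?_
    filter_upwards [φ.open_source.mem_nhds hp] with q hq
    simp [collarCoeff, hq]
  · have h0 := contMDiffAt_sqForm (k := k) (n := n) (M := M) (p := p) (b := fun _ => 0)
      (x := fun _ => 0) contMDiffAt_const contMDiffAt_const
    refine h0.congr_of_eventuallyEq ?_
    have hc := (hφ.isClosed δ hδx).isOpen_compl.mem_nhds
      (show p ∈ {p : M | p ∈ φ.source ∧ ‖φ p‖ ≤ δ}ᶜ from fun h => hp h.1)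
    filter_upwards [hc] with q hq
    have : collarCoeff φ a X q = 0 := collarCoeff_eq_zero hX0 hδ hq
    congr 1
    ext v w
    simp only [sqForm_apply, this, zero_mul]

lemma fderiv_norm_apply_single {y : E n} (hy : y ≠ 0) (i : Fin n) :
    fderiv ℝ (fun z : E n => ‖z‖) y (EuclideanSpace.single i 1) = angle y i := by
  have hy' : 0 < ‖y‖ := norm_pos_iff.2 hy
  have h := fderiv_radial (y := y) (A := Real.sqrt)
    (Real.hasDerivAt_sqrt (by positivity : ‖y‖ ^ 2 ≠ 0)) (EuclideanSpace.single i 1)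
  simp only [Real.sqrt_sq (norm_nonneg _)] at h
  rw [h]
  have e : 2 * (1 / (2 * ‖y‖)) = ‖y‖⁻¹ := by field_simp
  rw [e]
  simp [angle, EuclideanSpace.inner_single_right]

lemma differential_norm_chart (hφ : IsEndChart x₀ φ) {y : E n} (hy : y ∈ φ.target) (u : E n) :
    differential (n := n) (fun q => ‖φ q‖) (φ.symm y)
      (mfderiv 𝓘(ℝ, E n) 𝓘(ℝ, E n) φ.symm y u)
      = fderiv ℝ (fun z : E n => ‖z‖) y u := by
  have hne : y ≠ 0 := by
    rw [hφ.target_eq] at hy; exact norm_pos_iff.1 hy.1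
  have hs : MDifferentiableAt 𝓘(ℝ, E n) 𝓘(ℝ, E n) φ.symm y :=
    (contMDiffAt_symm_of_mem_maximalAtlas hφ.mem_maximalAtlas hy).mdifferentiableAt (by simp)
  have hφp : MDifferentiableAt 𝓘(ℝ, E n) 𝓘(ℝ, E n) φ (φ.symm y) :=
    (contMDiffAt_of_mem_maximalAtlas hφ.mem_maximalAtlas (φ.map_target hy)).mdifferentiableAt
      (by simp)
  have hN : MDifferentiableAt 𝓘(ℝ, E n) 𝓘(ℝ, ℝ) (fun z : E n => ‖z‖) (φ (φ.symm y)) := by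
    rw [φ.right_inv hy]
    exact ((contDiffAt_norm ℝ hne (n := 1)).differentiableAt (by norm_num)).mdifferentiableAt
  have hx : MDifferentiableAt 𝓘(ℝ, E n) 𝓘(ℝ, ℝ) (fun q => ‖φ q‖) (φ.symm y) :=
    MDifferentiableAt.comp (φ.symm y) hN hφp
  have h := mfderiv_comp y hx hs
  have hev : (fun q => ‖φ q‖) ∘ φ.symm =ᶠ[𝓝 y] fun z : E n => ‖z‖ := by
    filter_upwards [φ.open_target.mem_nhds hy] with z hz
    simp [φ.right_inv hz]
  rw [hev.mfderiv_eq, mfderiv_eq_fderiv] at h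
  exact (DFunLike.congr_fun h u).symm

/-- The metric `g + xⁿ⁻² a(θ) X(x²) dx²`. -/
def collarPerturbation (g : RMetric n k M) (hφ : IsEndChart x₀ φ) {a : E n → ℝ}
    (ha : ContDiffOn ℝ ∞ (fun y => a (angle y)) {0}ᶜ) (ha0 : ∀ y, y ≠ 0 → 0 < a (angle y))
    {X : ℝ → ℝ} (hX : ContDiff ℝ ∞ X) (hX0 : ∀ t, 0 ≤ X t) {δ : ℝ}
    (hXδ : ∀ t, δ ^ 2 ≤ t → X t = 0) (hδ : 0 ≤ δ) (hδx : δ < x₀) : RMetric n k M :=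
  addSqForm g (collarCoeff φ a X) (fun q => ‖φ q‖) (collarCoeff_nonneg hφ ha0 hX0)
    (contMDiffAt_sqForm_collarCoeff hφ ha hX hXδ hδ hδx)

/-- A perturbation supported near infinity, by a multiple of `dx²`. -/
lemma exists_collarPerturbation (g : RMetric n k M) (hφ : IsEndChart x₀ φ) {a : E n → ℝ}
    (ha : ContDiffOn ℝ ∞ (fun y => a (angle y)) {0}ᶜ) (ha0 : ∀ y, y ≠ 0 → 0 < a (angle y))
    {X : ℝ → ℝ} (hX : ContDiff ℝ ∞ X) (hX0 : ∀ t, 0 ≤ X t) {δ : ℝ}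
    (hXδ : ∀ t, δ ^ 2 ≤ t → X t = 0) (hδ : 0 ≤ δ) (hδx : δ < x₀) :
    ∃ g' : RMetric n k M, (∀ p, ¬ (p ∈ φ.source ∧ ‖φ p‖ ≤ δ) → g'.inner p = g.inner p) ∧
      ∀ y ∈ collar n x₀, coordMetric φ g' y = coordMetric φ g y + radialBump a X y := by
  refine ⟨collarPerturbation g hφ ha ha0 hX hX0 hXδ hδ hδx, fun p hp => ?_, fun y hy => ?_⟩
  · have h := collarCoeff_eq_zero (a := a) hXδ hδ hp
    ext v w
    simp only [collarPerturbation, addSqForm, add_apply, sqForm_apply, h, zero_mul, add_zero]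
  · have hne : y ≠ 0 := norm_pos_iff.1 hy.1
    rw [← hφ.target_eq] at hy
    ext i j
    simp only [coordMetric, Matrix.of_apply, Matrix.add_apply, collarPerturbation, addSqForm,
      add_apply, sqForm_apply, differential_norm_chart hφ hy, fderiv_norm_apply_single hne,
      collarCoeff, φ.map_target hy, if_true, φ.right_inv hy, radialBump, Matrix.smul_apply, dxSq,
      smul_eq_mul]

lemma coordMetric_isSymm (φ : OpenPartialHomeomorph M (E n)) (g : RMetric n k M) (y : E n) :
    (coordMetric φ g y).IsSymm := by
  ext i j
  simp only [Matrix.transpose_apply, coordMetric, Matrix.of_apply]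
  exact g.symm _ _ _

end CollarPerturbation

/-! ### Radial changes of coordinates -/

section RadialMap

variable {n : ℕ} {ψ : E n → ℝ}

/-- The function `xⁿ ψ(θ)`. -/
def radialCoeff (ψ : E n → ℝ) (y : E n) : ℝ := ‖y‖ ^ n * ψ (angle y)

/-- The transformation `(x, θ) ↦ (x + xⁿ⁺¹ ψ(θ), θ)`. -/
def radialMap (ψ : E n → ℝ) (y : E n) : E n := (1 + radialCoeff ψ y) • y

lemma contDiffAt_radialCoeff {k : WithTop ℕ∞} (hψ : ContDiffOn ℝ k (fun y => ψ (angle y)) {0}ᶜ)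
    {y : E n} (hy : y ≠ 0) : ContDiffAt ℝ k (radialCoeff ψ) y :=
  ((contDiffAt_norm ℝ hy).pow n).mul (hψ.contDiffAt (isOpen_compl_singleton.mem_nhds hy))

lemma contDiffAt_radialMap {k : WithTop ℕ∞} (hψ : ContDiffOn ℝ k (fun y => ψ (angle y)) {0}ᶜ)
    {y : E n} (hy : y ≠ 0) : ContDiffAt ℝ k (radialMap ψ) y :=
  (contDiffAt_const.add (contDiffAt_radialCoeff hψ hy)).smul contDiffAt_id

lemma fderiv_radialCoeff {k : WithTop ℕ∞} (hk : 1 ≤ k)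
    (hψ : ContDiffOn ℝ k (fun y => ψ (angle y)) {0}ᶜ) {y : E n}
    (hy : y ≠ 0) (u : E n) :
    fderiv ℝ (radialCoeff ψ) y u = n * (radialCoeff ψ y / ‖y‖ ^ 2) * inner ℝ y u
      + ‖y‖ ^ n * fderiv ℝ (fun y => ψ (angle y)) y u := by
  have hy' : 0 < ‖y‖ := norm_pos_iff.2 hy
  have h1 : DifferentiableAt ℝ (fun y => ψ (angle y)) y :=
    (hψ.contDiffAt (isOpen_compl_singleton.mem_nhds hy)).differentiableAt (by
      rintro rfl; simp at hk)
  have h2 : DifferentiableAt ℝ (fun z : E n => ‖z‖ ^ n) y :=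
    ((contDiffAt_norm ℝ hy (n := 1)).pow n).differentiableAt (by norm_num)
  have h3 : fderiv ℝ (fun z : E n => ‖z‖ ^ n) y u = n * (‖y‖ ^ n / ‖y‖ ^ 2) * inner ℝ y u := by
    have hd : HasDerivAt (fun t : ℝ => Real.sqrt t ^ n)
        (n * Real.sqrt (‖y‖ ^ 2) ^ (n - 1) * (1 / (2 * Real.sqrt (‖y‖ ^ 2)))) (‖y‖ ^ 2) :=
      (Real.hasDerivAt_sqrt (by positivity : ‖y‖ ^ 2 ≠ 0)).fun_pow n
    have h := fderiv_radial (y := y) hd u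
    simp only [Real.sqrt_sq (norm_nonneg _)] at h
    rw [h]
    rcases n with _ | n
    · simp
    · simp only [Nat.add_sub_cancel]
      field_simp
      ring
  unfold radialCoeff
  rw [fderiv_mul_apply h2 h1, h3]
  ring

lemma fderiv_radialMap {k : WithTop ℕ∞} (hk : 1 ≤ k)
    (hψ : ContDiffOn ℝ k (fun y => ψ (angle y)) {0}ᶜ) {y : E n}
    (hy : y ≠ 0) (u : E n) :
    fderiv ℝ (radialMap ψ) y u
      = (1 + radialCoeff ψ y) • u + fderiv ℝ (radialCoeff ψ) y u • y := by
  have h1 : DifferentiableAt ℝ (fun y => 1 + radialCoeff ψ y) y :=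
    ((contDiffAt_radialCoeff hψ hy).differentiableAt (by rintro rfl; simp at hk)).const_add 1
  unfold radialMap
  rw [fderiv_fun_smul h1 differentiableAt_fun_id]
  simp

lemma radialCoeff_nonneg (hψ0 : ∀ y, y ≠ 0 → 0 < ψ (angle y)) {y : E n} (hy : y ≠ 0) :
    0 ≤ radialCoeff ψ y := mul_nonneg (by positivity) (hψ0 y hy).le

lemma norm_radialMap (hψ0 : ∀ y, y ≠ 0 → 0 < ψ (angle y)) {y : E n} (hy : y ≠ 0) :
    ‖radialMap ψ y‖ = (1 + radialCoeff ψ y) * ‖y‖ := by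
  rw [radialMap, norm_smul, Real.norm_of_nonneg]
  linarith [radialCoeff_nonneg hψ0 hy]

lemma le_norm_radialMap (hψ0 : ∀ y, y ≠ 0 → 0 < ψ (angle y)) {y : E n} (hy : y ≠ 0) :
    ‖y‖ ≤ ‖radialMap ψ y‖ := by
  rw [norm_radialMap hψ0 hy]
  exact le_mul_of_one_le_left (norm_nonneg _) (by linarith [radialCoeff_nonneg hψ0 hy])

lemma angle_radialMap (hψ0 : ∀ y, y ≠ 0 → 0 < ψ (angle y)) {y : E n} (hy : y ≠ 0) :
    angle (radialMap ψ y) = angle y :=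
  angle_smul (by linarith [radialCoeff_nonneg hψ0 hy]) y

lemma radialMap_ne_zero (hψ0 : ∀ y, y ≠ 0 → 0 < ψ (angle y)) {y : E n} (hy : y ≠ 0) :
    radialMap ψ y ≠ 0 := by
  rw [← norm_pos_iff]
  exact (norm_pos_iff.2 hy).trans_le (le_norm_radialMap hψ0 hy)

/-- The map preserves the angle, and on each ray `r ↦ (1 + rⁿ ψ) r` is strictly increasing because
`ψ > 0`. -/
lemma injOn_radialMap (hψ0 : ∀ y, y ≠ 0 → 0 < ψ (angle y)) :
    Set.InjOn (radialMap ψ) {0}ᶜ := by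
  intro y hy z hz h
  have hy : y ≠ 0 := hy
  have hz : z ≠ 0 := hz
  have ha : angle y = angle z := by
    rw [← angle_radialMap hψ0 hy, ← angle_radialMap hψ0 hz, h]
  have hn : ‖y‖ = ‖z‖ := by
    have h1 : (1 + radialCoeff ψ y) * ‖y‖ = (1 + radialCoeff ψ z) * ‖z‖ := by
      rw [← norm_radialMap hψ0 hy, ← norm_radialMap hψ0 hz, h]
    unfold radialCoeff at h1
    rw [ha] at h1
    have hψz := hψ0 z hz
    by_contra hne
    rcases lt_or_gt_of_ne hne with hlt | hlt
    · have : (1 + ‖y‖ ^ n * ψ (angle z)) * ‖y‖ < (1 + ‖z‖ ^ n * ψ (angle z)) * ‖z‖ := by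
        apply mul_lt_mul' _ hlt (norm_nonneg _) (by positivity)
        gcongr
      linarith
    · have : (1 + ‖z‖ ^ n * ψ (angle z)) * ‖z‖ < (1 + ‖y‖ ^ n * ψ (angle z)) * ‖y‖ := by
        apply mul_lt_mul' _ hlt (norm_nonneg _) (by positivity)
        gcongr
      linarith
  rw [← norm_smul_angle hy, ← norm_smul_angle hz, ha, hn]

/-- Intermediate value theorem on the ray through `w`: the map does not decrease norms, so a
preimage is found at a radius at most `‖w‖`. -/
lemma exists_radialMap_eq (hψ0 : ∀ y, y ≠ 0 → 0 < ψ (angle y)) {w : E n} (hw : w ≠ 0) :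
    ∃ y : E n, y ≠ 0 ∧ radialMap ψ y = w := by
  have hw' : 0 < ‖w‖ := norm_pos_iff.2 hw
  have hc : Continuous fun r : ℝ => (1 + r ^ n * ψ (angle w)) * r := by fun_prop
  have hψw := hψ0 w hw
  have hmem : ‖w‖ ∈ Set.Icc ((fun r : ℝ => (1 + r ^ n * ψ (angle w)) * r) 0)
      ((fun r : ℝ => (1 + r ^ n * ψ (angle w)) * r) ‖w‖) := by
    constructor
    · simp
    · exact le_mul_of_one_le_left hw'.le (by have : 0 ≤ ‖w‖ ^ n * ψ (angle w) := by positivity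
                                             linarith)
  obtain ⟨r, hr, hrw⟩ := intermediate_value_Icc hw'.le hc.continuousOn hmem
  simp only at hrw
  have hr0 : 0 < r := by
    rcases hr.1.lt_or_eq with h | h
    · exact h
    · rw [← h] at hrw; simp at hrw; exact absurd hrw.symm hw'.ne'
  have hn : ‖r • angle w‖ = r := by rw [norm_smul, norm_angle hw, mul_one, Real.norm_of_nonneg hr0.le]
  refine ⟨r • angle w, ?_, ?_⟩
  · rw [← norm_pos_iff, hn]; exact hr0
  · rw [radialMap, radialCoeff, hn, angle_smul hr0, angle_of_norm_one (norm_angle hw), smul_smul, hrw,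
      norm_smul_angle hw]

/-- A vector in the kernel must be a multiple of `y`, and on `y` the derivative acts as
multiplication by `1 + (n + 1) xⁿ ψ`, which is positive. -/
lemma fderiv_radialMap_injective {k : WithTop ℕ∞} (hk : 1 ≤ k)
    (hψ : ContDiffOn ℝ k (fun y => ψ (angle y)) {0}ᶜ) (hψ0 : ∀ y, y ≠ 0 → 0 < ψ (angle y))
    {y : E n} (hy : y ≠ 0) : Function.Injective (fderiv ℝ (radialMap ψ) y) := by
  rw [injective_iff_map_eq_zero]
  intro u hu
  have hs := radialCoeff_nonneg hψ0 hy
  have hy' : 0 < ‖y‖ := norm_pos_iff.2 hy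
  rw [fderiv_radialMap hk hψ hy] at hu
  set s := radialCoeff ψ y with hsd
  set c := fderiv ℝ (radialCoeff ψ) y u with hc
  have hu' : u = (-(c / (1 + s))) • y := by
    have h1 : (1 + s) ≠ 0 := by positivity
    have h2 : (1 + s) • u = -(c • y) := eq_neg_of_add_eq_zero_left hu
    rw [neg_smul, div_eq_inv_mul, ← smul_smul, ← smul_neg, ← h2, smul_smul, inv_mul_cancel₀ h1,
      one_smul]
  have hself : fderiv ℝ (radialCoeff ψ) y y = n * s := by
    rw [fderiv_radialCoeff hk hψ hy, fderiv_homogeneous_self (s := fun y => ψ (angle y))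
      (fun t ht z => by rw [angle_smul ht])
      ((hψ.contDiffAt (isOpen_compl_singleton.mem_nhds hy)).differentiableAt
        (by rintro rfl; simp at hk)), real_inner_self_eq_norm_sq]
    field_simp
    ring
  have hc2 : c = -(c / (1 + s)) * (n * s) := by
    conv_lhs => rw [hc, hu', map_smul, hself, smul_eq_mul]
  have hc3 : c * (1 + s + n * s) = 0 := by
    have h1 : (1 + s) ≠ 0 := by positivity
    field_simp at hc2
    linarith
  have hc0 : c = 0 := (mul_eq_zero.1 hc3).resolve_right (by positivity)
  rw [hu', hc0]; simp

/-- The derivative of a radial transformation as an isomorphism. -/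
def radialEquiv {k : WithTop ℕ∞} (hk : 1 ≤ k)
    (hψ : ContDiffOn ℝ k (fun y => ψ (angle y)) {0}ᶜ) (hψ0 : ∀ y, y ≠ 0 → 0 < ψ (angle y))
    {y : E n} (hy : y ≠ 0) : E n ≃L[ℝ] E n :=
  (LinearEquiv.ofInjectiveEndo (fderiv ℝ (radialMap ψ) y : E n →ₗ[ℝ] E n)
    (fderiv_radialMap_injective hk hψ hψ0 hy)).toContinuousLinearEquiv

lemma coe_radialEquiv {k : WithTop ℕ∞} (hk : 1 ≤ k)
    (hψ : ContDiffOn ℝ k (fun y => ψ (angle y)) {0}ᶜ) (hψ0 : ∀ y, y ≠ 0 → 0 < ψ (angle y))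
    {y : E n} (hy : y ≠ 0) :
    (radialEquiv hk hψ hψ0 hy : E n →L[ℝ] E n) = fderiv ℝ (radialMap ψ) y := by
  ext u; rfl

lemma hasStrictFDerivAt_radialMap (hψ : ContDiffOn ℝ ∞ (fun y => ψ (angle y)) {0}ᶜ)
    (hψ0 : ∀ y, y ≠ 0 → 0 < ψ (angle y)) {y : E n} (hy : y ≠ 0) :
    HasStrictFDerivAt (radialMap ψ)
      (radialEquiv (by simp) hψ hψ0 hy : E n →L[ℝ] E n) y := by
  rw [coe_radialEquiv]
  exact (contDiffAt_radialMap hψ hy).hasStrictFDerivAt (by simp)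

lemma isOpen_radialMap_source (hψ : ContDiffOn ℝ ∞ (fun y => ψ (angle y)) {0}ᶜ) (x₁ : ℝ) :
    IsOpen {y : E n | y ≠ 0 ∧ ‖radialMap ψ y‖ < x₁} := by
  rw [isOpen_iff_mem_nhds]
  rintro y ⟨hy, hyx⟩
  have hc : ContinuousAt (fun z => ‖radialMap ψ z‖) y :=
    (contDiffAt_radialMap hψ hy).continuousAt.norm
  filter_upwards [isOpen_ne.mem_nhds hy, hc.eventually_lt continuousAt_const hyx] with z hz hzx
  exact ⟨hz, hzx⟩

lemma isOpenMap_radialMap (hψ : ContDiffOn ℝ ∞ (fun y => ψ (angle y)) {0}ᶜ)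
    (hψ0 : ∀ y, y ≠ 0 → 0 < ψ (angle y)) (x₁ : ℝ) :
    IsOpenMap ({y : E n | y ≠ 0 ∧ ‖radialMap ψ y‖ < x₁}.domRestrict (radialMap ψ)) := by
  rw [isOpenMap_iff_nhds_le]
  intro y
  have h1 := (hasStrictFDerivAt_radialMap hψ hψ0 y.2.1).map_nhds_eq_of_equiv
  have h2 : Filter.map ({y : E n | y ≠ 0 ∧ ‖radialMap ψ y‖ < x₁}.domRestrict (radialMap ψ)) (𝓝 y)
      = 𝓝 (radialMap ψ y) := by
    rw [← h1, ← map_nhds_subtype_coe_eq_nhds y.2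
      ((isOpen_radialMap_source hψ x₁).mem_nhds y.2), Filter.map_map]
    rfl
  exact h2.ge

/-- A radial transformation, as a diffeomorphism onto the collar. -/
def radialHomeomorph (hψ : ContDiffOn ℝ ∞ (fun y => ψ (angle y)) {0}ᶜ)
    (hψ0 : ∀ y, y ≠ 0 → 0 < ψ (angle y)) (x₁ : ℝ) : OpenPartialHomeomorph (E n) (E n) :=
  OpenPartialHomeomorph.ofContinuousOpenRestrict
    (Set.BijOn.toPartialEquiv (radialMap ψ) {y | y ≠ 0 ∧ ‖radialMap ψ y‖ < x₁} (collar n x₁)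
      ⟨fun y hy => ⟨norm_pos_iff.2 (radialMap_ne_zero hψ0 hy.1), hy.2⟩,
        (injOn_radialMap hψ0).mono fun y hy => hy.1, fun w hw => by
          obtain ⟨y, hy, rfl⟩ := exists_radialMap_eq hψ0 (norm_pos_iff.1 hw.1)
          exact ⟨y, ⟨hy, hw.2⟩, rfl⟩⟩)
    (fun y hy => (contDiffAt_radialMap hψ hy.1).continuousAt.continuousWithinAt)
    (isOpenMap_radialMap hψ hψ0 x₁) (isOpen_radialMap_source hψ x₁)

section

variable (hψ : ContDiffOn ℝ ∞ (fun y => ψ (angle y)) {0}ᶜ)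
  (hψ0 : ∀ y, y ≠ 0 → 0 < ψ (angle y)) {x₁ : ℝ}

lemma coe_radialHomeomorph : ⇑(radialHomeomorph hψ hψ0 x₁) = radialMap ψ := rfl

lemma radialHomeomorph_source :
    (radialHomeomorph hψ hψ0 x₁).source = {y | y ≠ 0 ∧ ‖radialMap ψ y‖ < x₁} := rfl

lemma radialHomeomorph_target : (radialHomeomorph hψ hψ0 x₁).target = collar n x₁ := rfl

lemma contDiffOn_radialHomeomorph_symm :
    ContDiffOn ℝ ∞ (radialHomeomorph hψ hψ0 x₁).symm (collar n x₁) := by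
  intro w hw
  have hmem := (radialHomeomorph hψ hψ0 x₁).map_target (x := w) hw
  rw [radialHomeomorph_source] at hmem
  exact ((radialHomeomorph hψ hψ0 x₁).contDiffAt_symm (a := w) hw
    (hasStrictFDerivAt_radialMap hψ hψ0 hmem.1).hasFDerivAt
    (contDiffAt_radialMap hψ hmem.1)).contDiffWithinAt

end

/-! ### The end chart after a radial change of coordinates -/

section Manifold

variable {M : Type*} [TopologicalSpace M] [ChartedSpace (E n) M]

/-- The chart obtained by a radial change of coordinates. -/
def radialChart (φ : OpenPartialHomeomorph M (E n))
    (hψ : ContDiffOn ℝ ∞ (fun y => ψ (angle y)) {0}ᶜ)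
    (hψ0 : ∀ y, y ≠ 0 → 0 < ψ (angle y)) (x₁ : ℝ) : OpenPartialHomeomorph M (E n) :=
  φ.trans (radialHomeomorph hψ hψ0 x₁)

variable {φ : OpenPartialHomeomorph M (E n)} {x₀ : ℝ}
  (hψ : ContDiffOn ℝ ∞ (fun y => ψ (angle y)) {0}ᶜ) (hψ0 : ∀ y, y ≠ 0 → 0 < ψ (angle y))

lemma mem_radialChart_source (hφ : IsEndChart x₀ φ) {p : M} :
    p ∈ (radialChart φ hψ hψ0 x₀).source ↔ p ∈ φ.source ∧ ‖radialMap ψ (φ p)‖ < x₀ := by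
  rw [radialChart, OpenPartialHomeomorph.trans_source]
  simp only [Set.mem_inter_iff, Set.mem_preimage, radialHomeomorph_source, Set.mem_ofPred_eq]
  constructor
  · rintro ⟨h1, h2, h3⟩; exact ⟨h1, h3⟩
  · rintro ⟨h1, h3⟩; exact ⟨h1, (hφ.mem_target h1).1, h3⟩

lemma radialChart_apply (x₁ : ℝ) (p : M) : radialChart φ hψ hψ0 x₁ p = radialMap ψ (φ p) := rfl

variable [IsManifold 𝓘(ℝ, E n) ∞ M]

/-- Since `radialMap` does not decrease norms, the preimage of the collar lies in the collar, so the
same `x₀` can be kept. For the same reason the new set `{x ≤ δ}` is cut out of the old closed one by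
a continuous inequality, hence is closed in `M`. -/
lemma isEndChart_radialChart (hφ : IsEndChart x₀ φ) :
    IsEndChart x₀ (radialChart φ hψ hψ0 x₀) := by
  refine ⟨?_, ?_, fun δ hδ => ?_⟩
  · rw [IsManifold.mem_maximalAtlas_iff_contMDiffOn]
    constructor
    · intro p hp
      have hp' := ((mem_radialChart_source hψ hψ0 hφ).1 hp).1
      exact ((contDiffAt_radialMap hψ (hφ.mem_target hp').1).contMDiffAt.comp p
        (contMDiffAt_of_mem_maximalAtlas hφ.mem_maximalAtlas hp')).contMDiffWithinAt
    · refine (contMDiffOn_symm_of_mem_maximalAtlas hφ.mem_maximalAtlas).comp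
        (t := φ.target) ((contDiffOn_radialHomeomorph_symm hψ hψ0 (x₁ := x₀)).contMDiffOn.mono ?_) ?_
      · intro w hw
        exact hw.1
      · intro w hw
        exact hw.2
  · rw [radialChart, OpenPartialHomeomorph.trans_target, radialHomeomorph_target, hφ.target_eq]
    refine Set.inter_eq_left.2 fun w hw => ?_
    have hmem := (radialHomeomorph hψ hψ0 x₀).map_target (x := w) hw
    have heq := (radialHomeomorph hψ hψ0 x₀).right_inv (x := w) hw
    rw [coe_radialHomeomorph] at heq
    rw [radialHomeomorph_source] at hmem
    refine ⟨norm_pos_iff.2 hmem.1, (le_norm_radialMap hψ0 hmem.1).trans_lt hmem.2⟩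
  · have hA := hφ.isClosed δ hδ
    have hf : ContinuousOn (fun p => ‖radialMap ψ (φ p)‖) {p : M | p ∈ φ.source ∧ ‖φ p‖ ≤ δ} := by
      intro p hp
      have h1 : ContinuousAt (radialMap ψ) (φ p) :=
        (contDiffAt_radialMap hψ (hφ.mem_target hp.1).1).continuousAt
      exact (h1.comp (φ.continuousAt hp.1)).norm.continuousWithinAt
    have hB := hf.preimage_isClosed_of_isClosed hA (isClosed_Iic (a := δ))
    convert hB using 1
    ext p
    simp only [Set.mem_ofPred_eq, Set.mem_inter_iff, Set.mem_preimage, Set.mem_Iic,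
      mem_radialChart_source hψ hψ0 hφ, radialChart_apply]
    constructor
    · rintro ⟨⟨h1, h2⟩, h3⟩
      exact ⟨⟨h1, (le_norm_radialMap hψ0 (hφ.mem_target h1).1).trans h3⟩, h3⟩
    · rintro ⟨⟨h1, h2⟩, h3⟩
      exact ⟨⟨h1, h3.trans_lt hδ⟩, h3⟩

lemma isRadialChange_radialChart (hn : n ≠ 0) (hφ : IsEndChart x₀ φ) (hx₀ : 0 < x₀) :
    IsRadialChange φ (radialChart φ hψ hψ0 x₀) := by
  refine ⟨fun p hp => ((mem_radialChart_source hψ hψ0 hφ).1 hp).1, ?_, ψ, hψ, fun p hp => rfl⟩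
  obtain ⟨m, rfl⟩ := Nat.exists_eq_succ_of_ne_zero hn
  obtain ⟨c, C, hc, hC⟩ := exists_bounds_sphere hψ.continuousOn hψ0
  have hC0 : 0 ≤ C := by
    obtain ⟨y, hy⟩ := exists_ne (0 : E (m + 1))
    exact hc.le.trans ((hC y hy).1.trans (hC y hy).2)
  refine ⟨min 1 (x₀ / (1 + C)), by positivity, fun p hp hpδ => ?_⟩
  rw [mem_radialChart_source hψ hψ0 hφ]
  refine ⟨hp, ?_⟩
  have hne := (hφ.mem_target hp).1
  rw [lt_min_iff, lt_div_iff₀ (by positivity)] at hpδ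
  rw [norm_radialMap hψ0 hne]
  have h1 : radialCoeff ψ (φ p) ≤ C := by
    have h2 : ‖φ p‖ ^ (m + 1) ≤ 1 := pow_le_one₀ (norm_nonneg _) hpδ.1.le
    calc radialCoeff ψ (φ p) ≤ 1 * ψ (angle (φ p)) :=
          mul_le_mul_of_nonneg_right h2 (hψ0 _ hne).le
      _ ≤ C := by rw [one_mul]; exact (hC _ hne).2
  calc (1 + radialCoeff ψ (φ p)) * ‖φ p‖ ≤ (1 + C) * ‖φ p‖ := by gcongr
    _ < x₀ := by linarith [hpδ.2]

lemma bilinear_comp_apply {T : Type*} [AddCommGroup T] [Module ℝ T] [TopologicalSpace T]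
    [IsTopologicalAddGroup T] [ContinuousSMul ℝ T]
    (B : T →L[ℝ] T →L[ℝ] ℝ) (L : E n →L[ℝ] T) (u v : E n) :
    B (L u) (L v) = ∑ i, ∑ j, B (L (stdFrame n i)) (L (stdFrame n j)) * (u i * v j) := by
  conv_lhs => rw [eq_sum_single u, eq_sum_single v]
  simp only [map_sum, map_smul, sum_apply, smul_apply, smul_eq_mul, Finset.mul_sum]
  rw [Finset.sum_comm]
  exact Finset.sum_congr rfl fun i _ => Finset.sum_congr rfl fun j _ => by ring

lemma bilOf_coordMetric {k : ℕ∞} (φ : OpenPartialHomeomorph M (E n)) (g : RMetric n k M)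
    (y u v : E n) : bilOf (coordMetric φ g y) u v = g.inner (φ.symm y)
      (mfderiv 𝓘(ℝ, E n) 𝓘(ℝ, E n) φ.symm y u) (mfderiv 𝓘(ℝ, E n) 𝓘(ℝ, E n) φ.symm y v) := by
  rw [bilOf_apply]
  exact (bilinear_comp_apply (g.inner (φ.symm y)) (mfderiv 𝓘(ℝ, E n) 𝓘(ℝ, E n) φ.symm y) u v).symm

/-- The components of a metric after a radial change of coordinates. -/
lemma bilOf_coordMetric_radialChart {k : ℕ∞} (hφ : IsEndChart x₀ φ) (g : RMetric n k M) {y : E n}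
    (hy : y ≠ 0) (hyx : ‖radialMap ψ y‖ < x₀) (u v : E n) :
    bilOf (coordMetric (radialChart φ hψ hψ0 x₀) g (radialMap ψ y))
      (fderiv ℝ (radialMap ψ) y u) (fderiv ℝ (radialMap ψ) y v) = bilOf (coordMetric φ g y) u v := by
  set φ' := radialChart φ hψ hψ0 x₀ with hφ'
  have hE := isEndChart_radialChart hψ hψ0 hφ
  have hw : radialMap ψ y ∈ φ'.target := by
    rw [hE.target_eq]
    exact ⟨norm_pos_iff.2 (radialMap_ne_zero hψ0 hy), hyx⟩
  have hinv : ∀ z, z ≠ 0 → ‖radialMap ψ z‖ < x₀ → φ'.symm (radialMap ψ z) = φ.symm z := by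
    intro z hz hzx
    have : (radialHomeomorph hψ hψ0 x₀).symm (radialMap ψ z) = z :=
      (radialHomeomorph hψ hψ0 x₀).left_inv (x := z) ⟨hz, hzx⟩
    change φ.symm ((radialHomeomorph hψ hψ0 x₀).symm (radialMap ψ z)) = _
    rw [this]
  have hs : MDifferentiableAt 𝓘(ℝ, E n) 𝓘(ℝ, E n) φ'.symm (radialMap ψ y) :=
    (contMDiffAt_symm_of_mem_maximalAtlas hE.mem_maximalAtlas hw).mdifferentiableAt (by simp)
  have hd : MDifferentiableAt 𝓘(ℝ, E n) 𝓘(ℝ, E n) (radialMap ψ) y :=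
    ((contDiffAt_radialMap hψ hy).differentiableAt (by simp)).mdifferentiableAt
  have hev : φ'.symm ∘ radialMap ψ =ᶠ[𝓝 y] φ.symm := by
    filter_upwards [(isOpen_radialMap_source hψ x₀).mem_nhds ⟨hy, hyx⟩] with z hz
    exact hinv z hz.1 hz.2
  have h := mfderiv_comp y hs hd
  rw [hev.mfderiv_eq, mfderiv_eq_fderiv] at h
  have h' : ∀ u : E n, mfderiv 𝓘(ℝ, E n) 𝓘(ℝ, E n) φ.symm y u
      = mfderiv 𝓘(ℝ, E n) 𝓘(ℝ, E n) φ'.symm (radialMap ψ y) (fderiv ℝ (radialMap ψ) y u) :=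
    fun u => DFunLike.congr_fun h u
  rw [bilOf_coordMetric, bilOf_coordMetric, h', h']
  rw [hinv y hy hyx]

end Manifold

end RadialMap

/-! ### The asymptotic expansion after a radial change of coordinates -/

section RealEstimates

lemma inv_sq_expansion {t : ℝ} (ht : 0 ≤ t) :
    |((1 + t) ^ 2)⁻¹ - (1 - 2 * t)| ≤ 3 * t ^ 2 ∧ 0 ≤ ((1 + t) ^ 2)⁻¹ ∧ ((1 + t) ^ 2)⁻¹ ≤ 1 ∧
      1 - ((1 + t) ^ 2)⁻¹ ≤ 2 * t := by
  have h1 : (1 : ℝ) ≤ (1 + t) ^ 2 := by nlinarith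
  have h0 : 0 < (1 + t) ^ 2 := by positivity
  have e : ((1 + t) ^ 2)⁻¹ - (1 - 2 * t) = (3 * t ^ 2 + 2 * t ^ 3) / (1 + t) ^ 2 := by
    field_simp; ring
  have hn : 0 ≤ ((1 + t) ^ 2)⁻¹ - (1 - 2 * t) := by rw [e]; positivity
  refine ⟨?_, by positivity, inv_le_one_of_one_le₀ h1, by linarith⟩
  rw [abs_of_nonneg hn, e, div_le_iff₀ h0]
  nlinarith [pow_nonneg ht 3, pow_nonneg ht 4]

lemma one_add_pow_le {s : ℝ} (hs : 0 ≤ s) (k : ℕ) : (1 + s) ^ k ≤ 1 + k * s * (1 + s) ^ k := by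
  induction k with
  | zero => simp
  | succ k ih =>
    have h1 : (1 + s) ^ k ≤ (1 + s) ^ (k + 1) := pow_le_pow_right₀ (by linarith) (by omega)
    have h2 : (1 + s) ^ (k + 1) = (1 + s) ^ k + s * (1 + s) ^ k := by ring
    have h3 : (k : ℝ) * s * (1 + s) ^ k ≤ k * s * (1 + s) ^ (k + 1) := by gcongr
    have h4 : s * (1 + s) ^ k ≤ s * (1 + s) ^ (k + 1) := by gcongr
    push_cast
    linarith

variable {x P ψ C K N X s ρ : ℝ} (hx : 0 < x) (hx1 : x ≤ 1) (hP : 0 < P) (hPx : P ≤ x) (hψ : 0 ≤ ψ)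
  (hψC : ψ ≤ C) (hs : s = x ^ 2 * P * ψ) (hN : 0 ≤ N)
include hx hx1 hP hPx hψ hψC hs

/-- In these estimates `x = ‖y‖`, `P = xⁿ⁻²` and `s = xⁿ ψ`, the relative displacement of the
radius. The permitted error is `o(P)`, so anything of size `x P` is negligible. -/
lemma radial_small : 0 ≤ s ∧ s ≤ C * x ∧ s ^ 2 / x ^ 2 ≤ C ^ 2 * (x * P) ∧ s / x ^ 2 = P * ψ := by
  have hxP : x ^ 2 * P ≤ x := by nlinarith [mul_pos hx hP]
  refine ⟨by rw [hs]; positivity, ?_, ?_, by rw [hs]; field_simp⟩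
  · rw [hs]
    calc x ^ 2 * P * ψ ≤ x * C := mul_le_mul hxP hψC hψ hx.le
      _ = C * x := by ring
  · have e : s ^ 2 / x ^ 2 = ψ ^ 2 * (x ^ 2 * P * P) := by rw [hs]; field_simp
    rw [e]
    gcongr

include hN in
/-- The component along `dx²`. -/
lemma radial_component_bound (hX0 : 0 ≤ X) (hX1 : X ≤ 1)
    (hXK : 1 - X ≤ K * x) {R : ℝ} (hR : |R| ≤ ρ) :
    |((1 + (N + 1) * s) ^ 2)⁻¹ * ((x ^ 2)⁻¹ + R + P * (2 * N * ψ) * X) - (((1 + s) * x) ^ 2)⁻¹|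
      ≤ ρ + (3 * (N + 1) ^ 2 * C ^ 2 + 3 * C ^ 2 + 2 * N * C * (2 * (N + 1) * C + K)) * (x * P) := by
  obtain ⟨s0, s1, s2, s3⟩ := radial_small hx hx1 hP hPx hψ hψC hs
  obtain ⟨a1, a2, a3, a4⟩ := inv_sq_expansion (t := (N + 1) * s) (by positivity)
  obtain ⟨b1, b2, b3, b4⟩ := inv_sq_expansion s0
  set α := ((1 + (N + 1) * s) ^ 2)⁻¹
  set β := ((1 + s) ^ 2)⁻¹
  have hβ : (((1 + s) * x) ^ 2)⁻¹ = β * (x ^ 2)⁻¹ := by rw [mul_pow, mul_inv]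
  have hxi : 0 < (x ^ 2)⁻¹ := by positivity
  -- The first-order terms `-2(N+1) s / x²` and `+2 s / x²` add up to `-2 N P ψ`, which cancels the
  -- perturbation at `X = 1`. This is the reason for the coefficient `a = 2nψ`.
  have e : α * ((x ^ 2)⁻¹ + R + P * (2 * N * ψ) * X) - β * (x ^ 2)⁻¹
      = (α - (1 - 2 * ((N + 1) * s))) * (x ^ 2)⁻¹ - (β - (1 - 2 * s)) * (x ^ 2)⁻¹ + α * R
        + P * (2 * N * ψ) * (α * X - 1) := by
    have : s * (x ^ 2)⁻¹ = P * ψ := by rw [← s3]; ring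
    linear_combination (-2 * N) * this
  rw [hβ, e]
  have t1 : |(α - (1 - 2 * ((N + 1) * s))) * (x ^ 2)⁻¹| ≤ 3 * (N + 1) ^ 2 * C ^ 2 * (x * P) := by
    rw [abs_mul, abs_of_pos hxi]
    calc _ ≤ 3 * ((N + 1) * s) ^ 2 * (x ^ 2)⁻¹ := by gcongr
      _ = 3 * (N + 1) ^ 2 * (s ^ 2 / x ^ 2) := by ring
      _ ≤ 3 * (N + 1) ^ 2 * (C ^ 2 * (x * P)) := by gcongr
      _ = _ := by ring
  have t2 : |(β - (1 - 2 * s)) * (x ^ 2)⁻¹| ≤ 3 * C ^ 2 * (x * P) := by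
    rw [abs_mul, abs_of_pos hxi]
    calc _ ≤ 3 * s ^ 2 * (x ^ 2)⁻¹ := by gcongr
      _ = 3 * (s ^ 2 / x ^ 2) := by ring
      _ ≤ 3 * (C ^ 2 * (x * P)) := by gcongr
      _ = _ := by ring
  have t3 : |α * R| ≤ ρ := by
    rw [abs_mul, abs_of_nonneg a2]
    exact (mul_le_of_le_one_left (abs_nonneg _) a3).trans hR
  have t4 : |P * (2 * N * ψ) * (α * X - 1)| ≤ 2 * N * C * (2 * (N + 1) * C + K) * (x * P) := by
    have h1 : |α * X - 1| ≤ (2 * (N + 1) * C + K) * x := by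
      have : α * X ≤ 1 := mul_le_one₀ a3 hX0 hX1
      rw [abs_sub_comm, abs_of_nonneg (by linarith)]
      have h2 : (1 - α) * X ≤ 1 - α := mul_le_of_le_one_right (by linarith) hX1
      have h3 : 2 * ((N + 1) * s) ≤ 2 * ((N + 1) * (C * x)) := by gcongr
      linarith
    have hC : 0 ≤ C := hψ.trans hψC
    rw [abs_mul, abs_of_nonneg (by positivity)]
    calc _ ≤ P * (2 * N * C) * ((2 * (N + 1) * C + K) * x) := by gcongr
      _ = _ := by ring
  have c1 := abs_le.1 t1
  have c2 := abs_le.1 t2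
  have c3 := abs_le.1 t3
  have c4 := abs_le.1 t4
  exact abs_le.2 ⟨by linarith only [c1.1, c2.2, c3.1, c4.1], by linarith only [c1.2, c2.1, c3.2, c4.2]⟩

set_option maxHeartbeats 1000000 in
/-- The tangential components. -/
lemma tangential_component_bound (hC : 0 ≤ C) (hN : 0 ≤ N) {L P' μ δ R R₁ R₂ R₀ κ₁ κ₂ : ℝ}
    (hX0 : 0 ≤ X) (hX1 : X ≤ 1) (hL : |P' - P| ≤ L * (x * P)) (hμ : |μ| ≤ C) (hδ : |δ| ≤ 1)
    (hR : |R| ≤ ρ) (hR₁ : |R₁| ≤ ρ) (hR₂ : |R₂| ≤ ρ) (hR₀ : |R₀| ≤ ρ)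
    (hκ₁ : |κ₁| ≤ C * (x ^ 3 * P)) (hκ₂ : |κ₂| ≤ C * (x ^ 3 * P)) :
    |((x ^ 2)⁻¹ - 1 / 2 + x ^ 2 / 16) * δ + P * μ + R - κ₁ * R₁ - κ₂ * R₂
        + κ₁ * κ₂ * ((x ^ 2)⁻¹ + R₀ + P * (2 * N * ψ) * X)
      - ((((1 + s) * x) ^ 2)⁻¹ - 1 / 2 + ((1 + s) * x) ^ 2 / 16) * δ - P' * (μ + 2 * ψ * δ)|
      ≤ (1 + 2 * C + C ^ 2) * ρ
        + (3 * C ^ 2 + (2 + C) * C + 3 * C * L + C ^ 2 + 2 * N * C ^ 3) * (x * P) := by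
  obtain ⟨s0, s1, s2, s3⟩ := radial_small hx hx1 hP hPx hψ hψC hs
  obtain ⟨b1, b2, b3, b4⟩ := inv_sq_expansion s0
  set β := ((1 + s) ^ 2)⁻¹
  have hβ : (((1 + s) * x) ^ 2)⁻¹ = β * (x ^ 2)⁻¹ := by rw [mul_pow, mul_inv]
  have hxi : 0 < (x ^ 2)⁻¹ := by positivity
  have hρ : 0 ≤ ρ := (abs_nonneg _).trans hR
  have hxP : 0 < x * P := by positivity
  have hx3 : x ^ 3 ≤ 1 := pow_le_one₀ hx.le hx1
  have hP1 : P ≤ 1 := hPx.trans hx1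
  have hκ1 : ∀ {κ : ℝ}, |κ| ≤ C * (x ^ 3 * P) → |κ| ≤ C := fun h =>
    h.trans (mul_le_of_le_one_right hC (mul_le_one₀ hx3 hP.le hP1))
  have hκκ : |κ₁ * κ₂| ≤ C ^ 2 * (x ^ 3 * (x * P)) := by
    rw [abs_mul]
    calc _ ≤ C * (x ^ 3 * P) * (C * (x ^ 3 * P)) := by gcongr
      _ = C ^ 2 * (x ^ 3 * (x * P)) * (x ^ 2 * P) := by ring
      _ ≤ C ^ 2 * (x ^ 3 * (x * P)) * 1 := by
        gcongr
        exact mul_le_one₀ (pow_le_one₀ hx.le hx1) hP.le hP1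
      _ = _ := by ring
  -- Here the first-order term `2 s / x² = 2 P ψ` of the change from old to new radius is matched by
  -- the shift `2 ψ δ` of the sphere tensor.
  have e : ((x ^ 2)⁻¹ - 1 / 2 + x ^ 2 / 16) * δ + P * μ + R - κ₁ * R₁ - κ₂ * R₂
        + κ₁ * κ₂ * ((x ^ 2)⁻¹ + R₀ + P * (2 * N * ψ) * X)
      - (β * (x ^ 2)⁻¹ - 1 / 2 + ((1 + s) * x) ^ 2 / 16) * δ - P' * (μ + 2 * ψ * δ)
      = -((β - (1 - 2 * s)) * (x ^ 2)⁻¹) * δ - x ^ 2 * (2 * s + s ^ 2) / 16 * δ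
        - (P' - P) * (μ + 2 * ψ * δ) + R - κ₁ * R₁ - κ₂ * R₂
        + κ₁ * κ₂ * (x ^ 2)⁻¹ + κ₁ * κ₂ * R₀ + κ₁ * κ₂ * (P * (2 * N * ψ) * X) := by
    have : s * (x ^ 2)⁻¹ = P * ψ := by rw [← s3]; ring
    linear_combination 2 * δ * this
  rw [hβ, e]
  have hmul : ∀ {u B : ℝ}, |u| ≤ B → |u * δ| ≤ B := fun h => by
    rw [abs_mul]; exact (mul_le_of_le_one_right (abs_nonneg _) hδ).trans h
  have t1 : |-((β - (1 - 2 * s)) * (x ^ 2)⁻¹) * δ| ≤ 3 * C ^ 2 * (x * P) := by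
    refine hmul ?_
    rw [abs_neg, abs_mul, abs_of_pos hxi]
    calc _ ≤ 3 * s ^ 2 * (x ^ 2)⁻¹ := by gcongr
      _ = 3 * (s ^ 2 / x ^ 2) := by ring
      _ ≤ 3 * (C ^ 2 * (x * P)) := by gcongr
      _ = _ := by ring
  have t2 : |x ^ 2 * (2 * s + s ^ 2) / 16 * δ| ≤ (2 + C) * C * (x * P) := by
    refine hmul ?_
    rw [abs_of_nonneg (by positivity)]
    have h1 : s ≤ C * (x * P) := by
      rw [hs]
      calc x ^ 2 * P * ψ = x * (x * P) * ψ := by ring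
        _ ≤ 1 * (x * P) * C := by gcongr
        _ = C * (x * P) := by ring
    have h2 : s ≤ C := s1.trans (mul_le_of_le_one_right hC hx1)
    have h3 : x ^ 2 ≤ 1 := pow_le_one₀ hx.le hx1
    have h4 : 2 * s + s ^ 2 ≤ (2 + C) * (C * (x * P)) := by
      calc 2 * s + s ^ 2 = (2 + s) * s := by ring
        _ ≤ (2 + C) * (C * (x * P)) := by gcongr
    have h5 : x ^ 2 * (2 * s + s ^ 2) ≤ 2 * s + s ^ 2 := mul_le_of_le_one_left (by positivity) h3
    have h6 : 0 ≤ (2 + C) * (C * (x * P)) := by positivity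
    linarith
  have t3 : |(P' - P) * (μ + 2 * ψ * δ)| ≤ 3 * C * L * (x * P) := by
    have h1 : |μ + 2 * ψ * δ| ≤ 3 * C := by
      refine (abs_add_le _ _).trans ?_
      have := hmul (u := 2 * ψ) (B := 2 * C) (by rw [abs_of_nonneg (by positivity)]; linarith)
      linarith
    rw [abs_mul]
    calc _ ≤ L * (x * P) * (3 * C) :=
          mul_le_mul hL h1 (abs_nonneg _) ((abs_nonneg _).trans hL)
      _ = _ := by ring
  have t4 : |κ₁ * R₁| ≤ C * ρ := by
    rw [abs_mul]; exact mul_le_mul (hκ1 hκ₁) hR₁ (abs_nonneg _) hC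
  have t5 : |κ₂ * R₂| ≤ C * ρ := by
    rw [abs_mul]; exact mul_le_mul (hκ1 hκ₂) hR₂ (abs_nonneg _) hC
  have t6 : |κ₁ * κ₂ * (x ^ 2)⁻¹| ≤ C ^ 2 * (x * P) := by
    rw [abs_mul, abs_of_pos hxi]
    calc _ ≤ C ^ 2 * (x ^ 3 * (x * P)) * (x ^ 2)⁻¹ := by gcongr
      _ = C ^ 2 * (x * P) * x := by field_simp
      _ ≤ C ^ 2 * (x * P) * 1 := by gcongr
      _ = _ := by ring
  have hκκ' : |κ₁ * κ₂| ≤ C ^ 2 * (x * P) := by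
    refine hκκ.trans ?_
    have : x ^ 3 * (x * P) ≤ x * P := mul_le_of_le_one_left hxP.le hx3
    gcongr
  have hκκ1 : |κ₁ * κ₂| ≤ C ^ 2 := by
    rw [abs_mul, sq]; exact mul_le_mul (hκ1 hκ₁) (hκ1 hκ₂) (abs_nonneg _) hC
  have t7 : |κ₁ * κ₂ * R₀| ≤ C ^ 2 * ρ := by
    rw [abs_mul]; gcongr
  have t8 : |κ₁ * κ₂ * (P * (2 * N * ψ) * X)| ≤ 2 * N * C ^ 3 * (x * P) := by
    rw [abs_mul, abs_of_nonneg (by positivity : 0 ≤ P * (2 * N * ψ) * X)]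
    calc _ ≤ C ^ 2 * (x * P) * (1 * (2 * N * C) * 1) := by gcongr
      _ = _ := by ring
  have c1 := abs_le.1 t1
  have c2 := abs_le.1 t2
  have c3 := abs_le.1 t3
  have c4 := abs_le.1 t4
  have c5 := abs_le.1 t5
  have c6 := abs_le.1 t6
  have c7 := abs_le.1 t7
  have c8 := abs_le.1 t8
  have c9 := abs_le.1 hR
  exact abs_le.2 ⟨by linarith only [c1.1, c2.2, c3.2, c4.2, c5.2, c6.1, c7.1, c8.1, c9.1],
    by linarith only [c1.2, c2.1, c3.1, c4.1, c5.1, c6.2, c7.2, c8.2, c9.2]⟩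

omit hs in
include hN in
/-- The mixed components. -/
lemma mixed_component_bound (hC : 0 ≤ C) {α R R₀ κ : ℝ} (hα : |α| ≤ 1)
    (hX0 : 0 ≤ X) (hX1 : X ≤ 1) (hR : |R| ≤ ρ) (hR₀ : |R₀| ≤ ρ) (hκ : |κ| ≤ C * (x ^ 3 * P)) :
    |α * (R - κ * ((x ^ 2)⁻¹ + R₀ + P * (2 * N * ψ) * X))|
      ≤ (1 + C) * ρ + (C + 2 * N * C ^ 2) * (x * P) := by
  have hxi : 0 < (x ^ 2)⁻¹ := by positivity
  have hP1 : P ≤ 1 := hPx.trans hx1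
  have hxP : 0 < x * P := by positivity
  have hκ1 : |κ| ≤ C * (x * P) := by
    refine hκ.trans ?_
    have : x ^ 3 ≤ x := by nlinarith [pow_le_one₀ hx.le hx1 (n := 2)]
    gcongr
  have hκ2 : |κ| ≤ C := hκ1.trans (mul_le_of_le_one_right hC (mul_le_one₀ hx1 hP.le hP1))
  rw [abs_mul]
  refine (mul_le_of_le_one_left (abs_nonneg _) hα).trans ?_
  have t1 : |κ * (x ^ 2)⁻¹| ≤ C * (x * P) := by
    rw [abs_mul, abs_of_pos hxi]
    calc _ ≤ C * (x ^ 3 * P) * (x ^ 2)⁻¹ := by gcongr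
      _ = C * (x * P) := by field_simp
  have t2 : |κ * R₀| ≤ C * ρ := by rw [abs_mul]; gcongr
  have t3 : |κ * (P * (2 * N * ψ) * X)| ≤ 2 * N * C ^ 2 * (x * P) := by
    rw [abs_mul, abs_of_nonneg (by positivity : 0 ≤ P * (2 * N * ψ) * X)]
    calc _ ≤ C * (x * P) * (1 * (2 * N * C) * 1) := by gcongr
      _ = _ := by ring
  have c1 := abs_le.1 t1
  have c2 := abs_le.1 t2
  have c3 := abs_le.1 t3
  have c9 := abs_le.1 hR
  exact abs_le.2 ⟨by linarith only [c1.2, c2.2, c3.2, c9.1],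
    by linarith only [c1.1, c2.1, c3.1, c9.2]⟩

end RealEstimates

/-! ### Orthonormal frames for the product metric `dx² + h̊` -/

section ProductFrame

variable {m : ℕ} {y : E (m + 1)} {b : OrthonormalBasis (Fin (m + 1)) ℝ (E (m + 1))}

lemma dxSq_mul_self {n : ℕ} {y : E n} (hy : y ≠ 0) : dxSq y * dxSq y = dxSq y := by
  have h : ∑ k, angle y k * angle y k = 1 := by
    rw [← inner_eq_sum, real_inner_self_eq_norm_sq, norm_angle hy]; norm_num
  ext i j
  simp only [Matrix.mul_apply, dxSq, Matrix.of_apply]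
  calc ∑ k, angle y i * angle y k * (angle y k * angle y j)
      = (∑ k, angle y k * angle y k) * (angle y i * angle y j) := by
        rw [Finset.sum_mul]; exact Finset.sum_congr rfl fun k _ => by ring
    _ = _ := by rw [h, one_mul]

/-- `dxSq y` and `1 - dxSq y` are complementary projections, so the metric is inverted on each of
them separately. -/
lemma inv_productMetric {n : ℕ} {y : E n} (hy : y ≠ 0) :
    (productMetric y)⁻¹ = dxSq y + ‖y‖ ^ 2 • (1 - dxSq y) := by
  have hy' : ‖y‖ ≠ 0 := norm_ne_zero_iff.2 hy
  have hD := dxSq_mul_self hy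
  have h1 : dxSq y * (1 - dxSq y) = 0 := by rw [mul_sub, hD, mul_one, sub_self]
  have h2 : (1 - dxSq y) * dxSq y = 0 := by rw [sub_mul, hD, one_mul, sub_self]
  have h3 : (1 - dxSq y) * (1 - dxSq y) = 1 - dxSq y := by rw [sub_mul, h1, one_mul, sub_zero]
  apply Matrix.inv_eq_right_inv
  rw [productMetric, roundMetric, add_mul, mul_add, mul_add, smul_mul_smul_comm, Matrix.mul_smul,
    Matrix.smul_mul, hD, h1, h2, h3, inv_mul_cancel₀ (pow_ne_zero 2 hy')]
  simp

/-- An orthonormal frame for `dx² + h̊`. -/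
def prodFrame (b : OrthonormalBasis (Fin (m + 1)) ℝ (E (m + 1))) (x : ℝ) (a : Fin (m + 1)) :
    E (m + 1) := (if a = 0 then 1 else x) • b a

lemma sum_frame_mul (b : OrthonormalBasis (Fin (m + 1)) ℝ (E (m + 1))) (i j : Fin (m + 1)) :
    ∑ a, b a i * b a j = if i = j then 1 else 0 := by
  have h := b.sum_inner_mul_inner (EuclideanSpace.single i (1 : ℝ)) (EuclideanSpace.single j 1)
  simpa [EuclideanSpace.inner_single_left, EuclideanSpace.inner_single_right,
    PiLp.single_apply, eq_comm] using h

lemma inv_productMetric_eq_sum (hy : y ≠ 0) (hb : b 0 = angle y) (i j : Fin (m + 1)) :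
    (productMetric y)⁻¹ i j = ∑ a, prodFrame b ‖y‖ a i * prodFrame b ‖y‖ a j := by
  have h := sum_frame_mul b i j
  rw [Fin.sum_univ_succ, hb] at h
  have h' : ∑ a : Fin m, b a.succ i * b a.succ j
      = (if i = j then 1 else 0) - angle y i * angle y j := by linarith
  rw [inv_productMetric hy, Fin.sum_univ_succ]
  simp only [prodFrame, if_pos, Fin.succ_ne_zero, if_false, PiLp.smul_apply, smul_eq_mul, one_mul,
    hb, Matrix.add_apply, Matrix.smul_apply, Matrix.sub_apply, Matrix.one_apply]
  have hD : dxSq y i j = angle y i * angle y j := rfl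
  rw [hD, ← h', Finset.mul_sum]
  congr 1
  exact Finset.sum_congr rfl fun a _ => by ring

lemma abs_bilOf_le_tensorNorm (hy : y ≠ 0) (hb : b 0 = angle y)
    (A : Matrix (Fin (m + 1)) (Fin (m + 1)) ℝ) (a c : Fin (m + 1)) :
    |bilOf A (prodFrame b ‖y‖ a) (prodFrame b ‖y‖ c)|
      ≤ tensorNorm (productMetric y) (toTensor A) := by
  have h := abs_evalT_le_tensorNorm (inv_productMetric_eq_sum hy hb) (toTensor A) ![a, c]
  rwa [evalT_toTensor] at h

lemma tensorNorm_le_of_frame (hy : y ≠ 0) (hb : b 0 = angle y)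
    {A : Matrix (Fin (m + 1)) (Fin (m + 1)) ℝ} {B : ℝ} (hB : 0 ≤ B)
    (h : ∀ a c, |bilOf A (prodFrame b ‖y‖ a) (prodFrame b ‖y‖ c)| ≤ B) :
    tensorNorm (productMetric y) (toTensor A) ≤ (m + 1) * B := by
  rw [tensorNorm_eq (inv_productMetric_eq_sum hy hb)]
  apply Real.sqrt_le_iff.2 ⟨by positivity, ?_⟩
  calc _ ≤ ∑ _c : Fin 2 → Fin (m + 1), B ^ 2 := Finset.sum_le_sum fun c _ => by
        rw [evalT_toTensor, ← sq_abs]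
        exact pow_le_pow_left₀ (abs_nonneg _) (h _ _) 2
    _ = _ := by simp; ring

lemma inner_frame (hy : y ≠ 0) (hb : b 0 = angle y) (a : Fin (m + 1)) :
    inner ℝ y (b a) = if a = 0 then ‖y‖ else 0 := by
  conv_lhs => rw [← norm_smul_angle hy, ← hb, inner_smul_left,
    orthonormal_iff_ite.1 b.orthonormal]
  simp [eq_comm]

lemma bilOf_hyperbolicMetric_frame (hy : y ≠ 0) (hb : b 0 = angle y) (a c : Fin m) :
    bilOf (hyperbolicMetric y) (prodFrame b ‖y‖ 0) (prodFrame b ‖y‖ 0) = (‖y‖ ^ 2)⁻¹ ∧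
    bilOf (hyperbolicMetric y) (prodFrame b ‖y‖ 0) (prodFrame b ‖y‖ c.succ) = 0 ∧
    bilOf (hyperbolicMetric y) (prodFrame b ‖y‖ a.succ) (prodFrame b ‖y‖ 0) = 0 ∧
    bilOf (hyperbolicMetric y) (prodFrame b ‖y‖ a.succ) (prodFrame b ‖y‖ c.succ)
      = ((‖y‖ ^ 2)⁻¹ - 1 / 2 + ‖y‖ ^ 2 / 16) * (if a = c then 1 else 0) := by
  have hy' : ‖y‖ ≠ 0 := norm_ne_zero_iff.2 hy
  simp only [prodFrame, map_smul, smul_apply, bilOf_hyperbolicMetric hy,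
    inner_frame hy hb, orthonormal_iff_ite.1 b.orthonormal, if_pos, Fin.succ_ne_zero, if_false,
    (Fin.succ_ne_zero _).symm, smul_eq_mul, Fin.succ_inj, hypα, hypβ]
  refine ⟨?_, by simp, by simp, ?_⟩
  · field_simp; ring
  · split_ifs
    · field_simp; ring
    · simp

lemma IsSphereTensor.bilOf_angle_right {n : ℕ} {μ : E n → Matrix (Fin n) (Fin n) ℝ}
    (hμ : IsSphereTensor μ) {θ : E n} (hθ : ‖θ‖ = 1) (u : E n) : bilOf (μ θ) u θ = 0 := by
  rw [bilOf_apply]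
  refine Finset.sum_eq_zero fun i _ => ?_
  have := hμ.tangential θ hθ i
  calc _ = u i * ∑ j, μ θ i j * θ j := by
        rw [Finset.mul_sum]; exact Finset.sum_congr rfl fun j _ => by ring
    _ = 0 := by rw [this, mul_zero]

lemma bilOf_symm {n : ℕ} {A : Matrix (Fin n) (Fin n) ℝ} (hA : A.IsSymm) (u v : E n) :
    bilOf A u v = bilOf A v u := by
  rw [bilOf_apply, bilOf_apply, Finset.sum_comm]
  refine Finset.sum_congr rfl fun i _ => Finset.sum_congr rfl fun j _ => ?_
  rw [hA.apply i j]; ring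

lemma bilOf_pullback_frame (hy : y ≠ 0) (hb : b 0 = angle y)
    {μ : E (m + 1) → Matrix (Fin (m + 1)) (Fin (m + 1)) ℝ} (hμ : IsSphereTensor μ) (a c : Fin m) :
    bilOf (pullbackSphereTensor μ y) (prodFrame b ‖y‖ 0) (prodFrame b ‖y‖ 0) = 0 ∧
    bilOf (pullbackSphereTensor μ y) (prodFrame b ‖y‖ 0) (prodFrame b ‖y‖ c.succ) = 0 ∧
    bilOf (pullbackSphereTensor μ y) (prodFrame b ‖y‖ a.succ) (prodFrame b ‖y‖ 0) = 0 ∧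
    bilOf (pullbackSphereTensor μ y) (prodFrame b ‖y‖ a.succ) (prodFrame b ‖y‖ c.succ)
      = bilOf (μ (angle y)) (b a.succ) (b c.succ) := by
  have hy' : ‖y‖ ≠ 0 := norm_ne_zero_iff.2 hy
  have h1 := hμ.bilOf_angle_right (norm_angle hy)
  have h2 : ∀ u, bilOf (μ (angle y)) (angle y) u = 0 := fun u => by
    rw [bilOf_symm (hμ.symm _ (norm_angle hy)), h1]
  simp only [prodFrame, map_smul, smul_apply, pullbackSphereTensor, bilOf_smul,
    if_pos, Fin.succ_ne_zero, if_false, hb, h1, h2, smul_eq_mul, mul_zero, true_and]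
  field_simp

lemma IsSphereTensor.exists_bound {n : ℕ} {μ : E n → Matrix (Fin n) (Fin n) ℝ}
    (hμ : IsSphereTensor μ) : ∃ C : ℝ, 0 ≤ C ∧ ∀ y, y ≠ 0 → ∀ u v : E n, ‖u‖ = 1 → ‖v‖ = 1 →
      |bilOf (μ (angle y)) u v| ≤ C := by
  have h : ∀ i j, ∃ C : ℝ, 0 < C ∧ ∀ y : E n, y ≠ 0 → |μ (angle y) i j| ≤ C := fun i j => by
    obtain ⟨C, hC, h⟩ := exists_bound_homogeneous (s := fun y => μ (angle y) i j)
      (fun t ht y => by rw [angle_smul ht]) (hμ.contDiffOn i j)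
    exact ⟨C, hC, fun y hy => (h y hy).1⟩
  choose C hC hb using h
  refine ⟨∑ i, ∑ j, C i j, Finset.sum_nonneg fun i _ => Finset.sum_nonneg fun j _ => (hC i j).le,
    fun y hy u v hu hv => ?_⟩
  rw [bilOf_apply]
  refine (Finset.abs_sum_le_sum_abs _ _).trans (Finset.sum_le_sum fun i _ => ?_)
  refine (Finset.abs_sum_le_sum_abs _ _).trans (Finset.sum_le_sum fun j _ => ?_)
  have h1 : |u i| ≤ 1 := by rw [← hu]; exact PiLp.norm_apply_le u i
  have h2 : |v j| ≤ 1 := by rw [← hv]; exact PiLp.norm_apply_le v j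
  have h3 := hb i j y hy
  rw [abs_mul, abs_mul]
  exact (mul_le_of_le_one_right (by positivity) (mul_le_one₀ h1 (abs_nonneg _) h2)).trans h3

end ProductFrame

/-- The sphere tensor `μ + 2 ψ h̊`. -/
def shiftTensor {n : ℕ} (μ : E n → Matrix (Fin n) (Fin n) ℝ) (ψ : E n → ℝ) (θ : E n) :
    Matrix (Fin n) (Fin n) ℝ := μ θ + (2 * ψ θ) • (1 - dxSq θ)

lemma IsSphereTensor.shiftTensor {n : ℕ} {μ : E n → Matrix (Fin n) (Fin n) ℝ}
    (hμ : IsSphereTensor μ) {ψ : E n → ℝ} (hψ : ContDiffOn ℝ 2 (fun y => ψ (angle y)) {0}ᶜ) :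
    IsSphereTensor (shiftTensor μ ψ) := by
  refine ⟨fun θ hθ => ?_, fun θ hθ i => ?_, fun i j => ?_⟩
  · refine (hμ.symm θ hθ).add (Matrix.IsSymm.smul ?_ _)
    exact Matrix.isSymm_one.sub (Matrix.IsSymm.ext fun i j => mul_comm _ _)
  · have h1 := hμ.tangential θ hθ i
    have h2 : ∑ j, θ j * θ j = 1 := by
      rw [← inner_eq_sum, real_inner_self_eq_norm_sq, hθ]; norm_num
    have h3 : ∑ j, (1 : Matrix (Fin n) (Fin n) ℝ) i j * θ j = θ i := by simp [Matrix.one_apply]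
    have h4 : ∑ j, dxSq θ i j * θ j = θ i := by
      calc _ = θ i * ∑ j, θ j * θ j := by
            rw [Finset.mul_sum]
            refine Finset.sum_congr rfl fun j _ => ?_
            simp only [dxSq, angle_of_norm_one hθ, Matrix.of_apply]; ring
        _ = _ := by rw [h2, mul_one]
    calc _ = ∑ j, μ θ i j * θ j + 2 * ψ θ * (∑ j, (1 : Matrix (Fin n) (Fin n) ℝ) i j * θ j
          - ∑ j, dxSq θ i j * θ j) := by
          rw [← Finset.sum_sub_distrib, Finset.mul_sum, ← Finset.sum_add_distrib]
          refine Finset.sum_congr rfl fun j _ => ?_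
          simp only [AHMass.shiftTensor, Matrix.add_apply, Matrix.smul_apply, Matrix.sub_apply,
            smul_eq_mul]
          ring
      _ = 0 := by rw [h1, h3, h4]; ring
  · have h : ContDiffOn ℝ 2 (fun y : E n => μ (angle y) i j
        + 2 * ψ (angle y) * ((1 : Matrix (Fin n) (Fin n) ℝ) i j - dxSq y i j)) {0}ᶜ :=
      (hμ.contDiffOn i j).add ((contDiffOn_const.mul hψ).mul (contDiffOn_const.sub
        fun y hy => (contDiffAt_dxSq hy i j).contDiffWithinAt))
    refine h.congr fun y hy => ?_
    have : dxSq (angle y) = dxSq y := by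
      ext i j
      simp only [dxSq, Matrix.of_apply, angle_of_norm_one (norm_angle hy)]
    simp only [AHMass.shiftTensor, Matrix.add_apply, Matrix.smul_apply, Matrix.sub_apply,
      smul_eq_mul, this]

/-- The remainder in the asymptotic expansion of a metric with matrix `A` at `y`. -/
def expansionError {n : ℕ} (A : Matrix (Fin n) (Fin n) ℝ) (μ : E n → Matrix (Fin n) (Fin n) ℝ)
    (y : E n) : Matrix (Fin n) (Fin n) ℝ :=
  A - hyperbolicMetric y - ‖y‖ ^ (n - 2) • pullbackSphereTensor μ y

lemma bilOf_expansionError {n : ℕ} (A : Matrix (Fin n) (Fin n) ℝ)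
    (μ : E n → Matrix (Fin n) (Fin n) ℝ) (y u v : E n) :
    bilOf A u v = bilOf (hyperbolicMetric y) u v
      + ‖y‖ ^ (n - 2) * bilOf (pullbackSphereTensor μ y) u v
      + bilOf (expansionError A μ y) u v := by
  rw [expansionError, bilOf_sub, bilOf_sub, bilOf_smul]; ring

/-! ### The effect of a radial change on the components of the metric -/

section Pointwise

variable {m : ℕ} {y : E (m + 1)} {b : OrthonormalBasis (Fin (m + 1)) ℝ (E (m + 1))}
  {ψ : E (m + 1) → ℝ}

/-- With `s = xⁿ ψ`, this is `d(x + xⁿ⁺¹ ψ) = (1 + (n + 1) s) dx + xⁿ⁺¹ dψ`: tangential vectors are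
scaled by `1 + s` and acquire a small radial part. -/
lemma fderiv_radialMap_frame (hψ : ContDiffOn ℝ 2 (fun y => ψ (angle y)) {0}ᶜ) (hy : y ≠ 0)
    (hb : b 0 = angle y) :
    fderiv ℝ (radialMap ψ) y (b 0) = (1 + ((m + 1 : ℕ) + 1) * radialCoeff ψ y) • b 0 ∧
    ∀ a : Fin m, fderiv ℝ (radialMap ψ) y (b a.succ) = (1 + radialCoeff ψ y) • b a.succ
      + (‖y‖ ^ (m + 2) * fderiv ℝ (fun y => ψ (angle y)) y (b a.succ)) • b 0 := by
  have hy' : ‖y‖ ≠ 0 := norm_ne_zero_iff.2 hy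
  have hd : DifferentiableAt ℝ (fun y => ψ (angle y)) y :=
    (hψ.contDiffAt (isOpen_compl_singleton.mem_nhds hy)).differentiableAt (by norm_num)
  have h0 : fderiv ℝ (fun y => ψ (angle y)) y (b 0) = 0 := by
    rw [hb, angle, map_smul, fderiv_homogeneous_self (fun t ht y => by rw [angle_smul ht]) hd,
      smul_zero]
  have hyb : y = ‖y‖ • b 0 := by rw [hb, norm_smul_angle hy]
  constructor
  · rw [fderiv_radialMap (by norm_num) hψ hy, fderiv_radialCoeff (by norm_num) hψ hy, h0,
      inner_frame hy hb, if_pos rfl]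
    conv_lhs => rw [show ∀ r : ℝ, r • y = r • ‖y‖ • b 0 from fun r => by rw [← hyb]]
    rw [smul_smul, ← add_smul]
    congr 1
    field_simp
    push_cast; ring
  · intro a
    rw [fderiv_radialMap (by norm_num) hψ hy, fderiv_radialCoeff (by norm_num) hψ hy,
      inner_frame hy hb, if_neg (Fin.succ_ne_zero a)]
    conv_lhs => rw [show ∀ r : ℝ, r • y = r • ‖y‖ • b 0 from fun r => by rw [← hyb]]
    rw [smul_smul]
    congr 2
    ring

end Pointwise

section Pointwise

variable {m : ℕ} {ψ : E (m + 1) → ℝ}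

/-- The frame at `radialMap ψ y` in terms of images of vectors at `y`. -/
lemma exists_frame_preimage (hψ : ContDiffOn ℝ 2 (fun y => ψ (angle y)) {0}ᶜ)
    (hψ0 : ∀ y, y ≠ 0 → 0 < ψ (angle y)) {C : ℝ}
    (hC : ∀ y : E (m + 1), y ≠ 0 → ∀ u, |fderiv ℝ (fun y => ψ (angle y)) y u| ≤ C * (‖u‖ / ‖y‖))
    {y : E (m + 1)} (hy : y ≠ 0) {b : OrthonormalBasis (Fin (m + 1)) ℝ (E (m + 1))}
    (hb : b 0 = angle y) :
    ∃ κ : Fin m → ℝ, (∀ a, |κ a| ≤ C * ‖y‖ ^ (m + 2)) ∧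
      fderiv ℝ (radialMap ψ) y ((1 + ((m + 1 : ℕ) + 1) * radialCoeff ψ y)⁻¹ • prodFrame b ‖y‖ 0)
        = prodFrame b ‖radialMap ψ y‖ 0 ∧
      ∀ a, fderiv ℝ (radialMap ψ) y (prodFrame b ‖y‖ a.succ - κ a • prodFrame b ‖y‖ 0)
        = prodFrame b ‖radialMap ψ y‖ a.succ := by
  have hy' : 0 < ‖y‖ := norm_pos_iff.2 hy
  have hs := radialCoeff_nonneg hψ0 hy
  set s := radialCoeff ψ y
  have hpos : 0 < 1 + (((m + 1 : ℕ) : ℝ) + 1) * s := by positivity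
  set p : Fin m → ℝ := fun a => fderiv ℝ (fun y => ψ (angle y)) y (b a.succ)
  have hp : ∀ a, |p a| ≤ C / ‖y‖ := fun a => by
    have := hC y hy (b a.succ)
    rwa [b.norm_eq_one, mul_one_div] at this
  have hf := fderiv_radialMap_frame hψ hy hb
  have h0 : ∀ x, prodFrame b x 0 = b 0 := fun x => by simp [prodFrame]
  have h1 : ∀ x (a : Fin m), prodFrame b x a.succ = x • b a.succ := fun x a => by simp [prodFrame]
  refine ⟨fun a => ‖y‖ ^ (m + 3) * p a * (1 + (((m + 1 : ℕ) : ℝ) + 1) * s)⁻¹, fun a => ?_, ?_,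
    fun a => ?_⟩
  · rw [abs_mul, abs_mul, abs_of_pos (by positivity : 0 < ‖y‖ ^ (m + 3)), abs_of_pos (inv_pos.2 hpos)]
    have h2 : (1 + (((m + 1 : ℕ) : ℝ) + 1) * s)⁻¹ ≤ 1 := inv_le_one_of_one_le₀ (by
      have : 0 ≤ (((m + 1 : ℕ) : ℝ) + 1) * s := by positivity
      linarith)
    refine (mul_le_of_le_one_right (by positivity) h2).trans ?_
    calc _ ≤ ‖y‖ ^ (m + 3) * (C / ‖y‖) := by gcongr; exact hp a
      _ = _ := by field_simp; ring
  · rw [map_smul, h0, h0, hf.1, smul_smul, inv_mul_cancel₀ hpos.ne', one_smul]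
  · rw [map_sub, map_smul, h0, h1, h1, map_smul, hf.1, hf.2 a, norm_radialMap hψ0 hy]
    rw [smul_add, smul_smul, smul_smul, smul_smul, add_sub_assoc, ← sub_smul]
    have : ‖y‖ * (‖y‖ ^ (m + 2) * p a)
        - ‖y‖ ^ (m + 3) * p a * (1 + (((m + 1 : ℕ) : ℝ) + 1) * s)⁻¹ *
          (1 + (((m + 1 : ℕ) : ℝ) + 1) * s) = 0 := by
      field_simp; ring
    rw [this, zero_smul, add_zero, mul_comm]

lemma bilOf_shiftTensor_frame {μ : E (m + 1) → Matrix (Fin (m + 1)) (Fin (m + 1)) ℝ}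
    {y : E (m + 1)} {b : OrthonormalBasis (Fin (m + 1)) ℝ (E (m + 1))}
    (hb : b 0 = angle y) (a c : Fin m) :
    bilOf (shiftTensor μ ψ (angle y)) (b a.succ) (b c.succ)
      = bilOf (μ (angle y)) (b a.succ) (b c.succ)
        + 2 * ψ (angle y) * (if a = c then 1 else 0) := by
  have h : ∀ a : Fin m, inner ℝ (angle y) (b a.succ) = 0 := fun a => by
    rw [← hb, orthonormal_iff_ite.1 b.orthonormal, if_neg (Fin.succ_ne_zero a).symm]
  rw [shiftTensor, bilOf_add, bilOf_smul, bilOf_sub, bilOf_one, bilOf_dxSq, h, zero_mul, mul_zero,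
    sub_zero, orthonormal_iff_ite.1 b.orthonormal]
  simp

set_option maxHeartbeats 2000000 in
/-- Under a radial change of coordinates, which compensates a radial perturbation of the metric, the
mass aspect changes and the remainder remains small. -/
theorem exists_expansionError_bound (hm : 2 ≤ m) (hψ : ContDiffOn ℝ 2 (fun y => ψ (angle y)) {0}ᶜ)
    (hψ0 : ∀ y, y ≠ 0 → 0 < ψ (angle y))
    {μ : E (m + 1) → Matrix (Fin (m + 1)) (Fin (m + 1)) ℝ} (hμ : IsSphereTensor μ) {K : ℝ} :
    ∃ C : ℝ, ∀ (X : ℝ → ℝ) (A A' : Matrix (Fin (m + 1)) (Fin (m + 1)) ℝ) (y : E (m + 1)),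
      y ≠ 0 → ‖y‖ ≤ 1 → 0 ≤ X (‖y‖ ^ 2) → X (‖y‖ ^ 2) ≤ 1 → 1 - X (‖y‖ ^ 2) ≤ K * ‖y‖ →
      (∀ u v, bilOf A' (fderiv ℝ (radialMap ψ) y u) (fderiv ℝ (radialMap ψ) y v)
        = bilOf (A + radialBump (fun θ => 2 * (m + 1 : ℕ) * ψ θ) X y) u v) →
      tensorNorm (productMetric (radialMap ψ y))
          (toTensor (expansionError A' (shiftTensor μ ψ) (radialMap ψ y)))
        ≤ C * (tensorNorm (productMetric y) (toTensor (expansionError A μ y)) + ‖y‖ ^ m) := by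
  obtain ⟨C₁, hC₁, hψb⟩ := exists_bound_homogeneous (s := fun y => ψ (angle y))
    (fun t ht y => by rw [angle_smul ht]) hψ
  obtain ⟨C₂, hC₂, hμb⟩ := hμ.exists_bound
  have hμ' := hμ.shiftTensor hψ
  set C := max C₁ C₂
  set N : ℝ := ((m + 1 : ℕ) : ℝ)
  set L : ℝ := ((m - 1 : ℕ) : ℝ) * C * (1 + C) ^ (m - 1)
  have hC : 0 ≤ C := hC₁.le.trans (le_max_left _ _)
  have hN : 0 ≤ N := by positivity
  set B₁ := 3 * (N + 1) ^ 2 * C ^ 2 + 3 * C ^ 2 + 2 * N * C * (2 * (N + 1) * C + K)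
  set B₂ := 3 * C ^ 2 + (2 + C) * C + 3 * C * L + C ^ 2 + 2 * N * C ^ 3
  set B₃ := C + 2 * N * C ^ 2
  -- Dominates the coefficients of `ρ` and of `x P` in the radial, tangential and mixed estimates
  -- together; the factor `m + 1` in the final constant is the passage from components to the norm.
  set B := max (1 + 2 * C + C ^ 2) (max B₁ (max B₂ B₃))
  refine ⟨((m : ℝ) + 1) * B, fun X A A' y hy hy1 hX0 hX1 hXK hA => ?_⟩
  have hx : 0 < ‖y‖ := norm_pos_iff.2 hy
  obtain ⟨b, hb⟩ := exists_orthonormal_frame (norm_angle hy)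
  obtain ⟨κ, hκ, hu0, hu⟩ := exists_frame_preimage hψ hψ0 (C := C) (fun z hz u =>
    ((hψb z hz).2.1 u).trans (by gcongr; exact le_max_left _ _)) hy hb
  have hy' := radialMap_ne_zero hψ0 hy
  have hb' : b 0 = angle (radialMap ψ y) := by rw [hb, angle_radialMap hψ0 hy]
  set x := ‖y‖
  set P := x ^ (m + 1 - 2) with hPd
  have hP : 0 < P := by positivity
  have hPx : P ≤ x := by
    calc P ≤ x ^ 1 := pow_le_pow_of_le_one hx.le hy1 (by omega)
      _ = x := pow_one x
  have hxP : x * P = x ^ m := by rw [hPd, ← pow_succ']; congr 1; omega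
  set s := radialCoeff ψ y with hsd
  have hs : s = x ^ 2 * P * ψ (angle y) := by
    rw [hsd, radialCoeff, hPd, ← pow_add]; congr 2; omega
  have hψp := (hψ0 y hy).le
  have hψC : ψ (angle y) ≤ C := ((le_abs_self _).trans (hψb y hy).1).trans (le_max_left _ _)
  obtain ⟨s0, s1, -, -⟩ := radial_small hx hy1 hP hPx hψp hψC hs
  have hx' : ‖radialMap ψ y‖ = (1 + s) * x := norm_radialMap hψ0 hy
  set ρ := tensorNorm (productMetric y) (toTensor (expansionError A μ y))
  have hR : ∀ a c, |bilOf (expansionError A μ y) (prodFrame b x a) (prodFrame b x c)| ≤ ρ :=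
    fun a c => abs_bilOf_le_tensorNorm hy hb _ a c
  have hρ : 0 ≤ ρ := (abs_nonneg _).trans (hR 0 0)
  have hiy : ∀ a, inner ℝ y (prodFrame b x a) = if a = 0 then x else 0 := fun a => by
    rw [prodFrame, inner_smul_right, inner_frame hy hb]
    split_ifs <;> simp [x]
  have hbump : ∀ a c, bilOf (radialBump (fun θ => 2 * N * ψ θ) X y) (prodFrame b x a)
      (prodFrame b x c) = P * (2 * N * ψ (angle y)) * X (x ^ 2)
        * ((if a = 0 then 1 else 0) * (if c = 0 then 1 else 0)) := fun a c => by
    rw [radialBump, bilOf_smul, bilOf_dxSq, hiy, hiy]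
    split_ifs <;> simp [x, P]
    field_simp
  have hG : ∀ a c, bilOf (A + radialBump (fun θ => 2 * N * ψ θ) X y) (prodFrame b x a)
      (prodFrame b x c) = bilOf (hyperbolicMetric y) (prodFrame b x a) (prodFrame b x c)
      + P * bilOf (pullbackSphereTensor μ y) (prodFrame b x a) (prodFrame b x c)
      + bilOf (expansionError A μ y) (prodFrame b x a) (prodFrame b x c)
      + P * (2 * N * ψ (angle y)) * X (x ^ 2)
        * ((if a = 0 then 1 else 0) * (if c = 0 then 1 else 0)) := fun a c => by
    rw [bilOf_add, hbump, bilOf_expansionError A μ y]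
  set R := fun a c => bilOf (expansionError A μ y) (prodFrame b x a) (prodFrame b x c)
  -- These are the components of the perturbed metric in the frame at `y`. Those of `A'` in the
  -- frame at `radialMap ψ y` follow by inserting the preimages of its vectors, in which the `κ a`
  -- are the radial corrections.
  have G00 : bilOf (A + radialBump (fun θ => 2 * N * ψ θ) X y) (prodFrame b x 0)
      (prodFrame b x 0) = (x ^ 2)⁻¹ + R 0 0 + P * (2 * N * ψ (angle y)) * X (x ^ 2) := by
    rcases m with _ | m
    · omega
    rw [hG, (bilOf_hyperbolicMetric_frame hy hb 0 0).1, (bilOf_pullback_frame hy hb hμ 0 0).1]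
    simp only [if_pos, R]; ring
  have G0 : ∀ c : Fin m, bilOf (A + radialBump (fun θ => 2 * N * ψ θ) X y) (prodFrame b x 0)
      (prodFrame b x c.succ) = R 0 c.succ := fun c => by
    rw [hG, (bilOf_hyperbolicMetric_frame hy hb c c).2.1, (bilOf_pullback_frame hy hb hμ c c).2.1]
    simp only [if_pos, R, Fin.succ_ne_zero, if_false]; ring
  have G1 : ∀ c : Fin m, bilOf (A + radialBump (fun θ => 2 * N * ψ θ) X y) (prodFrame b x c.succ)
      (prodFrame b x 0) = R c.succ 0 := fun c => by
    rw [hG, (bilOf_hyperbolicMetric_frame hy hb c c).2.2.1,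
      (bilOf_pullback_frame hy hb hμ c c).2.2.1]
    simp only [if_pos, R, Fin.succ_ne_zero, if_false]; ring
  have G2 : ∀ a c : Fin m, bilOf (A + radialBump (fun θ => 2 * N * ψ θ) X y)
      (prodFrame b x a.succ) (prodFrame b x c.succ)
      = ((x ^ 2)⁻¹ - 1 / 2 + x ^ 2 / 16) * (if a = c then 1 else 0)
        + P * bilOf (μ (angle y)) (b a.succ) (b c.succ) + R a.succ c.succ := fun a c => by
    rw [hG, (bilOf_hyperbolicMetric_frame hy hb a c).2.2.2,
      (bilOf_pullback_frame hy hb hμ a c).2.2.2]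
    simp only [R, Fin.succ_ne_zero, if_false]; ring
  have hκ' : ∀ a, |κ a| ≤ C * (x ^ 3 * P) := fun a => by
    have : x ^ (m + 2) = x ^ 3 * P := by rw [hPd, ← pow_add]; congr 1; omega
    rw [← this]; exact hκ a
  have hBB : ∀ {u v : ℝ}, u ≤ B → v ≤ B → u * ρ + v * (x * P) ≤ B * (ρ + x ^ m) := by
    intro u v hu hv
    rw [mul_add, ← hxP]
    exact add_le_add (mul_le_mul_of_nonneg_right hu hρ)
      (mul_le_mul_of_nonneg_right hv (by positivity))
  have k0 : 1 + 2 * C + C ^ 2 ≤ B := le_max_left _ _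
  have k1 : B₁ ≤ B := (le_max_left _ _).trans (le_max_right _ _)
  have k2 : B₂ ≤ B := ((le_max_left _ _).trans (le_max_right _ _)).trans (le_max_right _ _)
  have k3 : B₃ ≤ B := ((le_max_right _ _).trans (le_max_right _ _)).trans (le_max_right _ _)
  have hB : 0 ≤ B := (by positivity : 0 ≤ 1 + 2 * C + C ^ 2).trans k0
  set α := (1 + (N + 1) * s)⁻¹ with hαd
  have hα : |α| ≤ 1 := by
    rw [abs_of_nonneg (by positivity)]
    exact inv_le_one_of_one_le₀ (le_add_of_nonneg_right (by positivity))
  -- The sphere tensor is now weighted with a power of the new radius; replacing it by the old one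
  -- costs only `O(x P)`.
  have hpow : |((1 + s) * x) ^ (m + 1 - 2) - P| ≤ L * (x * P) := by
    have e : ((1 + s) * x) ^ (m + 1 - 2) - P = ((1 + s) ^ (m - 1) - 1) * P := by
      rw [mul_pow, hPd, show m + 1 - 2 = m - 1 by omega]; ring
    have h1 : 1 ≤ (1 + s) ^ (m - 1) := one_le_pow₀ (by linarith)
    have h2 := one_add_pow_le s0 (m - 1)
    have h3 : s ≤ C := s1.trans (mul_le_of_le_one_right hC hy1)
    rw [e, abs_of_nonneg (mul_nonneg (by linarith) hP.le)]
    calc _ ≤ ((m - 1 : ℕ) * s * (1 + s) ^ (m - 1)) * P := by gcongr; linarith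
      _ ≤ ((m - 1 : ℕ) * (C * x) * (1 + C) ^ (m - 1)) * P := by gcongr
      _ = L * (x * P) := by simp only [L]; ring
  have hrev := bilOf_expansionError A' (shiftTensor μ ψ) (radialMap ψ y)
  have e00 : |bilOf (expansionError A' (shiftTensor μ ψ) (radialMap ψ y))
      (prodFrame b ‖radialMap ψ y‖ 0) (prodFrame b ‖radialMap ψ y‖ 0)| ≤ B * (ρ + x ^ m) := by
    have h1 := hrev (prodFrame b ‖radialMap ψ y‖ 0) (prodFrame b ‖radialMap ψ y‖ 0)
    have c0 : Fin m := ⟨0, by omega⟩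
    rw [(bilOf_hyperbolicMetric_frame hy' hb' c0 c0).1, (bilOf_pullback_frame hy' hb' hμ' c0 c0).1,
      ← hu0, hA, map_smul, map_smul, smul_apply, G00, smul_eq_mul, smul_eq_mul, hu0, hx'] at h1
    have h := radial_component_bound hx hy1 hP hPx hψp hψC hs hN (K := K) hX0 hX1 hXK (hR 0 0)
    have e : bilOf (expansionError A' (shiftTensor μ ψ) (radialMap ψ y))
      (prodFrame b ‖radialMap ψ y‖ 0) (prodFrame b ‖radialMap ψ y‖ 0)
      = ((1 + (N + 1) * s) ^ 2)⁻¹ * ((x ^ 2)⁻¹ + R 0 0 + P * (2 * N * ψ (angle y)) * X (x ^ 2))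
        - (((1 + s) * x) ^ 2)⁻¹ := by
      rw [sq (1 + (N + 1) * s), mul_inv, ← hαd]
      rw [hx']
      linear_combination -h1
    rw [e]
    have h3 := hBB (u := 1) (by linarith only [k0, hC, sq_nonneg C]) k1
    rw [one_mul] at h3
    exact h.trans h3
  have e0 : ∀ c : Fin m, |α * (R 0 c.succ - κ c * ((x ^ 2)⁻¹ + R 0 0
      + P * (2 * N * ψ (angle y)) * X (x ^ 2)))| ≤ B * (ρ + x ^ m) := fun c =>
    (mixed_component_bound hx hy1 hP hPx hψp hψC hN hC hα hX0 hX1 (hR 0 c.succ) (hR 0 0)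
      (hκ' c)).trans (hBB (by linarith only [k0, hC, sq_nonneg C]) k3)
  have e1 : ∀ c : Fin m, |α * (R c.succ 0 - κ c * ((x ^ 2)⁻¹ + R 0 0
      + P * (2 * N * ψ (angle y)) * X (x ^ 2)))| ≤ B * (ρ + x ^ m) := fun c =>
    (mixed_component_bound hx hy1 hP hPx hψp hψC hN hC hα hX0 hX1 (hR c.succ 0) (hR 0 0)
      (hκ' c)).trans (hBB (by linarith only [k0, hC, sq_nonneg C]) k3)
  refine (tensorNorm_le_of_frame hy' hb' (by positivity) fun a c => ?_).trans_eq
    (mul_assoc _ _ _).symm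
  refine Fin.cases ?_ (fun a => ?_) a <;> refine Fin.cases ?_ (fun c => ?_) c
  · exact e00
  · have h1 := hrev (prodFrame b ‖radialMap ψ y‖ 0) (prodFrame b ‖radialMap ψ y‖ c.succ)
    have v1 := (bilOf_hyperbolicMetric_frame hy' hb' c c).2.1
    have v2 := (bilOf_pullback_frame hy' hb' hμ' c c).2.1
    have h2 := hA (α • prodFrame b x 0) (prodFrame b x c.succ - κ c • prodFrame b x 0)
    rw [hu0, hu] at h2
    simp only [map_smul, map_sub, smul_apply, smul_eq_mul, G00, G0] at h2
    have e : bilOf (expansionError A' (shiftTensor μ ψ) (radialMap ψ y))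
        (prodFrame b ‖radialMap ψ y‖ 0) (prodFrame b ‖radialMap ψ y‖ c.succ)
        = α * (R 0 c.succ - κ c * ((x ^ 2)⁻¹ + R 0 0
          + P * (2 * N * ψ (angle y)) * X (x ^ 2))) := by
      rw [v1, v2, h2] at h1
      linear_combination -h1
    rw [e]
    exact e0 c
  · have h1 := hrev (prodFrame b ‖radialMap ψ y‖ a.succ) (prodFrame b ‖radialMap ψ y‖ 0)
    have v1 := (bilOf_hyperbolicMetric_frame hy' hb' a a).2.2.1
    have v2 := (bilOf_pullback_frame hy' hb' hμ' a a).2.2.1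
    have h2 := hA (prodFrame b x a.succ - κ a • prodFrame b x 0) (α • prodFrame b x 0)
    rw [hu0, hu] at h2
    simp only [map_smul, map_sub, smul_apply, sub_apply, smul_eq_mul, G00, G1] at h2
    have e : bilOf (expansionError A' (shiftTensor μ ψ) (radialMap ψ y))
        (prodFrame b ‖radialMap ψ y‖ a.succ) (prodFrame b ‖radialMap ψ y‖ 0)
        = α * (R a.succ 0 - κ a * ((x ^ 2)⁻¹ + R 0 0
          + P * (2 * N * ψ (angle y)) * X (x ^ 2))) := by
      rw [v1, v2, h2] at h1
      linear_combination -h1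
    rw [e]
    exact e1 a
  · have h1 := hrev (prodFrame b ‖radialMap ψ y‖ a.succ) (prodFrame b ‖radialMap ψ y‖ c.succ)
    have v1 := (bilOf_hyperbolicMetric_frame hy' hb' a c).2.2.2
    have v2 := (bilOf_pullback_frame hy' hb' hμ' a c).2.2.2
    rw [angle_radialMap hψ0 hy, bilOf_shiftTensor_frame hb] at v2
    have h2 := hA (prodFrame b x a.succ - κ a • prodFrame b x 0)
      (prodFrame b x c.succ - κ c • prodFrame b x 0)
    rw [hu, hu] at h2
    simp only [map_smul, map_sub, smul_apply, sub_apply, smul_eq_mul, G00, G0, G1, G2] at h2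
    set δ : ℝ := if a = c then 1 else 0 with hδd
    have hδ : |δ| ≤ 1 := by rw [hδd]; split_ifs <;> simp
    have h := tangential_component_bound hx hy1 hP hPx hψp hψC hs hC hN hX0 hX1 hpow
      ((hμb y hy _ _ (b.norm_eq_one a.succ) (b.norm_eq_one c.succ)).trans (le_max_right C₁ C₂)) hδ
      (hR a.succ c.succ) (hR 0 c.succ) (hR a.succ 0) (hR 0 0) (hκ' a) (hκ' c)
    refine le_trans (le_of_eq ?_) (h.trans (hBB k0 k2))
    rw [v1, v2, h2, hx'] at h1
    rw [hx']
    congr 1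
    linear_combination -h1

end Pointwise

lemma tensorNorm_nonneg {n k : ℕ} {A : Matrix (Fin n) (Fin n) ℝ} {t : (Fin k → Fin n) → ℝ} :
    0 ≤ tensorNorm A t := Real.sqrt_nonneg _

/-! ### The asymptotic expansion in the new chart -/

section Manifold

variable {m : ℕ} {M : Type*} [TopologicalSpace M] [ChartedSpace (E (m + 1)) M]
  [IsManifold 𝓘(ℝ, E (m + 1)) ∞ M] {ψ : E (m + 1) → ℝ} {x₀ : ℝ}
  {φ : OpenPartialHomeomorph M (E (m + 1))}

/-- Close to infinity the cutoff equals `exp (-K x²)`, so `1 - X ≤ K x`, as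
`exists_expansionError_bound` requires. Its bound is the old remainder, which is `o(xⁿ⁻²)`, plus
`xⁿ⁻¹`; as the old radius is at most the new one, both are `o` of the power of the new radius. -/
theorem hasExpansion_radialChart (hm : 2 ≤ m)
    (hψ : ContDiffOn ℝ ∞ (fun y => ψ (angle y)) {0}ᶜ) (hψ0 : ∀ y, y ≠ 0 → 0 < ψ (angle y))
    (hφ : IsEndChart x₀ φ) (hx₀ : 0 < x₀) {k : ℕ∞} {g g' : RMetric (m + 1) k M}
    {μ : E (m + 1) → Matrix (Fin (m + 1)) (Fin (m + 1)) ℝ}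
    (hμ : HasExpansion (coordMetric φ g) μ) {K ε : ℝ} (hK : 0 ≤ K) (hε : 0 < ε)
    (hg' : ∀ y ∈ collar (m + 1) x₀, coordMetric φ g' y = coordMetric φ g y
      + radialBump (fun θ => 2 * (m + 1 : ℕ) * ψ θ) (radialCutoff K ε) y) :
    HasExpansion (coordMetric (radialChart φ hψ hψ0 x₀) g') (shiftTensor μ ψ) := by
  have hψ2 : ContDiffOn ℝ 2 (fun y => ψ (angle y)) {0}ᶜ := hψ.of_le (WithTop.coe_le_coe.2 le_top)
  refine ⟨hμ.tensor.shiftTensor hψ2, ?_⟩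
  obtain ⟨C, hC⟩ := exists_expansionError_bound hm hψ2 hψ0 hμ.tensor (K := K)
  set D := |C| + 1
  have hD : 0 < D := by positivity
  rw [Asymptotics.isLittleO_iff]
  intro c hc
  have h1 := (Asymptotics.isLittleO_iff.1 hμ.remainder) (by positivity : 0 < c / (2 * D))
  rw [eventually_nhdsWithin_iff, Metric.eventually_nhds_iff] at h1
  obtain ⟨r, hr, h1⟩ := h1
  set r' := min r (min (c / (2 * D)) (min x₀ (min 1 ε)))
  have hr' : 0 < r' := by positivity
  rw [eventually_nhdsWithin_iff, Metric.eventually_nhds_iff]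
  refine ⟨r', hr', fun y' hy' hne => ?_⟩
  rw [dist_zero_right] at hy'
  simp only [r', lt_min_iff] at hy'
  obtain ⟨q1, q2, q3, q4, q5⟩ := hy'
  obtain ⟨y, hy, rfl⟩ := exists_radialMap_eq hψ0 hne
  have hle := le_norm_radialMap hψ0 hy
  have hpos : 0 < ‖y‖ := norm_pos_iff.2 hy
  have hy1 : ‖y‖ ≤ 1 := hle.trans q4.le
  have hT := h1 (y := y) (by rw [dist_zero_right]; exact hle.trans_lt q1) hy
  have hsq : ‖y‖ ^ 2 ≤ ε ^ 2 := pow_le_pow_left₀ hpos.le (hle.trans q5.le) 2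
  have hb := hC (radialCutoff K ε) (coordMetric φ g y)
    (coordMetric (radialChart φ hψ hψ0 x₀) g' (radialMap ψ y)) y hy hy1 radialCutoff_nonneg
    (radialCutoff_le_one hK (by positivity)) (by
      rw [radialCutoff_of_le hε hsq]
      have e1 := Real.add_one_le_exp (-(K * ‖y‖ ^ 2))
      have e2 : K * ‖y‖ ^ 2 ≤ K * ‖y‖ := by
        gcongr
        rw [sq]; exact mul_le_of_le_one_left hpos.le hy1
      linarith) (fun u v => by
      rw [bilOf_coordMetric_radialChart hψ hψ0 hφ g' hy q3, hg' y ⟨hpos, hle.trans_lt q3⟩])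
  have hN0 : 0 ≤ tensorNorm (productMetric y)
      (toTensor (expansionError (coordMetric φ g y) μ y)) := tensorNorm_nonneg
  change ‖tensorNorm _ (toTensor (expansionError (coordMetric φ g y) μ y))‖ ≤ _ at hT
  change ‖tensorNorm _ (toTensor (expansionError (coordMetric (radialChart φ hψ hψ0 x₀) g'
    (radialMap ψ y)) (shiftTensor μ ψ) (radialMap ψ y)))‖ ≤ _
  rw [Real.norm_of_nonneg tensorNorm_nonneg, Real.norm_of_nonneg (by positivity)] at hT ⊢
  refine hb.trans ?_
  have hmm : ‖y‖ ^ m = ‖y‖ * ‖y‖ ^ (m + 1 - 2) := by rw [← pow_succ']; congr 1; omega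
  calc _ ≤ D * (tensorNorm (productMetric y)
        (toTensor (expansionError (coordMetric φ g y) μ y)) + ‖y‖ ^ m) := by
        gcongr
        exact (le_abs_self C).trans (by simp [D])
    _ ≤ D * (c / (2 * D) * ‖y‖ ^ (m + 1 - 2) + c / (2 * D) * ‖y‖ ^ (m + 1 - 2)) := by
        rw [hmm]
        gcongr
        exact hle.trans q2.le
    _ = c * ‖y‖ ^ (m + 1 - 2) := by field_simp; ring
    _ ≤ _ := by gcongr

end Manifold

/-! ### Positive functions on the sphere with prescribed moments -/

section Moments

variable {n : ℕ}

/-- The restriction to the sphere of an affine function. -/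
def affineFun (p : Fin (n + 1) → ℝ) (θ : E n) : ℝ := p 0 + ∑ i, p i.succ * θ i

/-- The integrals of a function on the sphere against `1` and the coordinates. -/
def moments (a : E n → ℝ) : Fin (n + 1) → ℝ :=
  Fin.cons (∫ θ : Metric.sphere (0 : E n) 1, a θ.1 ∂(volume : Measure (E n)).toSphere)
    fun i => ∫ θ : Metric.sphere (0 : E n) 1, a θ.1 * θ.1 i ∂(volume : Measure (E n)).toSphere

lemma contDiff_affineFun (p : Fin (n + 1) → ℝ) : ContDiff ℝ ∞ (affineFun p : E n → ℝ) := by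
  unfold affineFun; fun_prop

lemma integrable_sphere {f : Metric.sphere (0 : E n) 1 → ℝ} (hf : Continuous f) :
    Integrable f (volume : Measure (E n)).toSphere :=
  hf.integrable_of_hasCompactSupport (HasCompactSupport.of_compactSpace f)

lemma integral_sphere_pos {f : Metric.sphere (0 : E n) 1 → ℝ} (hf : Continuous f)
    (h0 : ∀ θ, 0 ≤ f θ) {θ₀ : Metric.sphere (0 : E n) 1} (h : f θ₀ ≠ 0) :
    0 < ∫ θ, f θ ∂(volume : Measure (E n)).toSphere :=
  hf.integral_pos_of_hasCompactSupport_nonneg_nonzero (HasCompactSupport.of_compactSpace f) h0 h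

lemma sum_mul_moments {a : E n → ℝ} (ha : Continuous a) (p : Fin (n + 1) → ℝ) :
    ∑ j, p j * moments a j = ∫ θ : Metric.sphere (0 : E n) 1, a θ.1 * affineFun p θ.1
      ∂(volume : Measure (E n)).toSphere := by
  have h1 : Continuous fun θ : Metric.sphere (0 : E n) 1 => a θ.1 := ha.comp continuous_subtype_val
  have h2 : ∀ i, Continuous fun θ : Metric.sphere (0 : E n) 1 => θ.1 i := fun i => by fun_prop
  have e : ∀ θ : Metric.sphere (0 : E n) 1, a θ.1 * affineFun p θ.1
      = p 0 * a θ.1 + ∑ i, p i.succ * (a θ.1 * θ.1 i) := fun θ => by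
    rw [affineFun, mul_add, Finset.mul_sum]
    congr 1
    · ring
    · exact Finset.sum_congr rfl fun i _ => by ring
  simp only [e]
  have h3 : ∀ i : Fin n, Integrable (fun θ : Metric.sphere (0 : E n) 1 =>
      p i.succ * (a θ.1 * θ.1 i)) (volume : Measure (E n)).toSphere := fun i =>
    (integrable_sphere (h1.mul (h2 i))).const_mul _
  rw [integral_add ((integrable_sphere h1).const_mul _) (integrable_finsetSum _ fun i _ => h3 i),
    integral_finsetSum _ fun i _ => h3 i, integral_const_mul, Fin.sum_univ_succ]
  simp only [integral_const_mul, moments, Fin.cons_zero, Fin.cons_succ]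

lemma moments_combo {a b : E n → ℝ} (ha : Continuous a) (hb : Continuous b) (r s : ℝ) :
    moments (fun θ => r * a θ + s * b θ) = r • moments a + s • moments b := by
  have key : ∀ p : Fin (n + 1) → ℝ, ∑ j, p j * moments (fun θ => r * a θ + s * b θ) j
      = ∑ j, p j * (r • moments a + s • moments b) j := by
    intro p
    have e : ∑ j, p j * (r • moments a + s • moments b) j
        = r * ∑ j, p j * moments a j + s * ∑ j, p j * moments b j := by
      rw [Finset.mul_sum, Finset.mul_sum, ← Finset.sum_add_distrib]
      exact Finset.sum_congr rfl fun j _ => by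
        simp only [Pi.add_apply, Pi.smul_apply, smul_eq_mul]; ring
    have hp := (contDiff_affineFun p).continuous
    have h1 : Continuous fun θ : Metric.sphere (0 : E n) 1 => a θ.1 * affineFun p θ.1 :=
      (ha.mul hp).comp continuous_subtype_val
    have h2 : Continuous fun θ : Metric.sphere (0 : E n) 1 => b θ.1 * affineFun p θ.1 :=
      (hb.mul hp).comp continuous_subtype_val
    rw [e, sum_mul_moments (by fun_prop), sum_mul_moments ha, sum_mul_moments hb,
      ← integral_const_mul, ← integral_const_mul, ← integral_add
        ((integrable_sphere h1).const_mul _) ((integrable_sphere h2).const_mul _)]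
    exact integral_congr_ae (Filter.Eventually.of_forall fun θ => by ring)
  funext i
  have := key (Pi.single i 1)
  simpa [Pi.single_apply] using this

lemma affineFun_eq_zero [NeZero n] {p : Fin (n + 1) → ℝ}
    (h : ∀ θ : E n, ‖θ‖ = 1 → affineFun p θ = 0) : p = 0 := by
  have h1 : ∀ i : Fin n, p 0 + p i.succ = 0 := fun i => by
    have := h (EuclideanSpace.single i 1) (by simp)
    simpa [affineFun, PiLp.single_apply] using this
  have h2 : ∀ i : Fin n, p 0 - p i.succ = 0 := fun i => by
    have := h (-EuclideanSpace.single i 1) (by simp)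
    simpa [affineFun, PiLp.single_apply, sub_eq_add_neg] using this
  have h0 : p 0 = 0 := by linarith [h1 0, h2 0]
  funext j
  refine Fin.cases h0 (fun i => ?_) j
  have := h1 i
  simp only [Pi.zero_apply]; linarith

/-- The moments of the smooth positive functions on the sphere. -/
def momentCone (n : ℕ) : Set (Fin (n + 1) → ℝ) :=
  {v | ∃ a : E n → ℝ, ContDiff ℝ ∞ a ∧ (∀ θ, ‖θ‖ = 1 → 0 < a θ) ∧ moments a = v}

lemma smul_mem_momentCone {v : Fin (n + 1) → ℝ} (hv : v ∈ momentCone n) {r : ℝ} (hr : 0 < r) :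
    r • v ∈ momentCone n := by
  obtain ⟨a, ha, ha0, rfl⟩ := hv
  refine ⟨fun θ => r * a θ + 0 * a θ, by fun_prop, fun θ hθ => ?_, ?_⟩
  · have := ha0 θ hθ
    positivity
  · rw [moments_combo ha.continuous ha.continuous]; simp

lemma convex_momentCone : Convex ℝ (momentCone n) := by
  rintro _ ⟨a, ha, ha0, rfl⟩ _ ⟨b, hb, hb0, rfl⟩ r s hr hs hrs
  refine ⟨fun θ => r * a θ + s * b θ, by fun_prop, fun θ hθ => ?_,
    moments_combo ha.continuous hb.continuous r s⟩
  have h1 := ha0 θ hθ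
  have h2 := hb0 θ hθ
  rcases hr.eq_or_lt with rfl | hr
  · have : s = 1 := by linarith
    subst this; linarith
  · positivity

/-- The linear map taking the coefficients of an affine function to its moments is injective, since
pairing the moments with the coefficients gives the integral of the square. It is therefore an
isomorphism, and it carries the open set of affine functions with `p 0 > ∑ |pᵢ|`, which are positive
on the sphere, to an open set of moments. -/
lemma interior_momentCone_nonempty [NeZero n] : (interior (momentCone n)).Nonempty := by
  have hc : ∀ p, Continuous (affineFun p : E n → ℝ) := fun p => (contDiff_affineFun p).continuous
  have hlin : ∀ (r s : ℝ) (p q : Fin (n + 1) → ℝ) (θ : E n),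
      affineFun (r • p + s • q) θ = r * affineFun p θ + s * affineFun q θ := fun r s p q θ => by
    simp only [affineFun, Pi.add_apply, Pi.smul_apply, smul_eq_mul, mul_add, Finset.mul_sum,
      add_mul, Finset.sum_add_distrib, mul_assoc]
    ring
  let A : (Fin (n + 1) → ℝ) →ₗ[ℝ] (Fin (n + 1) → ℝ) :=
    { toFun := fun p => moments (affineFun p)
      map_add' := fun p q => by
        have := moments_combo (hc p) (hc q) 1 1
        rw [one_smul, one_smul] at this
        rw [← this]
        congr 1; funext θ
        have := hlin 1 1 p q θ
        rwa [one_smul, one_smul] at this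
      map_smul' := fun r p => by
        have := moments_combo (hc p) (hc p) r 0
        rw [zero_smul, add_zero] at this
        rw [RingHom.id_apply, ← this]
        congr 1; funext θ
        have := hlin r 0 p p θ
        rwa [zero_smul, add_zero] at this }
  have hA : Function.Injective A := by
    rw [← LinearMap.ker_eq_bot, LinearMap.ker_eq_bot']
    intro p hp
    by_contra hne
    have hex : ∃ θ : E n, ‖θ‖ = 1 ∧ affineFun p θ ≠ 0 := by
      by_contra! hcon
      exact hne (affineFun_eq_zero hcon)
    obtain ⟨θ₀, h1, h2⟩ := hex
    have h3 := sum_mul_moments (hc p) p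
    have h4 : moments (affineFun p : E n → ℝ) = 0 := hp
    have h5 : Continuous fun θ : Metric.sphere (0 : E n) 1 => affineFun p θ.1 * affineFun p θ.1 :=
      ((hc p).mul (hc p)).comp continuous_subtype_val
    have h6 := integral_sphere_pos h5 (fun θ => mul_self_nonneg _)
      (θ₀ := ⟨θ₀, by simpa using h1⟩) (mul_self_ne_zero.2 h2)
    rw [← h3, h4] at h6
    simp at h6
  let e := (LinearEquiv.ofInjectiveEndo A hA).toContinuousLinearEquiv
  have hU : IsOpen {p : Fin (n + 1) → ℝ | ∑ i : Fin n, |p i.succ| < p 0} :=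
    isOpen_lt (by fun_prop) (by fun_prop)
  refine ⟨e (Pi.single 0 1), mem_interior.2 ⟨e '' {p | ∑ i : Fin n, |p i.succ| < p 0}, ?_,
    e.toHomeomorph.isOpenMap _ hU, Set.mem_image_of_mem _ ?_⟩⟩
  · rintro _ ⟨p, hp, rfl⟩
    refine ⟨affineFun p, contDiff_affineFun p, fun θ hθ => ?_, rfl⟩
    have hp' : ∑ i : Fin n, |p i.succ| < p 0 := hp
    have h1 : -∑ i : Fin n, |p i.succ| ≤ ∑ i, p i.succ * θ i := by
      rw [← Finset.sum_neg_distrib]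
      refine Finset.sum_le_sum fun i _ => ?_
      have h2 : |θ i| ≤ 1 := by rw [← hθ]; exact PiLp.norm_apply_le θ i
      have h3 : |p i.succ * θ i| ≤ |p i.succ| := by
        rw [abs_mul]; exact mul_le_of_le_one_right (abs_nonneg _) h2
      exact (abs_le.1 h3).1.trans' (by simp)
    rw [affineFun]; linarith
  · simp

/-- Every future timelike vector is the vector of moments of a smooth positive function. -/
theorem mem_momentCone_of_timelike [NeZero n] {v : Fin (n + 1) → ℝ} (h0 : 0 < v 0)
    (hv : ∑ i : Fin n, v i.succ ^ 2 < v 0 ^ 2) : v ∈ momentCone n := by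
  by_contra hnot
  -- If `v` were not a moment vector, a nonzero functional would separate it from the convex cone.
  -- Nonempty interior is what permits separation without the cone being closed or open.
  obtain ⟨f, u, hf0, hfC, hfv⟩ := geometric_hahn_banach_of_nonempty_interior
    (convex_momentCone (n := n)) (convex_singleton v)
    (Set.disjoint_singleton_right.2 fun h => hnot (interior_subset h))
    interior_momentCone_nonempty (Set.singleton_nonempty v)
  have hfv := hfv v rfl
  set p : Fin (n + 1) → ℝ := fun j => f (Pi.single j 1)
  have hfp : ∀ w, f w = ∑ j, p j * w j := fun w => by
    have hw : w = ∑ j, w j • (Pi.single j (1 : ℝ) : Fin (n + 1) → ℝ) := by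
      funext i; simp [Finset.sum_apply, Pi.single_apply]
    conv_lhs => rw [hw, map_sum]
    exact Finset.sum_congr rfl fun j _ => by rw [map_smul, smul_eq_mul, mul_comm]
  -- Scaling invariance of the cone: a positive value could be scaled up beyond `u`. Likewise, in
  -- `hunon`, a negative `u` could be passed by scaling down.
  have hneg : ∀ w ∈ momentCone n, f w ≤ 0 := by
    intro w hw
    by_contra! hpos
    have hu : 0 < u := hpos.trans_le (hfC w hw)
    have h1 := hfC _ (smul_mem_momentCone hw (by positivity : 0 < (u + 1) / f w))
    rw [map_smul, smul_eq_mul, div_mul_cancel₀ _ hpos.ne'] at h1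
    linarith
  have hunon : 0 ≤ u := by
    obtain ⟨w, hw⟩ := interior_momentCone_nonempty (n := n)
    have hw := interior_subset hw
    by_contra! hu
    have hfw : f w < 0 := (hfC w hw).trans_lt hu
    have h1 := hfC _ (smul_mem_momentCone hw (by
      exact div_pos_of_neg_of_neg (by linarith : u / 2 < 0) hfw))
    rw [map_smul, smul_eq_mul, div_mul_cancel₀ _ hfw.ne] at h1
    linarith
  -- Where the affine function `p` is positive, its smooth transition serves as a weight
  -- concentrated on that set; adding a small constant `η` makes it strictly positive, hence
  -- admissible, while `f` of its moments stays positive.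
  have hle : ∀ θ : E n, ‖θ‖ = 1 → affineFun p θ ≤ 0 := by
    intro θ₀ hθ₀
    by_contra! hpos
    have hc := (contDiff_affineFun p : ContDiff ℝ ∞ (affineFun p : E n → ℝ))
    have hst : ContDiff ℝ ∞ fun θ : E n => Real.smoothTransition (affineFun p θ) :=
      Real.smoothTransition.contDiff.comp hc
    have hI := integral_sphere_pos (n := n)
      (f := fun θ => Real.smoothTransition (affineFun p θ.1) * affineFun p θ.1)
      ((hst.continuous.mul hc.continuous).comp continuous_subtype_val) (fun θ => by
        rcases le_or_gt (affineFun p θ.1) 0 with h | h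
        · simp [Real.smoothTransition.zero_of_nonpos h]
        · exact mul_nonneg (Real.smoothTransition.nonneg _) h.le)
      (θ₀ := ⟨θ₀, by simpa using hθ₀⟩)
      (mul_pos (Real.smoothTransition.pos_of_pos hpos) hpos).ne'
    rw [← sum_mul_moments hst.continuous, ← hfp] at hI
    have h1 : ∀ η : ℝ, 0 < η → f (moments fun θ : E n => Real.smoothTransition (affineFun p θ))
        + η * f (moments fun _ : E n => (1 : ℝ)) ≤ 0 := by
      intro η hη
      have := hneg _ ⟨fun θ => 1 * Real.smoothTransition (affineFun p θ) + η * 1,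
        by fun_prop, fun θ _ => by
          have := Real.smoothTransition.nonneg (affineFun p θ)
          linarith, rfl⟩
      rw [moments_combo hst.continuous continuous_const, map_add, map_smul, map_smul] at this
      simpa using this
    set I := f (moments fun θ : E n => Real.smoothTransition (affineFun p θ))
    set J := f (moments fun _ : E n => (1 : ℝ))
    have h2 := h1 (I / (2 * (|J| + 1))) (by positivity)
    have h3 : I / (2 * (|J| + 1)) * |J| ≤ I / 2 := by
      rw [div_mul_eq_mul_div, div_le_div_iff₀ (by positivity) (by positivity)]
      nlinarith [abs_nonneg J]
    have h4 : -(I / (2 * (|J| + 1)) * |J|) ≤ I / (2 * (|J| + 1)) * J := by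
      rw [← mul_neg]
      exact mul_le_mul_of_nonneg_left (neg_abs_le J) (by positivity)
    linarith
  set q : E n := WithLp.toLp 2 fun i => p i.succ
  have hqv : ∑ i : Fin n, p i.succ * v i.succ ≤ ‖q‖ * √(∑ i : Fin n, v i.succ ^ 2) := by
    have h := real_inner_le_norm q (WithLp.toLp 2 fun i : Fin n => v i.succ)
    rw [inner_eq_sum, EuclideanSpace.norm_eq (WithLp.toLp 2 fun i : Fin n => v i.succ)] at h
    simpa [q] using h
  -- The left side is the maximum of the affine function on the sphere, attained in the direction of
  -- `q`; for `q = 0` any unit vector will do.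
  have hp0 : p 0 + ‖q‖ ≤ 0 := by
    by_cases hq : q = 0
    · have h1 := hle (EuclideanSpace.single 0 1) (by simp)
      have h2 : ∀ i : Fin n, p i.succ = 0 := fun i => congrArg (fun z : E n => z i) hq
      rw [affineFun] at h1
      simp only [h2, zero_mul, Finset.sum_const_zero, add_zero] at h1
      simpa [hq] using h1
    · have h1 := hle (‖q‖⁻¹ • q) (norm_smul_inv_norm hq)
      have h2 : ∑ i, p i.succ * (‖q‖⁻¹ • q) i = ‖q‖ := by
        have : ∑ i, p i.succ * (‖q‖⁻¹ • q) i = inner ℝ q (‖q‖⁻¹ • q) := by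
          rw [inner_eq_sum]
        rw [this, inner_smul_right, real_inner_self_eq_norm_sq]
        field_simp
      rwa [affineFun, h2] at h1
  have hs : √(∑ i : Fin n, v i.succ ^ 2) < v 0 := (Real.sqrt_lt' h0).2 hv
  have hfv' : 0 ≤ p 0 * v 0 + ∑ i : Fin n, p i.succ * v i.succ := by
    rw [← Fin.sum_univ_succ (fun j => p j * v j), ← hfp]; linarith
  -- Were `p 0 < 0`, the bound `‖q‖ ≤ -p 0`, Cauchy–Schwarz and the timelike condition on `v` would
  -- give `f v < 0`. So `p 0 = 0`, then `q = 0`, and `f` vanishes, contrary to the choice of `f`.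
  have hq0 : p 0 = 0 := by
    by_contra hne
    have hlt : p 0 < 0 := lt_of_le_of_ne (by linarith [norm_nonneg q]) hne
    have h1 : ‖q‖ * √(∑ i : Fin n, v i.succ ^ 2) ≤ -p 0 * √(∑ i : Fin n, v i.succ ^ 2) := by
      gcongr; linarith
    nlinarith
  have hq : q = 0 := norm_le_zero_iff.1 (by linarith)
  apply hf0
  ext w
  have h2 : ∀ i : Fin n, p i.succ = 0 := fun i => congrArg (fun z : E n => z i) hq
  rw [hfp, Fin.sum_univ_succ, hq0]
  simp [h2]

end Moments

/-! ### Deformation of the energy-momentum -/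

lemma scalarCurvature_congr {n : ℕ} {G H : E n → Matrix (Fin n) (Fin n) ℝ} {y : E n}
    (h : G =ᶠ[𝓝 y] H) : scalarCurvature G y = scalarCurvature H y := by
  have hpd : ∀ {f f' : E n → ℝ} {z : E n} (i : Fin n), f =ᶠ[𝓝 z] f' → pd i f z = pd i f' z :=
    fun i hf => by rw [pd, pd, hf.fderiv_eq]
  have hchr : ∀ l i j, christoffel G l i j =ᶠ[𝓝 y] christoffel H l i j := fun l i j => by
    filter_upwards [h.eventuallyEq_nhds] with z hz
    have he : ∀ i j, (fun w => G w i j) =ᶠ[𝓝 z] fun w => H w i j := fun i j =>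
      hz.mono fun w hw => congrFun (congrFun hw i) j
    simp only [christoffel, hz.eq_of_nhds, hpd _ (he _ _)]
  simp only [scalarCurvature, ricci, h.eq_of_nhds, hpd _ (hchr _ _ _), (hchr _ _ _).eq_of_nhds]

/-! ### Energy-momentum of the shifted sphere tensor -/

section EnergyMomentum

variable {n : ℕ}

lemma continuous_massAspect {μ : E n → Matrix (Fin n) (Fin n) ℝ} (hμ : IsSphereTensor μ) :
    Continuous fun θ : Metric.sphere (0 : E n) 1 => massAspect μ θ.1 := by
  have h1 : ∀ θ : Metric.sphere (0 : E n) 1, ‖θ.1‖ = 1 := fun θ => by simp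
  unfold massAspect Matrix.trace
  refine continuous_finsetSum _ fun i _ => ?_
  have h := (hμ.contDiffOn i i).continuousOn.comp_continuous
    (f := fun θ : Metric.sphere (0 : E n) 1 => θ.1) continuous_subtype_val fun θ h => by
      have := h1 θ
      rw [Set.mem_singleton_iff.1 h, norm_zero] at this
      exact zero_ne_one this
  refine h.congr fun θ => ?_
  change μ (angle θ.1) i i = μ θ.1 i i
  rw [angle_of_norm_one (h1 θ)]

lemma massAspect_shiftTensor (μ : E n → Matrix (Fin n) (Fin n) ℝ) (ψ : E n → ℝ) {θ : E n}
    (hθ : ‖θ‖ = 1) : massAspect (shiftTensor μ ψ) θ = massAspect μ θ + 2 * (n - 1) * ψ θ := by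
  have h : (dxSq θ).trace = 1 := by
    have : (dxSq θ).trace = ∑ i, θ i * θ i := by
      simp only [Matrix.trace, Matrix.diag_apply, dxSq, Matrix.of_apply, angle_of_norm_one hθ]
    rw [this, ← inner_eq_sum, real_inner_self_eq_norm_sq, hθ]; norm_num
  rw [massAspect, shiftTensor, Matrix.trace_add, Matrix.trace_smul, Matrix.trace_sub, h,
    Matrix.trace_one, massAspect, smul_eq_mul, Fintype.card_fin]
  ring

lemma energyMomentum_shiftTensor {μ : E n → Matrix (Fin n) (Fin n) ℝ} (hμ : IsSphereTensor μ)
    {ψ : E n → ℝ} (hψ : Continuous ψ) (c : ℝ) (j : Fin (n + 1)) :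
    energyMomentum c (shiftTensor μ ψ) j
      = energyMomentum c μ j + 2 * c * (n - 1) * moments ψ j := by
  have h1 : ∀ θ : Metric.sphere (0 : E n) 1, ‖θ.1‖ = 1 := fun θ => by simp
  have hm := continuous_massAspect hμ
  have hψ' : Continuous fun θ : Metric.sphere (0 : E n) 1 => ψ θ.1 := hψ.comp continuous_subtype_val
  have key : ∀ f : Metric.sphere (0 : E n) 1 → ℝ, Continuous f →
      ∫ θ, massAspect (shiftTensor μ ψ) θ.1 * f θ ∂(volume : Measure (E n)).toSphere
        = ∫ θ, massAspect μ θ.1 * f θ ∂(volume : Measure (E n)).toSphere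
          + 2 * (n - 1) * ∫ θ, ψ θ.1 * f θ ∂(volume : Measure (E n)).toSphere := by
    intro f hf
    have i1 : Integrable (fun θ : Metric.sphere (0 : E n) 1 => massAspect μ θ.1 * f θ)
        (volume : Measure (E n)).toSphere := integrable_sphere (hm.mul hf)
    have i2 : Integrable (fun θ : Metric.sphere (0 : E n) 1 => 2 * ((n : ℝ) - 1) * (ψ θ.1 * f θ))
        (volume : Measure (E n)).toSphere := (integrable_sphere (hψ'.mul hf)).const_mul _
    rw [← integral_const_mul, ← integral_add i1 i2]
    refine integral_congr_ae (Filter.Eventually.of_forall fun θ => ?_)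
    simp only [massAspect_shiftTensor μ ψ (h1 θ)]
    ring
  refine Fin.cases ?_ (fun i => ?_) j
  · have := key (fun _ => 1) continuous_const
    simp only [mul_one] at this
    simp only [energyMomentum, moments, Fin.cons_zero, this]
    ring
  · have := key (fun θ => θ.1 i) (by fun_prop)
    simp only [energyMomentum, moments, Fin.cons_succ, this]
    ring

/-- A positive smooth function on the sphere effects a given timelike change of the
energy-momentum. -/
lemma exists_energyMomentum_shiftTensor (hn : 2 ≤ n) {μ : E n → Matrix (Fin n) (Fin n) ℝ}
    (hμ : IsSphereTensor μ) {c : ℝ} (hc : 0 < c) {p : Fin (n + 1) → ℝ}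
    (hp : InChronologicalFuture (energyMomentum c μ) p) :
    ∃ ψ : E n → ℝ, ContDiffOn ℝ ∞ (fun y => ψ (angle y)) {0}ᶜ ∧ (∀ y, y ≠ 0 → 0 < ψ (angle y)) ∧
      energyMomentum c (shiftTensor μ ψ) = p := by
  have : NeZero n := ⟨by omega⟩
  have hn' : (0 : ℝ) < n - 1 := by
    have : (2 : ℝ) ≤ n := by exact_mod_cast hn
    linarith
  set d := 2 * c * ((n : ℝ) - 1)
  have hd : 0 < d := by positivity
  obtain ⟨ψ, hψ, hψ0, hv⟩ := mem_momentCone_of_timelike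
    (v := fun j => d⁻¹ * (p j - energyMomentum c μ j))
    (mul_pos (inv_pos.2 hd) (sub_pos.2 hp.1)) (by
      simp only [mul_pow, ← Finset.mul_sum]
      have := hp.2
      gcongr
      linarith)
  have hang : ContDiffOn ℝ ∞ (angle : E n → E n) {0}ᶜ := fun y hy =>
    (((contDiffAt_norm ℝ hy).inv (norm_ne_zero_iff.2 hy)).smul contDiffAt_id).contDiffWithinAt
  refine ⟨ψ, hψ.comp_contDiffOn hang, fun y hy => hψ0 _ (norm_angle hy), ?_⟩
  funext j
  rw [energyMomentum_shiftTensor hμ hψ.continuous, hv]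
  change _ + d * (d⁻¹ * (p j - energyMomentum c μ j)) = p j
  rw [mul_inv_cancel_left₀ hd.ne']
  ring

end EnergyMomentum

/-! ### Assembly of the deformation -/

section Deformation

variable {m : ℕ} {M : Type*} [TopologicalSpace M] [ChartedSpace (E (m + 1)) M]
  [IsManifold 𝓘(ℝ, E (m + 1)) ∞ M]

/-- Both `ψ` and the new sphere tensor are chosen once for all `ε`; only the cutoff in the metric
depends on `ε`. -/
theorem hasDeformation (hm : 2 ≤ m) {k : ℕ∞} (hk : 2 ≤ k) {g : RMetric (m + 1) k M} {x₀ : ℝ}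
    (hx₀ : 0 < x₀) (hx₀' : x₀ < 1) {φ : OpenPartialHomeomorph M (E (m + 1))}
    (hφ : IsEndChart x₀ φ) {μ : E (m + 1) → Matrix (Fin (m + 1)) (Fin (m + 1)) ℝ}
    (hμ : HasExpansion (coordMetric φ g) μ) (hdecay : HasDecay x₀ (coordMetric φ g))
    {c : ℝ} (hc : 0 < c) {p : Fin (m + 1 + 1) → ℝ}
    (hp : InChronologicalFuture (energyMomentum c μ) p) : HasDeformation c x₀ φ g p := by
  obtain ⟨ψ, hψ, hψ0, hE⟩ := exists_energyMomentum_shiftTensor (by omega) hμ.tensor hc hp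
  set a : E (m + 1) → ℝ := fun θ => 2 * (m + 1 : ℕ) * ψ θ
  have ha : ContDiffOn ℝ ∞ (fun y => a (angle y)) {0}ᶜ := contDiffOn_const.mul hψ
  have ha0 : ∀ y, y ≠ 0 → 0 < a (angle y) := fun y hy => mul_pos (by positivity) (hψ0 y hy)
  obtain ⟨C₁, hC₁⟩ := hdecay.bound
  obtain ⟨K, ρ, hK, hρ, hcurv⟩ := exists_radialCutoff_scalarCurvature (by omega : 1 ≤ m)
    (ha.of_le (WithTop.coe_le_coe.2 le_top)) ha0 C₁
  -- The perturbation lives in `x ≤ 2ε`. The first bound keeps this inside the collar and gives `ε₀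
  -- < x₀ / 4`; the second keeps it inside the region `‖y‖ < ρ` of the curvature estimate.
  set ε₀ := min (x₀ / 8) (ρ / 2)
  have hε₀ : 0 < ε₀ := by positivity
  -- For `ε` outside of the admissible range the default value is `g` itself, so that a function of
  -- all real `ε` can be chosen.
  have hex : ∀ ε, ∃ g' : RMetric (m + 1) k M, 0 < ε → ε < ε₀ →
      (∀ p, ¬ (p ∈ φ.source ∧ ‖φ p‖ ≤ 2 * ε) → g'.inner p = g.inner p) ∧
      ∀ y ∈ collar (m + 1) x₀,
        coordMetric φ g' y = coordMetric φ g y + radialBump a (radialCutoff K ε) y := by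
    intro ε
    by_cases h : 0 < ε ∧ ε < ε₀
    · have h8 : ε < x₀ / 8 := h.2.trans_le (min_le_left _ _)
      obtain ⟨g', h1, h2⟩ := exists_collarPerturbation g hφ ha ha0
        (X := radialCutoff K ε) contDiff_radialCutoff (fun t => radialCutoff_nonneg)
        (δ := 2 * ε) (fun t ht => radialCutoff_of_ge h.1 (by nlinarith [sq_nonneg ε]))
        (by linarith) (by linarith)
      exact ⟨g', fun _ _ => ⟨h1, h2⟩⟩
    · exact ⟨g, fun h1 h2 => absurd ⟨h1, h2⟩ h⟩
  choose gε hgε using hex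
  refine ⟨ε₀, hε₀, (min_le_left _ _).trans_lt (by linarith), gε, fun _ => shiftTensor μ ψ,
    fun ε hε hεε => ⟨fun q hq => (hgε ε hε hεε).1 q fun h => hq ⟨h.1, h.2.trans (by linarith)⟩,
      ?_, x₀, radialChart φ hψ hψ0 x₀, hx₀, hx₀', isEndChart_radialChart hψ hψ0 hφ,
      isRadialChange_radialChart hψ hψ0 (by omega) hφ hx₀,
      hasExpansion_radialChart hm hψ hψ0 hφ hx₀ hμ hK hε (hgε ε hε hεε).2⟩, ?_⟩
  · obtain ⟨C, hC, hmain⟩ := hcurv ε hε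
    refine ⟨C, fun y hy => ?_⟩
    have hyne : y ≠ 0 := norm_pos_iff.1 hy.1
    have hopen : collar (m + 1) x₀ ∈ 𝓝 y := by
      rw [← hφ.target_eq] at hy ⊢
      exact φ.open_target.mem_nhds hy
    by_cases hyρ : ‖y‖ < ρ
    · have he : coordMetric φ (gε ε) =ᶠ[𝓝 y]
          fun z => coordMetric φ g z + radialBump a (radialCutoff K ε) z := by
        filter_upwards [hopen] with z hz using (hgε ε hε hεε).2 z hz
      rw [scalarCurvature_congr he]
      refine hmain (coordMetric φ g) y hyne hyρ (fun i j => contDiffAt_coordMetric hk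
        hφ.mem_maximalAtlas g (by rwa [hφ.target_eq]) i j)
        (Filter.Eventually.of_forall fun z => coordMetric_isSymm φ g z) ?_
      refine le_trans (le_add_of_nonneg_right ?_) (hC₁ y hy)
      exact mul_nonneg (by positivity) (add_nonneg (add_nonneg tensorNorm_nonneg
        tensorNorm_nonneg) tensorNorm_nonneg)
    -- Beyond `ρ` the perturbation vanishes near `y`, so there the two curvatures agree.
    · have h2 : 2 * ε < ‖y‖ := by
        have := hεε.trans_le (min_le_right _ _)
        linarith
      have he : coordMetric φ (gε ε) =ᶠ[𝓝 y] coordMetric φ g := by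
        filter_upwards [hopen, (isOpen_lt continuous_const continuous_norm).mem_nhds h2] with z hz hz2
        have hz3 : 2 * ε ^ 2 ≤ ‖z‖ ^ 2 := by
          have hz2 : 2 * ε < ‖z‖ := hz2
          nlinarith
        rw [(hgε ε hε hεε).2 z hz, radialBump, radialCutoff_of_ge hε hz3, mul_zero, zero_smul,
          add_zero]
      rw [scalarCurvature_congr he, sub_self]
      exact ⟨le_rfl, by positivity⟩
  · simp only [hE]
    exact tendsto_const_nhds

lemma IsTimelikePast.inChronologicalFuture_zero {n : ℕ} {p : Fin (n + 1) → ℝ}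
    (hp : IsTimelikePast p) : InChronologicalFuture p 0 := by
  refine ⟨hp.1, ?_⟩
  simpa using hp.2

end Deformation

end AHMass

end

theorem corollary5p2 {n : ℕ} (hn : 3 ≤ n) {k : ℕ∞} (hk : 2 ≤ k)
    {M : Type*} [TopologicalSpace M] [T2Space M] [SecondCountableTopology M]
    [ChartedSpace (AHMass.E n) M] [IsManifold 𝓘(ℝ, AHMass.E n) ∞ M]
    (g : AHMass.RMetric n k M)
    (x₀ : ℝ) (hx₀ : 0 < x₀) (hx₀' : x₀ < 1)
    (φ : OpenPartialHomeomorph M (AHMass.E n)) (hφ : AHMass.IsEndChart x₀ φ)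
    (μ : AHMass.E n → Matrix (Fin n) (Fin n) ℝ)
    (hμ : AHMass.HasExpansion (AHMass.coordMetric φ g) μ)
    (hR : AHMass.ScalarIntegrable x₀ (AHMass.coordMetric φ g))
    (hdecay : AHMass.HasDecay x₀ (AHMass.coordMetric φ g))
    (c : ℝ) (hc : 0 < c) :
    (∀ m' : Fin (n + 1) → ℝ,
      AHMass.InChronologicalFuture (AHMass.energyMomentum c μ) m' →
        AHMass.HasDeformation c x₀ φ g m') ∧
    (AHMass.IsTimelikePast (AHMass.energyMomentum c μ) →
      AHMass.HasDeformation c x₀ φ g 0) := by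
  obtain ⟨m, rfl⟩ : ∃ m, n = m + 1 := ⟨n - 1, by omega⟩
  have hdef := fun p hp => AHMass.hasDeformation (by omega) hk hx₀ hx₀' hφ hμ hdecay hc (p := p) hp
  exact ⟨hdef, fun h => hdef 0 h.inChronologicalFuture_zero⟩
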